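/- **Setting.** Let $n\ge 1$, let $L$ be an even lattice of signature $(2,n)$ with quadratic form $q$ and bilinear form $(x,y)=q(x+y)-q(x)-q(y)$, $V=L\otimes\mathbb Q$, $V(\mathbb R)=L\otimes\mathbb R$. Let $e\in L$ be primitive isotropic, $e'\in L'$ with $(e,e')=1$, $\tilde e'=e'-q(e')e$, $W=e^\perp\cap e'^\perp$, and let $b_1,\dots,b_n$ be an orthogonal basis of $W(\mathbb R)$ with $q(b_1)=1$, $q(b_j)=-1$ for $j\ge2$; put $\epsilon_j=q(b_j)$. Let $\mathbb H_n$ be the component $y_1>0$ of $\{Z=X+iY=\sum_j z_jb_j\in W(\mathbb C): q(Y)>0\}$ and $\psi(Z)=Z-q(Z)e+\tilde e'$. Isometries $\sigma$ act by $j(\sigma,Z)\,\psi(\sigma Z)=\sigma\psi(Z)$ with $j(\sigma,Z)=(e,\sigma\psi(Z))$; $O^+(L)$ is the group of isometries of $L$ preserving $\mathbb H_n$. Let $\Gamma\subseteq O^+(L)$ be a congruence subgroup that is neat (for each $\gamma\in\Gamma$ the eigenvalues of $\gamma$ generate a torsion-free group). For $\kappa\in\mathbb Z$ the weight $\kappa$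 slash operator on functions and on differential forms on $\mathbb H_n$ is $\Phi|_\kappa\sigma=j(\sigma,Z)^{-\kappa}\sigma^*\Phi$; a form with values in $\mathcal L_\kappa$ (on a $\Gamma$-invariant open set) is a form invariant under $|_\kappa\gamma$ for all $\gamma\in\Gamma$. For $\lambda\in V(\mathbb R)$ and $Z\in\mathbb H_n$ let $\lambda_{Z^+}$ be the orthogonal projection of $\lambda$ to the plane spanned by the real and imaginary part of $\psi(Z)$, and $\lambda_{Z^-}=\lambda-\lambda_{Z^+}$. For $q(\mu)>0$ put $C_\mu=\{Z\in\mathbb H_n: q(\mu_{Z^-})=0\}$. **Operators.** Let $h^{ij}(Y)=4y_iy_j-2q(Y)\epsilon_i\delta_{ij}$ (the inverse of the matrix of the invariant hermitian metric with Kähler form $-\tfrac i2\partial\bar\partial\log q(Y)$), and $d\mu=(4iq(Y))^{-n}dz_1\wedge d\bar z_1\wedge\dots\wedge dz_n\wedge d\bar z_n$. The conjugate-linear Hodge operator $\bar *$ is given by $\alpha\wedge\bar *\beta=\langle\alpha,\beta\rangle\,d\mu$, where on $(p,q)$-forms $\langle\cdot,\cdot\rangle$ is $4^{p-q}$ times the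 inner product induced by the hermitian metric with $\langle dz_i,dz_j\rangle=\langle d\bar z_i,d\bar z_j\rangle=2h^{ij}$, $\langle dz_i,d\bar z_j\rangle=0$; this normalisation gives $d\bar z_i\wedge\bar * d\bar z_j=\tfrac12h^{ij}d\mu$, $\bar *1=d\mu$ and $\bar *d\mu=1$. Put $\bar *_\kappa=q(Y)^\kappa\,\bar *$, $\xi_\kappa=\bar *_\kappa\bar\partial$ and $\Delta_\kappa=\bar *_{-\kappa}\bar\partial\,\bar *_\kappa\bar\partial+\bar\partial\,\bar *_{-\kappa}\bar\partial\,\bar *_\kappa$. A form $H$ of weight $\kappa$ is harmonic if $\Delta_\kappa H=0$. **The series.** Let $\kappa\in\mathbb Z$, $\kappa>n$. For $\lambda\in V(\mathbb R)$ let $p_Z(\lambda)=\xi_1\frac{(\lambda,\psi(\bar Z))}{q(Y)}$ and, for $q(\lambda)>0$, $$\tilde p_Z(\lambda)=-\frac{(\lambda,\psi(Z))^{\kappa-1}}{4^\kappa(\kappa-\frac n2)}\,\frac{p_Z(\lambda)}{(-q(\lambda_{Z^-}))^{n/2}}\,q(\lambda_{Z^+})^{\frac n2-\kappa}\,{}_2F_1\Big(1-\tfrac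 n2,\kappa-\tfrac n2;\kappa-\tfrac n2+1;\tfrac{q(\lambda)}{q(\lambda_{Z^+})}\Big),$$ an $(n,n-1)$-form on $\mathbb H_n\setminus C_\lambda$. For $\mu\in V$ with $q(\mu)>0$ and $\Gamma_\mu$ its stabiliser in $\Gamma$ put $$\Omega_\mu^{\rm cusp}=\sum_{\gamma\in\Gamma_\mu\backslash\Gamma}\tilde p_Z(\mu)|_{-\kappa}\gamma,\qquad \omega_\mu^{\rm cusp}=\sum_{\gamma\in\Gamma_\mu\backslash\Gamma}(\mu,\psi(Z))^{-\kappa}|_\kappa\gamma .$$ **Theorem.** Let $\mu\in V$ with $q(\mu)>0$ and $U_\mu=\mathbb H_n\setminus\bigcup_{\gamma\in\Gamma}\gamma C_\mu$. 1. $\tilde p_Z(\mu)|_{-\kappa}\gamma=\tilde p_Z(\gamma^{-1}\mu)$ for all $\gamma\in\Gamma$ (so the terms only depend on the class of $\gamma$). The set $U_\mu$ is open, and the series $\Omega_\mu^{\rm cusp}$ converges absolutely and locally uniformly on $U_\mu$. It defines a real analytic $(n,n-1)$-form on $U_\mu$ with values in $\mathcal L_{-\kappa}$. 2. The series $\omega_\mu^{\rm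 cusp}$ converges absolutely on $\mathbb H_n$, and $\xi_{-\kappa}\Omega_\mu^{\rm cusp}=\omega_\mu^{\rm cusp}$ on $U_\mu$. Moreover $\Delta_{-\kappa}\Omega_\mu^{\rm cusp}=0$ on $U_\mu$, i.e. $\Omega_\mu^{\rm cusp}$ is harmonic outside the $\Gamma$-translates of $C_\mu$. 3. The image under $\xi_{-\kappa}$ of the complex vector space generated by the $\Omega_\mu^{\rm cusp}$ ($\mu\in V$, $q(\mu)>0$) is the complex vector space generated by the $\omega_\mu^{\rm cusp}$, where identities are understood outside the $\Gamma$-translates of finitely many cycles $C_\mu$. -/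

import Mathlib

open scoped BigOperators ComplexConjugate

noncomputable section

/-- An even lattice `L` of signature `(2, n)` in the real quadratic space `(V, q)`
(so `V` is `L ⊗ ℝ` and the bilinear form is `(x, y) = q (x + y) - q x - q y`), together with
a primitive isotropic vector `e ∈ L`, a vector `e'` in the dual lattice with `(e, e') = 1`, and an
orthonormal basis `b` of `W = e^⊥ ∩ e'^⊥`: `q (b 0) = 1`, `q (b j) = -1` for `j ≠ 0`. -/
structure LatticeSetup (n : ℕ) [NeZero n] (V : Type*) [AddCommGroup V] [Module ℝ V] where
  q : QuadraticForm ℝ V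
  L : Submodule ℤ V
  e : V
  e' : V
  b : Fin n → V
  finrank_eq : Module.finrank ℝ V = n + 2
  sigPos_eq : sigPos q = 2
  sigNeg_eq : sigNeg q = n
  lattice : ∃ B : Module.Basis (Fin (n + 2)) ℝ V, Submodule.span ℤ (Set.range B) = L
  even : ∀ x ∈ L, ∃ m : ℤ, q x = m
  e_mem : e ∈ L
  e_isotropic : q e = 0
  e_primitive : ∀ x ∈ L, ∀ m : ℤ, m • x = e → IsUnit m
  e'_dual : ∀ x ∈ L, ∃ m : ℤ, QuadraticMap.polar q e' x = m
  e_e' : QuadraticMap.polar q e e' = 1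
  b_e : ∀ j, QuadraticMap.polar q (b j) e = 0
  b_e' : ∀ j, QuadraticMap.polar q (b j) e' = 0
  b_norm : ∀ j, q (b j) = if j = 0 then 1 else -1
  b_orth : ∀ i j, i ≠ j → QuadraticMap.polar q (b i) (b j) = 0

/-- Complex valued differential forms of total degree `k` on (open subsets of) `ℂⁿ`. -/
abbrev Form (n k : ℕ) : Type :=
  (Fin n → ℂ) → (Fin n → ℂ) [⋀^Fin k]→L[ℝ] ℂ

namespace Form

variable {n k : ℕ}

/-- The form `Φ` is of type `(p, q)` at every point of `S`. -/
def IsOfType (p q : ℕ) (Φ : Form n k) (S : Set (Fin n → ℂ)) : Prop :=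
  p + q = k ∧ ∀ Z ∈ S, ∀ (c : ℂ) (v : Fin k → Fin n → ℂ),
    Φ Z (fun i => c • v i) = c ^ p * conj c ^ q * Φ Z v

/-- A function as a form of degree `0`. -/
def ofFun (f : (Fin n → ℂ) → ℂ) : Form n 0 :=
  fun Z => ContinuousAlternatingMap.constOfIsEmpty ℝ (Fin n → ℂ) (Fin 0) (f Z)

/-- The value of a form of degree `0`, as a function. -/
def toFun (Φ : Form n 0) : (Fin n → ℂ) → ℂ := fun Z => Φ Z Fin.elim0

/-- The conjugate linear part `v ↦ (T v + i T (i v)) / 2` of a real linear map. -/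
def conjLinearPart {F : Type*} [NormedAddCommGroup F] [NormedSpace ℝ F] [NormedSpace ℂ F]
    [SMulCommClass ℝ ℂ F] (T : (Fin n → ℂ) →L[ℝ] F) : (Fin n → ℂ) →L[ℝ] F :=
  (1 / 2 : ℂ) • (T + Complex.I • T.comp (Complex.I • ContinuousLinearMap.id ℝ (Fin n → ℂ)))

/-- The Dolbeault operator: `∂̄ (f dz_I ∧ dz̄_J) = ∑_k (∂f/∂z̄_k) dz̄_k ∧ dz_I ∧ dz̄_J`. -/
def dbar (Φ : Form n k) : Form n (k + 1) :=
  fun Z => ContinuousAlternatingMap.alternatizeUncurryFin (conjLinearPart (fderiv ℝ Φ Z))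

end Form

/-- Insert the vectors `r` into the first `k` slots of an alternating map. -/
def contractFirst {n m k l : ℕ} (h : k + l = m) (η : (Fin n → ℂ) [⋀^Fin m]→L[ℝ] ℂ)
    (r : Fin k → Fin n → ℂ) : (Fin n → ℂ) [⋀^Fin l]→L[ℝ] ℂ where
  toFun w := η (fun i => Fin.append r w (Fin.cast h.symm i))
  map_update_add' := by
    subst h
    intro inst w i x y
    obtain rfl : inst = instDecidableEqFin l := Subsingleton.elim _ _
    have key : ∀ x : Fin n → ℂ, Fin.append r (Function.update w i x)
        = Function.update (Fin.append r w) (Fin.natAdd k i) x := by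
      intro x
      funext j
      refine Fin.addCases (fun a => ?_) (fun a => ?_) j
      · have : Fin.castAdd l a ≠ Fin.natAdd k i := by
          intro h
          have := congrArg Fin.val h
          simp at this
          omega
        simp [Function.update_of_ne this]
      · by_cases ha : a = i
        · subst ha; simp
        · have : Fin.natAdd k a ≠ Fin.natAdd k i := by simpa using ha
          simp [Function.update_of_ne this, Function.update_of_ne ha]
    simp only [Fin.cast_eq_self, key]
    exact η.map_update_add _ _ _ _
  map_update_smul' := by
    subst h
    intro inst w i c x
    obtain rfl : inst = instDecidableEqFin l := Subsingleton.elim _ _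
    have key : ∀ x : Fin n → ℂ, Fin.append r (Function.update w i x)
        = Function.update (Fin.append r w) (Fin.natAdd k i) x := by
      intro x
      funext j
      refine Fin.addCases (fun a => ?_) (fun a => ?_) j
      · have : Fin.castAdd l a ≠ Fin.natAdd k i := by
          intro h
          have := congrArg Fin.val h
          simp at this
          omega
        simp [Function.update_of_ne this]
      · by_cases ha : a = i
        · subst ha; simp
        · have : Fin.natAdd k a ≠ Fin.natAdd k i := by simpa using ha
          simp [Function.update_of_ne this, Function.update_of_ne ha]
    simp only [Fin.cast_eq_self, key]
    exact η.map_update_smul _ _ _ _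
  map_eq_zero_of_eq' := by
    subst h
    intro w i j hij hne
    exact η.map_eq_zero_of_eq _ (i := Fin.natAdd k i) (j := Fin.natAdd k j)
      (by simpa using hij) (by simpa using hne)
  cont := by
    subst h
    refine η.cont.comp (continuous_pi fun i => ?_)
    refine Fin.addCases (fun a => ?_) (fun a => ?_) i
    · simpa using continuous_const
    · simpa using continuous_apply a

/-- The coframe `dz_0, dz̄_0, dz_1, dz̄_1, …` of `ℂⁿ`. -/
def coframe {n : ℕ} (a : Fin (2 * n)) (v : Fin n → ℂ) : ℂ :=
  if (a : ℕ) % 2 = 0 then v ⟨a / 2, by omega⟩ else conj (v ⟨a / 2, by omega⟩)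

/-- The form `dz_0 ∧ dz̄_0 ∧ dz_1 ∧ dz̄_1 ∧ …` of top degree on `ℂⁿ`. -/
def coordinateVolume (n : ℕ) : (Fin n → ℂ) [⋀^Fin (2 * n)]→L[ℝ] ℂ where
  toFun v := Matrix.det (Matrix.of fun j a => coframe a (v j))
  map_update_add' := by
    intro inst v i x y
    obtain rfl : inst = instDecidableEqFin (2 * n) := Subsingleton.elim _ _
    have key : ∀ x : Fin n → ℂ,
        (Matrix.of fun j a => coframe a (Function.update v i x j) : Matrix _ _ ℂ)
        = Matrix.updateRow (Matrix.of fun j a => coframe a (v j)) i (fun a => coframe a x) := by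
      intro x
      ext j a
      by_cases hj : j = i
      · subst hj; simp
      · simp [Matrix.updateRow_ne hj, Function.update_of_ne hj]
    rw [key, key, key, ← Matrix.det_updateRow_add]
    congr 2
    funext a
    simp only [coframe, Pi.add_apply]
    split_ifs <;> simp
  map_update_smul' := by
    intro inst v i c x
    obtain rfl : inst = instDecidableEqFin (2 * n) := Subsingleton.elim _ _
    have key : ∀ x : Fin n → ℂ,
        (Matrix.of fun j a => coframe a (Function.update v i x j) : Matrix _ _ ℂ)
        = Matrix.updateRow (Matrix.of fun j a => coframe a (v j)) i (fun a => coframe a x) := by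
      intro x
      ext j a
      by_cases hj : j = i
      · subst hj; simp
      · simp [Matrix.updateRow_ne hj, Function.update_of_ne hj]
    rw [key, key, Complex.real_smul, ← Matrix.det_updateRow_smul]
    congr 2
    funext a
    simp only [coframe, Pi.smul_apply, smul_eq_mul]
    split_ifs <;> simp
  map_eq_zero_of_eq' := by
    intro v i j hij hne
    exact Matrix.det_zero_of_row_eq hne (by funext a; simp [hij])
  cont := by
    refine Continuous.matrix_det (continuous_matrix fun i a => ?_)
    simp only [Matrix.of_apply, coframe]
    split_ifs <;> fun_prop

namespace LatticeSetup

variable {n : ℕ} [NeZero n] {V : Type*} [AddCommGroup V] [Module ℝ V] (M : LatticeSetup n V)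

/-! ### The orthogonal upper half plane -/

/-- The bilinear form `(x, y) = q (x + y) - q x - q y`. -/
def bil (x y : V) : ℝ := QuadraticMap.polar M.q x y

/-- The isotropic vector `ẽ' = e' - q(e') e`. -/
def et : V := M.e' - M.q M.e' • M.e

/-- The vector `∑ y_j b_j` of `W(ℝ)`. -/
def vec (y : Fin n → ℝ) : V := ∑ j, y j • M.b j

/-- The real part `X` of `Z = X + iY = ∑ z_j b_j`. -/
def X (Z : Fin n → ℂ) : V := M.vec fun j => (Z j).re

/-- The imaginary part `Y` of `Z = X + iY = ∑ z_j b_j`. -/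
def Y (Z : Fin n → ℂ) : V := M.vec fun j => (Z j).im

/-- `q(Y)`. -/
def qY (Z : Fin n → ℂ) : ℝ := M.q (M.Y Z)

/-- The component `ℍₙ` of `{Z = X + iY ∈ W(ℂ) | q(Y) > 0}` with `y_0 > 0`, in the coordinates given
by `b`. The other component is obtained by replacing `b 0` by `-b 0`. -/
def upperHalfPlane : Set (Fin n → ℂ) := {Z | 0 < M.qY Z ∧ 0 < (Z 0).im}

/-- The real part `X - (q(X) - q(Y)) e + ẽ'` of `ψ(Z) = Z - q(Z) e + ẽ'`. -/
def psiRe (Z : Fin n → ℂ) : V := M.X Z - (M.q (M.X Z) - M.q (M.Y Z)) • M.e + M.et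

/-- The imaginary part `Y - (X, Y) e` of `ψ(Z) = Z - q(Z) e + ẽ'`. -/
def psiIm (Z : Fin n → ℂ) : V := M.Y Z - M.bil (M.X Z) (M.Y Z) • M.e

/-- `(x, ψ(Z))`, for the complex bilinear extension of the bilinear form. -/
def pairPsi (x : V) (Z : Fin n → ℂ) : ℂ := M.bil x (M.psiRe Z) + Complex.I * M.bil x (M.psiIm Z)

/-- `(x, σ(ψ(Z)))`. -/
def pairAct (x : V) (σ : V ≃ₗ[ℝ] V) (Z : Fin n → ℂ) : ℂ :=
  M.bil x (σ (M.psiRe Z)) + Complex.I * M.bil x (σ (M.psiIm Z))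

/-- The factor of automorphy `j(σ, Z) = (e, σ(ψ(Z)))`. -/
def autFactor (σ : V ≃ₗ[ℝ] V) (Z : Fin n → ℂ) : ℂ := M.pairAct M.e σ Z

/-- The action `σZ = ψ⁻¹(σ(ψ(Z)))`, where `ψ⁻¹` of a line in `V(ℂ)` is computed by normalising
its generator to have `e`-pairing `1` and projecting to `W(ℂ)`; the `k`-th coordinate of
this projection is `q(b_k) (b_k, ·) / 2`. -/
def act (σ : V ≃ₗ[ℝ] V) (Z : Fin n → ℂ) : Fin n → ℂ :=
  fun k => M.q (M.b k) / 2 * M.pairAct (M.b k) σ Z / M.autFactor σ Z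

/-- Membership in `O⁺(L)`: isometries of `V(ℝ)` that preserve `L` and `ℍₙ`. -/
def InOPlus (σ : V ≃ₗ[ℝ] V) : Prop :=
  (∀ x, M.q (σ x) = M.q x) ∧ (∀ x, σ x ∈ M.L ↔ x ∈ M.L) ∧
    ∀ Z ∈ M.upperHalfPlane, M.act σ Z ∈ M.upperHalfPlane

/-- The group generated by the complex eigenvalues of `σ` is torsion free. -/
def IsNeat [Module.Finite ℝ V] (σ : V ≃ₗ[ℝ] V) : Prop :=
  ∀ x ∈ Subgroup.closure {x : ℂˣ |
      ((LinearMap.charpoly (σ : V →ₗ[ℝ] V)).map (algebraMap ℝ ℂ)).IsRoot (x : ℂ)},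
    ∀ m : ℕ, 0 < m → x ^ m = 1 → x = 1

/-- `Γ ⊆ O⁺(L)` is a neat congruence subgroup: it contains a principal congruence subgroup
`{σ ∈ O⁺(L) | σ ≡ id mod N L}` and all its elements are neat. -/
structure IsNeatCongruenceSubgroup [Module.Finite ℝ V] (Γ : Subgroup (V ≃ₗ[ℝ] V)) : Prop where
  inOPlus : ∀ σ ∈ Γ, M.InOPlus σ
  congruence : ∃ N : ℕ, 0 < N ∧ ∀ σ : V ≃ₗ[ℝ] V, M.InOPlus σ →
    (∀ x ∈ M.L, ∃ y ∈ M.L, σ x - x = N • y) → σ ∈ Γ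
  neat : ∀ σ ∈ Γ, IsNeat σ

/-- `x ∈ L ⊗ ℚ`. -/
def IsRational (x : V) : Prop := ∃ N : ℕ, 0 < N ∧ N • x ∈ M.L

/-! ### Real analytic cycles -/

/-- The orthogonal projection `x_{Z⁺}` of `x` to the positive plane `Z⁺` spanned by the orthogonal
vectors `ψ(X)`, `ψ(Y)` (real and imaginary part of `ψ(Z)`), both of `q`-value `q(Y)`. -/
def projPos (x : V) (Z : Fin n → ℂ) : V :=
  (M.bil x (M.psiRe Z) / (2 * M.qY Z)) • M.psiRe Z
    + (M.bil x (M.psiIm Z) / (2 * M.qY Z)) • M.psiIm Z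

/-- `q(x_{Z⁺})`. -/
def qPos (x : V) (Z : Fin n → ℂ) : ℝ := M.q (M.projPos x Z)

/-- `q(x_{Z⁻})`, where `x_{Z⁻} = x - x_{Z⁺}`. -/
def qNeg (x : V) (Z : Fin n → ℂ) : ℝ := M.q (x - M.projPos x Z)

/-- The cycle `C_μ = {Z ∈ ℍₙ | q(μ_{Z⁻}) = 0}`. -/
def cycle (μ : V) : Set (Fin n → ℂ) := {Z ∈ M.upperHalfPlane | M.qNeg μ Z = 0}

/-- The complement in `ℍₙ` of the `Γ`-translates of `C_μ`. -/
def regularSet (Γ : Subgroup (V ≃ₗ[ℝ] V)) (μ : V) : Set (Fin n → ℂ) :=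
  M.upperHalfPlane \ ⋃ γ ∈ Γ, M.act γ '' M.cycle μ

/-! ### Hermitian geometry -/

/-- The inverse `h^{ij}(Y) = 4 y_i y_j - 2 q(Y) ε_i δ_{ij}` of the matrix of the invariant hermitian
metric on `ℍₙ` with Kähler form
`-(i/2) ∂∂̄ log q(Y) = (i/2) ∑ h_{ij}(Y) dz_i ∧ dz̄_j`. -/
def hInv (Z : Fin n → ℂ) (i j : Fin n) : ℝ :=
  4 * (Z i).im * (Z j).im - if i = j then 2 * M.qY Z * M.q (M.b i) else 0

/-- The volume form `dμ(Z) = (4 i q(Y))⁻ⁿ dz_0 ∧ dz̄_0 ∧ dz_1 ∧ dz̄_1 ∧ …`. -/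
def vol (Z : Fin n → ℂ) : (Fin n → ℂ) [⋀^Fin (2 * n)]→L[ℝ] ℂ :=
  (1 / (4 * Complex.I * M.qY Z) ^ n) • coordinateVolume n

/-- The real frame `b_i, i b_i` of the tangent space `ℂⁿ`. -/
def frame (a : Fin n × Fin 2) : Fin n → ℂ := Pi.single a.1 (![1, Complex.I] a.2)

/-- The frame `frame`, with indices raised by `h^{ij}`. -/
def raisedFrame (Z : Fin n → ℂ) (a : Fin n × Fin 2) : Fin n → ℂ :=
  fun j => ![1, Complex.I] a.2 * M.hInv Z j a.1

/-- The conjugate linear Hodge operator `*̄` on forms of type `(p, q)`, given by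
`α ∧ *̄β = ⟨α, β⟩ dμ`, written out as the contraction of `dμ` with the metric dual of the
conjugate of `β`. The factor `4 ^ (p - q)` fixes the normalisation
`⟨dz̄_i, dz̄_j⟩ = h^{ij} / 2` of the inner product; with it
`*̄ dz̄_i = -(1/2) ∑_j h^{ij} (4 i q(Y))⁻ⁿ (dz̄_j-omitted form)`, `*̄ 1 = dμ`, `*̄ dμ = 1`, and
`*̄ *̄ = (-1)^{p+q}`. -/
def hodgeStar (p q : ℕ) {k l : ℕ} (h : k + l = 2 * n) (Φ : Form n k) : Form n l := fun Z =>
  ((4 : ℂ) ^ ((p : ℤ) - q) / (Nat.factorial k : ℂ)) •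
    ∑ a : Fin k → Fin n × Fin 2,
      conj (Φ Z fun s => frame (a s)) • contractFirst h (M.vol Z) fun s => M.raisedFrame Z (a s)

/-- The operator `*̄_κ(φ ⊗ F) = *̄ φ ⊗ F̄ q(Y)^κ` on `(p, q)`-forms of weight `κ`. -/
def hodgeStarWeight (κ : ℤ) (p q : ℕ) {k l : ℕ} (h : k + l = 2 * n) (Φ : Form n k) : Form n l :=
  fun Z => ((M.qY Z : ℂ) ^ κ) • M.hodgeStar p q h Φ Z

/-- The operator `ξ_κ = *̄_κ ∂̄` on `(p, q)`-forms of weight `κ`. -/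
def xi (κ : ℤ) (p q : ℕ) {k l : ℕ} (h : k + 1 + l = 2 * n) (Φ : Form n k) : Form n l :=
  M.hodgeStarWeight κ p (q + 1) h Φ.dbar

/-- The degree `2n - 2 + 1 = n + (n - 1)` of `(n, n - 1)`-forms. -/
theorem degree_eq : 2 * n - 2 + 1 + 1 + 0 = 2 * n := by
  have := NeZero.pos n
  omega

/-- The operator `ξ_κ` from `(n, n - 1)`-forms of weight `κ` to functions of weight `-κ`. -/
def xiTop (κ : ℤ) (Φ : Form n (2 * n - 2 + 1)) : (Fin n → ℂ) → ℂ :=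
  Form.toFun (M.xi κ n (n - 1) (l := 0) degree_eq Φ)

/-- The weight `κ` Laplace operator `Δ_κ = *̄_{-κ} ∂̄ *̄_κ ∂̄ + ∂̄ *̄_{-κ} ∂̄ *̄_κ` on
`(n, n - 1)`-forms. -/
def laplace (κ : ℤ) (Φ : Form n (2 * n - 2 + 1)) : Form n (2 * n - 2 + 1) :=
  M.hodgeStarWeight (-κ) 0 1 (by have := NeZero.pos n; omega)
      (M.hodgeStarWeight κ n n (l := 0) degree_eq Φ.dbar).dbar
    + (M.hodgeStarWeight (-κ) 0 2 (l := 2 * n - 2) (by have := NeZero.pos n; omega)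
        (M.hodgeStarWeight κ n (n - 1) (l := 1) (by have := NeZero.pos n; omega) Φ).dbar).dbar

/-! ### Slash operators, and the two families of forms -/

/-- The weight `κ` slash operator on functions. -/
def slashFun (κ : ℤ) (σ : V ≃ₗ[ℝ] V) (f : (Fin n → ℂ) → ℂ) : (Fin n → ℂ) → ℂ :=
  fun Z => M.autFactor σ Z ^ (-κ) * f (M.act σ Z)

/-- The weight `κ` slash operator `Φ ↦ j(σ, Z)^{-κ} σ^*Φ` on differential forms. -/
def slash (κ : ℤ) (σ : V ≃ₗ[ℝ] V) {k : ℕ} (Φ : Form n k) : Form n k :=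
  fun Z => (M.autFactor σ Z ^ (-κ)) •
    (Φ (M.act σ Z)).compContinuousLinearMap (fderiv ℝ (M.act σ) Z)

/-- The `(n, n - 1)`-form `p_Z(x) = ξ_1 ((x, ψ(Z̄)) / q(Y))`. -/
def pForm (x : V) : Form n (2 * n - 2 + 1) :=
  M.xi 1 0 0 (by have := NeZero.pos n; omega)
    (Form.ofFun fun Z => M.pairPsi x (fun j => conj (Z j)) / M.qY Z)

/-- The `(n, n - 1)`-form `p̃_Z(x)` for `q(x) > 0`. Here `(-1)^{n/2-1} q(x_{Z⁻})^{n/2}`, with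
`q(x_{Z⁻}) < 0`, is `-(-q(x_{Z⁻}))^{n/2}`. -/
def pTilde (κ : ℤ) (x : V) : Form n (2 * n - 2 + 1) := fun Z =>
  (M.pairPsi x Z ^ (κ - 1) *
    (((-M.qNeg x Z) ^ ((n : ℝ) / 2))⁻¹ * M.qPos x Z ^ ((n : ℝ) / 2 - κ) *
      ordinaryHypergeometric (1 - (n : ℝ) / 2) (κ - (n : ℝ) / 2) (κ - (n : ℝ) / 2 + 1)
        (M.q x / M.qPos x Z) / (-((4 : ℝ) ^ κ * (κ - (n : ℝ) / 2))) : ℝ)) • M.pForm x Z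

variable (Γ : Subgroup (V ≃ₗ[ℝ] V))

/-- The index set `Γ_μ \ Γ`. -/
abbrev Cosets (μ : V) : Type _ := Quotient (QuotientGroup.rightRel (MulAction.stabilizer Γ μ))

/-- The term `p̃_Z(μ)|_{-κ} γ` of the class of `γ` in `Γ_μ \ Γ` (it only depends on the class). -/
def OmegaTerm (κ : ℤ) (μ : V) (c : Cosets Γ μ) : Form n (2 * n - 2 + 1) :=
  M.slash (-κ) (c.out : Γ) (M.pTilde κ μ)

/-- The series `Ω_μ = ∑_{γ ∈ Γ_μ \ Γ} p̃_Z(μ)|_{-κ} γ`. -/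
def OmegaCusp (κ : ℤ) (μ : V) : Form n (2 * n - 2 + 1) := fun Z =>
  ∑' c : Cosets Γ μ, M.OmegaTerm Γ κ μ c Z

/-- The term `(μ, ψ(Z))^{-κ} |_κ γ` of the class of `γ` in `Γ_μ \ Γ` (it only depends on the
class). -/
def omegaTerm (κ : ℤ) (μ : V) (c : Cosets Γ μ) : (Fin n → ℂ) → ℂ :=
  M.slashFun κ (c.out : Γ) fun Z => 1 / M.pairPsi μ Z ^ κ

/-- Oda's cusp form `ω_μ = ∑_{γ ∈ Γ_μ \ Γ} (μ, ψ(Z))^{-κ} |_κ γ`. -/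
def omegaCusp (κ : ℤ) (μ : V) : (Fin n → ℂ) → ℂ := fun Z =>
  ∑' c : Cosets Γ μ, M.omegaTerm Γ κ μ c Z

/-- The space generated by the `Ω_μ`. -/
def HLoc (κ : ℤ) : Submodule ℂ (Form n (2 * n - 2 + 1)) :=
  Submodule.span ℂ {Φ | ∃ μ, M.IsRational μ ∧ 0 < M.q μ ∧ Φ = M.OmegaCusp Γ κ μ}

/-- The space generated by the `ω_μ`. -/
def omegaSpace (κ : ℤ) : Submodule ℂ ((Fin n → ℂ) → ℂ) :=
  Submodule.span ℂ {f | ∃ μ, M.IsRational μ ∧ 0 < M.q μ ∧ f = M.omegaCusp Γ κ μ}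

/-- `ξ_{-κ} Φ = f` holds on `ℍₙ` outside the `Γ`-translates of finitely many cycles `C_μ`. -/
def XiEqOffCycles (κ : ℤ) (Φ : Form n (2 * n - 2 + 1)) (f : (Fin n → ℂ) → ℂ) : Prop :=
  ∃ S : Finset V, (∀ μ ∈ S, M.IsRational μ ∧ 0 < M.q μ) ∧
    ∀ Z ∈ M.upperHalfPlane, (∀ μ ∈ S, Z ∈ M.regularSet Γ μ) → M.xiTop (-κ) Φ Z = f Z

end LatticeSetup

end

namespace LatticeSetup

variable {n : ℕ} [NeZero n] {V : Type*} [AddCommGroup V] [Module ℝ V] (M : LatticeSetup n V)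

/-! ### Coordinates -/

/-! The construction of p̃ is natural for isometries, so the term of γ is p̃ for the vector x = γ⁻¹μ
(`slash_pTilde`). Both series therefore run over the orbit Γμ, whose vectors all have norm m = q(μ)
and lie in one lattice N⁻¹L. What remains is a computation for a single x, and uniformity in x.

A single vector. Put a = (x, ψ(Z)), u = ā/q(Y) and s = q(x_{Z⁺}) = au/4. Since a is holomorphic, ∂̄s
= (a/4)∂̄u. The form p_Z(x) is essentially the Hodge dual of ∂̄u, and the contraction of its
coefficients with ∂̄u equals 4(s − m) (`sum_pCoeff_mul_betaCoeff`). Write p̃ = a^(κ-1) G(s) p_Z. In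
the basis of contractions of the volume form with ∂/∂z̄_j, ∂̄p̃ is a divergence, and it collapses to
a^κ ((s − m)G' + (n/2)G) times the volume density. The hypergeometric factor is the one for which
the bracket equals (4s)^(-κ) (`hasDerivAt_radial`), so the divergence is (q(Y)/ā)^κ times the
density (`exists_hasDbar_termCoeff`), and the Hodge operator turns it into a^(-κ). Conversely
*̄_{-κ}p̃ = -u^(κ-1) G(s) ∂̄u. It is ∂̄-closed, since every differential that occurs is a multiple
of ∂̄u (`exists_hasDbar_starCoeff`). Hence one half of the Laplacian vanishes because the limit ω is
holomorphic, the other because *̄p̃ is closed.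

Convergence. On vectors with q(x) ≥ 0 compactness gives |(x, ψ(Z))| ≥ δ‖x‖
(`exists_le_norm_pairPsi`), so the terms are O(‖x‖^(-κ)) and only lattice points have to be counted.
In the coordinates e, ẽ', b the condition q(x) = m reads ab + q(w) = m. For ab ≠ 0 the divisor bound
leaves O(‖w‖^(2/3)) pairs (a, b) over each w in a lattice of rank at most n. For ab = 0 the vector w
lies on a quadric, and a projection with fibres of at most two points reduces to rank n − 1
(`summable_cylinder`, `summable_quadric`). Both sums converge for κ ≥ n + 1.

Analyticity and termwise differentiation. The whole family of terms, divided by the weights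
‖x‖^(-κ), is one real analytic map into the Banach algebra of bounded families, and the series is a
bounded linear functional of it (`NormalSeries`). The ratios q(x)/q(x_{Z⁺}) form an element of norm
less than 1 exactly off the cycles (`norm_ratioFamily_lt_one_iff`). There the binomial and
hypergeometric series may be evaluated in the algebra, and the same criterion shows that U_μ is
open.

The statement on spans follows from the conjugate linearity of ξ on differentiable forms, by
induction over linear combinations. -/

theorem bil_comm (x y : V) : M.bil x y = M.bil y x := QuadraticMap.polar_comm _ _ _

theorem bil_add_left (x y z : V) : M.bil (x + y) z = M.bil x z + M.bil y z :=
  QuadraticMap.polar_add_left _ _ _ _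

theorem bil_smul_left (c : ℝ) (x z : V) : M.bil (c • x) z = c * M.bil x z :=
  QuadraticMap.polar_smul_left _ _ _ _

theorem bil_sub_left (x y z : V) : M.bil (x - y) z = M.bil x z - M.bil y z :=
  QuadraticMap.polar_sub_left _ _ _ _

theorem bil_add_right (x y z : V) : M.bil x (y + z) = M.bil x y + M.bil x z :=
  QuadraticMap.polar_add_right _ _ _ _

theorem bil_smul_right (c : ℝ) (x z : V) : M.bil x (c • z) = c * M.bil x z :=
  QuadraticMap.polar_smul_right _ _ _ _

theorem bil_sub_right (x y z : V) : M.bil x (y - z) = M.bil x y - M.bil x z :=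
  QuadraticMap.polar_sub_right _ _ _ _

theorem bil_self (x : V) : M.bil x x = 2 * M.q x := by
  simp [bil, QuadraticMap.polar_self]

theorem bil_sum_left {ι : Type*} (s : Finset ι) (f : ι → V) (z : V) :
    M.bil (∑ i ∈ s, f i) z = ∑ i ∈ s, M.bil (f i) z := by
  classical
  induction s using Finset.induction_on with
  | empty => simp [bil, QuadraticMap.polar]
  | insert a s ha ih => rw [Finset.sum_insert ha, Finset.sum_insert ha, bil_add_left, ih]

theorem bil_sum_right {ι : Type*} (s : Finset ι) (f : ι → V) (z : V) :
    M.bil z (∑ i ∈ s, f i) = ∑ i ∈ s, M.bil z (f i) := by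
  simp only [M.bil_comm z, bil_sum_left]

theorem q_eq_bil (x : V) : M.q x = M.bil x x / 2 := by rw [bil_self]; ring

theorem eps_sq (j : Fin n) : M.q (M.b j) * M.q (M.b j) = 1 := by
  rw [M.b_norm]; split_ifs <;> norm_num

theorem bil_e_e : M.bil M.e M.e = 0 := by rw [bil_self, M.e_isotropic, mul_zero]

theorem bil_e_et : M.bil M.e M.et = 1 := by
  rw [et, bil_sub_right, bil_smul_right, bil_e_e, mul_zero, sub_zero]; exact M.e_e'

theorem bil_et_e : M.bil M.et M.e = 1 := by rw [bil_comm, bil_e_et]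

theorem bil_et_et : M.bil M.et M.et = 0 := by
  have h1 : M.bil M.e' M.e = 1 := by rw [bil_comm]; exact M.e_e'
  have h2 : M.bil M.e M.e' = 1 := M.e_e'
  simp only [et, bil_sub_right, bil_smul_right, bil_sub_left, bil_smul_left, bil_e_e, h1, h2]
  rw [bil_self]
  ring

theorem bil_b_e (j : Fin n) : M.bil (M.b j) M.e = 0 := M.b_e j

theorem bil_e_b (j : Fin n) : M.bil M.e (M.b j) = 0 := by rw [bil_comm, bil_b_e]

theorem bil_b_et (j : Fin n) : M.bil (M.b j) M.et = 0 := by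
  have h : M.bil (M.b j) M.e' = 0 := M.b_e' j
  rw [et, bil_sub_right, bil_smul_right, bil_b_e, h]; ring

theorem bil_et_b (j : Fin n) : M.bil M.et (M.b j) = 0 := by rw [bil_comm, bil_b_et]

theorem bil_b_b (i j : Fin n) : M.bil (M.b i) (M.b j) = if i = j then 2 * M.q (M.b j) else 0 := by
  split_ifs with h
  · rw [h, bil_self]
  · exact M.b_orth i j h

theorem bil_vec_e (y : Fin n → ℝ) : M.bil (M.vec y) M.e = 0 := by
  simp [vec, bil_sum_left, bil_smul_left, bil_b_e]

theorem bil_vec_et (y : Fin n → ℝ) : M.bil (M.vec y) M.et = 0 := by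
  simp [vec, bil_sum_left, bil_smul_left, bil_b_et]

theorem bil_vec_b (y : Fin n → ℝ) (j : Fin n) : M.bil (M.vec y) (M.b j) = 2 * M.q (M.b j) * y j := by
  simp [vec, bil_sum_left, bil_smul_left, bil_b_b, mul_comm]

theorem bil_vec_vec (x y : Fin n → ℝ) :
    M.bil (M.vec x) (M.vec y) = 2 * ∑ j, M.q (M.b j) * x j * y j := by
  conv_lhs => rw [vec, vec, ← vec, bil_sum_right]
  simp only [bil_smul_right, bil_vec_b, Finset.mul_sum]
  exact Finset.sum_congr rfl fun _ _ => by ring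

theorem q_vec (y : Fin n → ℝ) : M.q (M.vec y) = ∑ j, M.q (M.b j) * y j ^ 2 := by
  rw [q_eq_bil, bil_vec_vec, mul_div_cancel_left₀ _ two_ne_zero]
  exact Finset.sum_congr rfl fun _ _ => by ring

/-- The vector with given coordinates in the basis `e, ẽ', b`. -/
noncomputable def ofCoord (p : ℝ × ℝ × (Fin n → ℝ)) : V := p.1 • M.e + p.2.1 • M.et + M.vec p.2.2

/-- The coordinates of a vector in the basis `e, ẽ', b`. -/
noncomputable def coord : V →ₗ[ℝ] ℝ × ℝ × (Fin n → ℝ) where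
  toFun x := (M.bil x M.et, M.bil x M.e, fun k => M.q (M.b k) / 2 * M.bil x (M.b k))
  map_add' x y := by
    simp only [bil_add_left, Prod.mk_add_mk, Prod.mk.injEq, true_and]
    funext k; simp [mul_add]
  map_smul' c x := by
    simp only [bil_smul_left, RingHom.id_apply, Prod.smul_mk, smul_eq_mul, Prod.mk.injEq, true_and]
    funext k; simp; ring

theorem coord_ofCoord (p : ℝ × ℝ × (Fin n → ℝ)) : M.coord (M.ofCoord p) = p := by
  obtain ⟨a, b, c⟩ := p
  simp only [coord, ofCoord, LinearMap.coe_mk, AddHom.coe_mk, bil_add_left, bil_smul_left, bil_e_et,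
    bil_et_et, bil_vec_et, bil_e_e, bil_et_e, bil_vec_e, bil_e_b, bil_et_b, bil_vec_b,
    Prod.mk.injEq]
  refine ⟨by ring, by ring, ?_⟩
  funext k
  linear_combination c k * M.eps_sq k

/-- The coordinate map has the right inverse `ofCoord`, and both sides have dimension n + 2. Hence
e, ẽ', b_1, …, b_n is a basis, and later arguments can compute in it. -/
theorem coord_injective : Function.Injective M.coord := by
  have hfin : Module.Finite ℝ V := Module.finite_of_finrank_pos (by rw [M.finrank_eq]; omega)
  refine (LinearMap.injective_iff_surjective_of_finrank_eq_finrank ?_).2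
    fun p => ⟨_, M.coord_ofCoord p⟩
  rw [M.finrank_eq]
  simp
  ring

theorem ofCoord_coord (x : V) : M.ofCoord (M.coord x) = x :=
  M.coord_injective (M.coord_ofCoord _)

theorem bil_eq (x y : V) : M.bil x y = M.bil x M.et * M.bil y M.e + M.bil x M.e * M.bil y M.et
    + ∑ k, M.q (M.b k) / 2 * M.bil x (M.b k) * M.bil y (M.b k) := by
  conv_lhs => rw [← M.ofCoord_coord x]
  simp only [ofCoord, coord, LinearMap.coe_mk, AddHom.coe_mk, bil_add_left, bil_smul_left,
    vec, bil_sum_left, M.bil_comm y]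

theorem q_eq (x : V) : M.q x = M.bil x M.et * M.bil x M.e
    + ∑ k, M.q (M.b k) / 4 * M.bil x (M.b k) ^ 2 := by
  rw [q_eq_bil, bil_eq, add_div, Finset.sum_div]
  congr 1
  · ring
  · exact Finset.sum_congr rfl fun _ _ => by ring

/-- The complex quadratic form `q(Z) = ∑ ε_j z_j²`. -/
noncomputable def qC (Z : Fin n → ℂ) : ℂ := ∑ j, (M.q (M.b j) : ℂ) * Z j ^ 2

theorem qY_eq (Z : Fin n → ℂ) : M.qY Z = ∑ j, M.q (M.b j) * (Z j).im ^ 2 := M.q_vec _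

/-- The pairing is a polynomial of degree two in Z alone, which is the source of its holomorphy. -/
theorem pairPsi_eq (x : V) (Z : Fin n → ℂ) : M.pairPsi x Z =
    M.bil x M.et - M.bil x M.e * M.qC Z + ∑ k, (M.bil x (M.b k) : ℂ) * Z k := by
  simp only [pairPsi, psiRe, psiIm, X, Y, bil_add_right, bil_sub_right, bil_smul_right, bil_vec_vec,
    q_vec, qC]
  simp only [vec, bil_sum_right, bil_smul_right]
  have h : ∀ k, Z k = (Z k).re + (Z k).im * Complex.I := fun k => (Complex.re_add_im _).symm
  have h1 : ∑ j, (M.q (M.b j) : ℂ) * Z j ^ 2 = ((∑ j, M.q (M.b j) * (Z j).re ^ 2 : ℝ) : ℂ)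
      - ((∑ j, M.q (M.b j) * (Z j).im ^ 2 : ℝ) : ℂ)
      + Complex.I * ((2 * ∑ j, M.q (M.b j) * (Z j).re * (Z j).im : ℝ) : ℂ) := by
    push_cast
    rw [Finset.mul_sum, Finset.mul_sum, ← Finset.sum_sub_distrib, ← Finset.sum_add_distrib]
    refine Finset.sum_congr rfl fun j _ => ?_
    conv_lhs => rw [h j]
    linear_combination (M.q (M.b j) : ℂ) * ((Z j).im : ℂ) ^ 2 * Complex.I_sq
  have h2 : ∑ k, (M.bil x (M.b k) : ℂ) * Z k = ((∑ k, (Z k).re * M.bil x (M.b k) : ℝ) : ℂ)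
      + Complex.I * ((∑ k, (Z k).im * M.bil x (M.b k) : ℝ) : ℂ) := by
    push_cast
    rw [Finset.mul_sum, ← Finset.sum_add_distrib]
    refine Finset.sum_congr rfl fun j _ => ?_
    conv_lhs => rw [h j]
    ring
  rw [h1, h2]
  push_cast
  ring

theorem q_psiRe (Z : Fin n → ℂ) : M.q (M.psiRe Z) = M.qY Z := by
  rw [q_eq_bil]
  simp only [psiRe, bil_add_left, bil_add_right, bil_sub_left, bil_sub_right, bil_smul_left,
    bil_smul_right, bil_e_e, bil_e_et, bil_et_e, bil_et_et, X, bil_vec_e, bil_vec_et,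
    M.bil_comm M.e (M.vec _), M.bil_comm M.et (M.vec _)]
  simp only [bil_self, qY, Y]
  ring

theorem q_psiIm (Z : Fin n → ℂ) : M.q (M.psiIm Z) = M.qY Z := by
  rw [q_eq_bil]
  simp only [psiIm, bil_sub_left, bil_sub_right, bil_smul_left, bil_smul_right, bil_e_e, Y,
    bil_vec_e, M.bil_comm M.e (M.vec _)]
  simp only [bil_self, qY, Y]
  ring

theorem bil_psiRe_psiIm (Z : Fin n → ℂ) : M.bil (M.psiRe Z) (M.psiIm Z) = 0 := by
  simp only [psiRe, psiIm, bil_add_left, bil_sub_left, bil_sub_right, bil_smul_left,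
    bil_smul_right, bil_e_e, bil_et_e, X, Y, bil_vec_e, bil_vec_et,
    M.bil_comm M.e (M.vec _), M.bil_comm M.et (M.vec _)]
  ring

theorem pairPsi_re (x : V) (Z : Fin n → ℂ) : (M.pairPsi x Z).re = M.bil x (M.psiRe Z) := by
  simp [pairPsi]

theorem pairPsi_im (x : V) (Z : Fin n → ℂ) : (M.pairPsi x Z).im = M.bil x (M.psiIm Z) := by
  simp [pairPsi]

/-- The real and imaginary parts of ψ(Z) are orthogonal and both have norm q(Y), so projecting onto
their plane is explicit. For q(Y) = 0 both sides are 0 by the convention on division. -/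
theorem qPos_eq (x : V) (Z : Fin n → ℂ) :
    M.qPos x Z = Complex.normSq (M.pairPsi x Z) / (4 * M.qY Z) := by
  rw [qPos, projPos, q_eq_bil, Complex.normSq_apply, pairPsi_re, pairPsi_im]
  simp only [bil_add_left, bil_add_right, bil_smul_left, bil_smul_right,
    bil_psiRe_psiIm, M.bil_comm (M.psiIm Z) (M.psiRe Z)]
  simp only [bil_self, q_psiRe, q_psiIm]
  rcases eq_or_ne (M.qY Z) 0 with h | h
  · simp [h]
  · field_simp; ring

theorem qNeg_eq (x : V) (Z : Fin n → ℂ) : M.qNeg x Z = M.q x - M.qPos x Z := by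
  have h1 : M.bil x (M.projPos x Z) = 2 * M.qPos x Z := by
    rw [qPos_eq, projPos, Complex.normSq_apply, pairPsi_re, pairPsi_im]
    simp only [bil_add_right, bil_smul_right]
    rcases eq_or_ne (M.qY Z) 0 with h | h
    · simp [h]
    · field_simp; ring
  rw [qNeg, q_eq_bil, bil_sub_left, bil_sub_right, bil_sub_right, bil_self, bil_self,
    M.bil_comm (M.projPos x Z) x, h1, ← qPos]
  ring

theorem b_zero : M.q (M.b 0) = 1 := by rw [M.b_norm, if_pos rfl]

theorem b_ne_zero {j : Fin n} (h : j ≠ 0) : M.q (M.b j) = -1 := by rw [M.b_norm, if_neg h]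

/-- The Lorentzian form is definite on the complement of a vector of positive norm. -/
theorem sum_eps_sq_neg {y d : Fin n → ℝ} (hy : 0 < ∑ j, M.q (M.b j) * y j ^ 2)
    (hd : ∑ j, M.q (M.b j) * y j * d j = 0) :
    ∑ j, M.q (M.b j) * d j ^ 2 ≤ 0 ∧ (∑ j, M.q (M.b j) * d j ^ 2 = 0 → d = 0) := by
  classical
  have split : ∀ f : Fin n → ℝ, ∑ j, M.q (M.b j) * f j = f 0 - ∑ j ∈ Finset.univ.erase 0, f j := by
    intro f
    rw [← Finset.add_sum_erase _ _ (Finset.mem_univ (0 : Fin n)), M.b_zero, one_mul, sub_eq_add_neg,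
      ← Finset.sum_neg_distrib]
    congr 1
    refine Finset.sum_congr rfl fun j hj => ?_
    rw [M.b_ne_zero (Finset.ne_of_mem_erase hj)]; ring
  rw [split] at hy
  simp only [mul_assoc] at hd
  rw [split] at hd ⊢
  -- Cauchy–Schwarz on the negative coordinates. With orthogonality it becomes (y₀d₀)² ≤ AB where A
  -- < y₀², which forces d₀² ≤ B.
  have cs := Finset.sum_mul_sq_le_sq_mul_sq (Finset.univ.erase (0 : Fin n)) y d
  set A := ∑ j ∈ Finset.univ.erase (0 : Fin n), y j ^ 2
  set B := ∑ j ∈ Finset.univ.erase (0 : Fin n), d j ^ 2 with hB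
  have hA0 : 0 ≤ A := Finset.sum_nonneg fun _ _ => sq_nonneg _
  have hB0 : 0 ≤ B := Finset.sum_nonneg fun _ _ => sq_nonneg _
  have h1 : (y 0 * d 0) ^ 2 ≤ A * B := by
    rw [show y 0 * d 0 = ∑ j ∈ Finset.univ.erase (0 : Fin n), y j * d j by linarith]
    exact cs
  have hy0 : 0 < y 0 ^ 2 := by linarith
  have h2 : y 0 ^ 2 * (B - d 0 ^ 2) ≥ (y 0 ^ 2 - A) * B := by nlinarith
  have h3 : 0 ≤ B - d 0 ^ 2 := by
    by_contra hneg
    have := mul_nonneg (by linarith : 0 ≤ y 0 ^ 2 - A) hB0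
    nlinarith
  refine ⟨by linarith, fun h => ?_⟩
  have hB' : B = 0 := by
    have : B - d 0 ^ 2 = 0 := by linarith
    rw [this] at h2
    nlinarith
  funext j
  by_cases hj : j = 0
  · subst hj
    have : d 0 ^ 2 = 0 := by linarith
    simpa using this
  · have := (Finset.sum_eq_zero_iff_of_nonneg (fun i _ => sq_nonneg (d i))).1 (hB ▸ hB') j
      (Finset.mem_erase.2 ⟨hj, Finset.mem_univ _⟩)
    simpa using this

/-- The orthogonal complement of the plane of `Z` is negative definite. -/
theorem q_neg_of_pairPsi_eq_zero {x : V} {Z : Fin n → ℂ} (hZ : 0 < M.qY Z)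
    (hx : M.pairPsi x Z = 0) (hq : 0 ≤ M.q x) : x = 0 := by
  have hre : M.bil x (M.psiRe Z) = 0 := by rw [← pairPsi_re, hx, Complex.zero_re]
  have him : M.bil x (M.psiIm Z) = 0 := by rw [← pairPsi_im, hx, Complex.zero_im]
  set β := M.bil x M.e with hβ
  set α := M.bil x M.et with hα
  set c : Fin n → ℝ := fun k => M.q (M.b k) / 2 * M.bil x (M.b k) with hc
  have hco : ∀ k, M.bil x (M.b k) = 2 * M.q (M.b k) * c k := fun k => by
    rw [hc]; linear_combination -(M.bil x (M.b k)) * M.eps_sq k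
  set y : Fin n → ℝ := fun j => (Z j).im
  set u : Fin n → ℝ := fun j => (Z j).re
  have hYq : M.qY Z = ∑ j, M.q (M.b j) * y j ^ 2 := M.qY_eq Z
  simp only [psiRe, psiIm, X, Y, bil_add_right, bil_sub_right, bil_smul_right, bil_vec_vec, q_vec]
    at hre him
  simp only [vec, bil_sum_right, bil_smul_right, hco, ← hβ, ← hα] at hre him
  -- Vanishing of the imaginary part of the pairing says that c − βu is orthogonal to Y in W.
  have hd : ∑ j, M.q (M.b j) * y j * (c j - β * u j) = 0 := by
    have : ∑ j, M.q (M.b j) * y j * (c j - β * u j) =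
        (∑ j, y j * (2 * M.q (M.b j) * c j) - 2 * (∑ j, M.q (M.b j) * u j * y j) * β) / 2 := by
      rw [eq_div_iff two_ne_zero, Finset.sum_mul, Finset.mul_sum, Finset.sum_mul,
        ← Finset.sum_sub_distrib]
      exact Finset.sum_congr rfl fun _ _ => by ring
    rw [this]
    linarith
  obtain ⟨h1, h2⟩ := M.sum_eps_sq_neg (hYq ▸ hZ) hd
  -- Vanishing of the real part allows completing the square. Both summands are then non-positive,
  -- so q(x) ≥ 0 makes both zero.
  have h3 : M.q x = -β ^ 2 * M.qY Z + ∑ j, M.q (M.b j) * (c j - β * u j) ^ 2 := by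
    have e1 : ∑ k, M.q (M.b k) / 4 * M.bil x (M.b k) ^ 2 = ∑ k, M.q (M.b k) * c k ^ 2 := by
      refine Finset.sum_congr rfl fun k _ => ?_
      rw [hco]
      linear_combination M.q (M.b k) * c k ^ 2 * M.eps_sq k
    have e2 : ∑ j, M.q (M.b j) * (c j - β * u j) ^ 2 = ∑ k, M.q (M.b k) * c k ^ 2
        - β * ∑ j, u j * (2 * M.q (M.b j) * c j) + β ^ 2 * ∑ j, M.q (M.b j) * u j ^ 2 := by
      rw [Finset.mul_sum, Finset.mul_sum, ← Finset.sum_sub_distrib, ← Finset.sum_add_distrib]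
      exact Finset.sum_congr rfl fun _ _ => by ring
    rw [q_eq, e1, e2, hYq, ← hα, ← hβ]
    linear_combination β * hre
  have hβ0 : β = 0 := by
    by_contra hne
    have : 0 < β ^ 2 * M.qY Z := by positivity
    linarith
  have h4 := h2 (by rw [hβ0] at h3 h1 ⊢; simp at h3 h1 ⊢; linarith)
  have hc0 : c = 0 := by funext j; have := congrFun h4 j; simpa [hβ0] using this
  have hα0 : α = 0 := by simpa [hβ0, hc0] using hre
  apply M.coord_injective
  rw [map_zero]
  exact Prod.ext hα0 (Prod.ext hβ0 hc0)

end LatticeSetup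

/-! ### Lattice points on a quadric -/

/-- A series whose terms are pulled back along a map with controlled fibres converges. -/
theorem summable_comp_of_card_fiber {X Y : Type*} (f : X → Y) (g N : Y → ℝ) (hg : ∀ y, 0 ≤ g y)
    (hN : ∀ (y : Y) (S : Finset X), (∀ x ∈ S, f x = y) → (S.card : ℝ) ≤ N y)
    (h : Summable fun y => N y * g y) : Summable fun x => g (f x) := by
  classical
  have hN0 : ∀ y, 0 ≤ N y := fun y => by simpa using hN y ∅ (by simp)
  refine summable_of_sum_le (c := ∑' y, N y * g y) (fun x => hg _) fun S => ?_
  have h1 : ∑ x ∈ S, g (f x) = ∑ y ∈ S.image f, ∑ x ∈ S.filter (fun x => f x = y), g (f x) :=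
    (Finset.sum_fiberwise_of_maps_to (fun x hx => Finset.mem_image_of_mem f hx) _).symm
  rw [h1]
  refine (Finset.sum_le_sum fun y _ => ?_).trans
    (h.sum_le_tsum _ fun y _ => mul_nonneg (hN0 y) (hg y))
  rw [Finset.sum_congr rfl (g := fun _ => g y) fun x hx => by rw [(Finset.mem_filter.1 hx).2],
    Finset.sum_const, nsmul_eq_mul]
  exact mul_le_mul_of_nonneg_right (hN y _ fun x hx => (Finset.mem_filter.1 hx).2) (hg y)

/-- Local factor of the divisor bound. For p ≥ 8 one has p^(v/3) ≥ 2^v ≥ v + 1. For smaller p the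
constant 5 suffices, because 2^(v/3) ≥ 1 + (v/3) log 2 and (5/3) log 2 > 1. -/
theorem succ_le_five_mul_rpow {p : ℕ} (hp : 2 ≤ p) (v : ℕ) :
    ((v : ℝ) + 1) ≤ (if p < 8 then 5 else 1) * (p : ℝ) ^ ((v : ℝ) / 3) := by
  split_ifs with h
  · have h1 : (2 : ℝ) ^ ((v : ℝ) / 3) ≤ (p : ℝ) ^ ((v : ℝ) / 3) :=
      Real.rpow_le_rpow (by norm_num) (by exact_mod_cast hp) (by positivity)
    have h2 : Real.log 2 * ((v : ℝ) / 3) + 1 ≤ (2 : ℝ) ^ ((v : ℝ) / 3) := by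
      rw [Real.rpow_def_of_pos (by norm_num)]; exact Real.add_one_le_exp _
    have h3 := Real.log_two_gt_d9
    have hv : (0 : ℝ) ≤ v := Nat.cast_nonneg v
    nlinarith
  · have h1 : (8 : ℝ) ^ ((v : ℝ) / 3) ≤ (p : ℝ) ^ ((v : ℝ) / 3) :=
      Real.rpow_le_rpow (by norm_num) (by exact_mod_cast (not_lt.1 h)) (by positivity)
    have h2 : (8 : ℝ) ^ ((v : ℝ) / 3) = 2 ^ v := by
      rw [show (8 : ℝ) = 2 ^ (3 : ℝ) by norm_num, ← Real.rpow_mul (by norm_num),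
        mul_div_cancel₀ _ (by norm_num), Real.rpow_natCast]
    have h3 : (v : ℝ) + 1 ≤ 2 ^ v := by exact_mod_cast Nat.lt_two_pow_self (n := v)
    linarith

/-- The number of divisors of `k` is `O(k^{1/3})`. -/
theorem card_divisors_le_rpow (k : ℕ) (hk : k ≠ 0) :
    (k.divisors.card : ℝ) ≤ 5 ^ 8 * (k : ℝ) ^ (1 / 3 : ℝ) := by
  have h1 : (k : ℝ) ^ (1 / 3 : ℝ) =
      ∏ p ∈ k.primeFactors, (p : ℝ) ^ ((k.factorization p : ℝ) / 3) := by
    conv_lhs => rw [← Nat.prod_factorization_pow_eq_self hk, Finsupp.prod, Nat.support_factorization]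
    push_cast
    rw [← Real.finsetProd_rpow _ _ fun i _ => by positivity]
    refine Finset.prod_congr rfl fun p _ => ?_
    rw [← Real.rpow_natCast, ← Real.rpow_mul (by positivity)]
    ring_nf
  -- A crude count: at most eight numbers are below 8, so the factor 5 occurs at most eight times.
  have h2 : ∏ p ∈ k.primeFactors, (if p < 8 then (5 : ℝ) else 1) ≤ 5 ^ 8 := by
    rw [Finset.prod_ite, Finset.prod_const_one, mul_one, Finset.prod_const]
    refine pow_le_pow_right₀ (by norm_num) ?_
    calc _ ≤ (Finset.range 8).card :=
          Finset.card_le_card fun p hp => Finset.mem_range.2 (Finset.mem_filter.1 hp).2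
      _ = 8 := by simp
  rw [Nat.card_divisors hk, h1]
  push_cast
  calc _ ≤ ∏ p ∈ k.primeFactors,
        ((if p < 8 then (5 : ℝ) else 1) * (p : ℝ) ^ ((k.factorization p : ℝ) / 3)) :=
        Finset.prod_le_prod (fun _ _ => by positivity) fun p hp =>
          succ_le_five_mul_rpow (Nat.prime_of_mem_primeFactors hp).two_le _
    _ ≤ _ := by
        rw [Finset.prod_mul_distrib]
        exact mul_le_mul_of_nonneg_right h2 (Finset.prod_nonneg fun _ _ => by positivity)

/-- The number of factorisations of a non-zero integer into two integers. -/
theorem card_factorisations_le (t : ℤ) (ht : t ≠ 0) (S : Finset (ℤ × ℤ))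
    (hS : ∀ p ∈ S, p.1 * p.2 = t) : S.card ≤ t.natAbs.divisors.card * 2 := by
  have : (t.natAbs.divisors ×ˢ (Finset.univ : Finset Bool)).card = t.natAbs.divisors.card * 2 := by
    simp
  rw [← this]
  -- The first factor determines the second, and it is itself determined by its absolute value, a
  -- divisor of |t|, and its sign.
  refine Finset.card_le_card_of_injOn (fun p => (p.1.natAbs, decide (0 ≤ p.1))) ?_ ?_
  · intro p hp
    simp only [Finset.coe_product, Set.mem_prod, Finset.mem_coe, Nat.mem_divisors,
      Finset.mem_univ, and_true]
    exact ⟨Int.natAbs_dvd_natAbs.2 ⟨p.2, (hS p hp).symm⟩, by simpa using ht⟩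
  · rintro ⟨a, b⟩ hp ⟨c, d⟩ hq h
    simp only [Prod.mk.injEq, decide_eq_decide] at h
    have e1 := hS _ hp
    have e2 := hS _ hq
    simp only at e1 e2
    have hac : a = c := by omega
    subst hac
    have ha : a ≠ 0 := by rintro rfl; simp at e1; exact ht e1.symm
    rw [Prod.mk.injEq]
    exact ⟨rfl, mul_left_cancel₀ ha (e1.trans e2.symm)⟩

section ZLattice

variable {E : Type*} [NormedAddCommGroup E] [NormedSpace ℝ E] [FiniteDimensional ℝ E]

/-- Adding 1 keeps the bound meaningful at the zero vector, which does occur as a projection of a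
lattice point. -/
theorem ZLattice.summable_one_add_norm_rpow (L : Submodule ℤ E) [DiscreteTopology L] (r : ℝ)
    (hr : r < -Module.finrank ℤ L) : Summable fun z : L => (1 + ‖z‖) ^ r := by
  have hr0 : r ≤ 0 := hr.le.trans (by simp)
  refine (ZLattice.summable_norm_rpow L r hr).of_norm_bounded_eventually ?_
  refine (Set.finite_singleton (0 : L)).subset fun z hz => ?_
  by_contra hne
  apply hz
  have hpos : 0 < ‖z‖ := norm_pos_iff.2 hne
  rw [Set.mem_ofPred_eq, Real.norm_of_nonneg (by positivity)]
  exact Real.rpow_le_rpow_of_nonpos hpos (by linarith) hr0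

/-- For a discrete subgroup the ℤ-rank equals the real dimension of its span. -/
theorem finrank_int_le_of_le (L : Submodule ℤ E) [DiscreteTopology L] (U : Submodule ℝ E)
    (h : ∀ x ∈ L, x ∈ U) : Module.finrank ℤ L ≤ Module.finrank ℝ U := by
  have hd : DiscreteTopology (Submodule.span ℤ (L : Set E)) := by
    rw [Submodule.span_eq]; infer_instance
  have h1 := Real.finrank_eq_int_finrank_of_discrete hd
  rw [Set.finrank, Set.finrank, Submodule.span_eq] at h1
  rw [← h1]
  exact Submodule.finrank_mono (Submodule.span_le.2 h)

end ZLattice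

theorem rpow_neg_le_of_le_mul {N c x κ : ℝ} (hκ : 0 ≤ κ) (hx : 0 < x) (hc : 0 < c)
    (h : x ≤ c * N) : N ^ (-κ) ≤ c ^ κ * x ^ (-κ) := by
  have hN : 0 < N := by
    by_contra hneg
    nlinarith [mul_nonneg hc.le (neg_nonneg.2 (not_lt.1 hneg))]
  have h1 : (c * N) ^ (-κ) ≤ x ^ (-κ) := Real.rpow_le_rpow_of_nonpos hx h (by linarith)
  rw [Real.mul_rpow hc.le hN.le, Real.rpow_neg hc.le] at h1
  have h2 : 0 < c ^ κ := Real.rpow_pos_of_pos hc _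
  calc N ^ (-κ) = c ^ κ * ((c ^ κ)⁻¹ * N ^ (-κ)) := by field_simp
    _ ≤ _ := mul_le_mul_of_nonneg_left h1 h2.le

section Quadric

variable {n : ℕ} (ε : Fin n → ℝ)

theorem abs_sum_eps_le (hε : ∀ j, |ε j| ≤ 1) (x y : Fin n → ℝ) : |∑ j, ε j * x j * y j| ≤ n * ‖x‖ * ‖y‖ := by
  calc |∑ j, ε j * x j * y j| ≤ ∑ j : Fin n, ‖x‖ * ‖y‖ := by
        refine (Finset.abs_sum_le_sum_abs _ _).trans (Finset.sum_le_sum fun j _ => ?_)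
        rw [abs_mul, abs_mul]
        have h1 := norm_le_pi_norm x j
        have h2 := norm_le_pi_norm y j
        rw [Real.norm_eq_abs] at h1 h2
        calc |ε j| * |x j| * |y j| ≤ 1 * ‖x‖ * ‖y‖ := by
              gcongr; exact hε j
          _ = _ := by ring
    _ = _ := by simp; ring

variable (Λ : Submodule ℤ (Fin n → ℝ)) [DiscreteTopology Λ]

/-- Lattice points on `ℤ ×` an affine quadric. -/
theorem summable_cylinder (hε : ∀ j, |ε j| ≤ 1) (m : ℝ) (hm : 0 < m) (κ : ℝ) (hκ : n + 1 ≤ κ)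
    (hint : ∀ x ∈ Λ, ∀ y ∈ Λ, ∃ k : ℤ, 2 * ∑ j, ε j * x j * y j = k) :
    Summable fun z : {z : ℤ × Λ // ∑ j, ε j * (z.2 : Fin n → ℝ) j * (z.2 : Fin n → ℝ) j = m} =>
      max |(z.1.1 : ℝ)| ‖(z.1.2 : Fin n → ℝ)‖ ^ (-κ) := by
  classical
  rcases isEmpty_or_nonempty
    {z : ℤ × Λ // ∑ j, ε j * (z.2 : Fin n → ℝ) j * (z.2 : Fin n → ℝ) j = m} with hemp | ⟨⟨z₀, hz₀⟩⟩
  · exact summable_empty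
  obtain ⟨v, hv⟩ : ∃ v : Λ, v = z₀.2 := ⟨_, rfl⟩
  rw [← hv] at hz₀
  let B : (Fin n → ℝ) →ₗ[ℝ] ℝ :=
    { toFun := fun x => 2 * ∑ j, ε j * x j * (v : Fin n → ℝ) j
      map_add' := fun x y => by
        rw [← mul_add, ← Finset.sum_add_distrib]
        congr 1; exact Finset.sum_congr rfl fun _ _ => by simp; ring
      map_smul' := fun c x => by
        simp only [Pi.smul_apply, smul_eq_mul, RingHom.id_apply, Finset.mul_sum]
        exact Finset.sum_congr rfl fun _ _ => by ring }
  have hB : ∀ x, B x = 2 * ∑ j, ε j * x j * (v : Fin n → ℝ) j := fun _ => rfl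
  have hBv : B v = 2 * m := by rw [hB, hz₀]
  -- The part of the lattice orthogonal to a fixed vector v of norm m. Since B v = 2m ≠ 0, its rank
  -- is at most n − 1.
  let Λ' : Submodule ℤ (Fin n → ℝ) := Λ ⊓ (LinearMap.ker B).restrictScalars ℤ
  have hΛ' : ∀ x, x ∈ Λ' ↔ x ∈ Λ ∧ B x = 0 := fun x => by simp [Λ']
  have : DiscreteTopology Λ' := by
    refine DiscreteTopology.of_continuous_injective (f := Submodule.inclusion inf_le_left)
      ?_ (Submodule.inclusion_injective (inf_le_left : Λ' ≤ Λ))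
    exact continuous_subtype_val.subtype_mk _
  have hrank : Module.finrank ℤ Λ' + 1 ≤ n := by
    have h1 := finrank_int_le_of_le Λ' (LinearMap.ker B) fun x hx => ((hΛ' x).1 hx).2
    have h2 : Module.finrank ℝ (LinearMap.ker B) < Module.finrank ℝ (Fin n → ℝ) := by
      refine Submodule.finrank_lt fun h => ?_
      have : (v : Fin n → ℝ) ∈ LinearMap.ker B := h ▸ Submodule.mem_top
      rw [LinearMap.mem_ker, hBv] at this
      linarith
    rw [Module.finrank_fin_fun] at h2
    omega
  obtain ⟨k₀, hk₀⟩ := hint v v.2 v v.2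
  rw [hz₀] at hk₀
  -- Orthogonal projection along v, scaled by 2m so that its values stay in the lattice: both 2m and
  -- (w, v) are integers.
  let π : Λ → Λ' := fun w => ⟨(2 * m) • (w : Fin n → ℝ) - (B w) • (v : Fin n → ℝ), by
    rw [hΛ']
    constructor
    · obtain ⟨k, hk⟩ := hint w w.2 v v.2
      rw [hk₀, hB, hk, Int.cast_smul_eq_zsmul, Int.cast_smul_eq_zsmul]
      exact Λ.sub_mem (Λ.smul_mem _ w.2) (Λ.smul_mem _ v.2)
    · rw [map_sub, map_smul, map_smul, hBv, smul_eq_mul, smul_eq_mul]; ring⟩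
  have hn : 0 < (n : ℝ) := by
    have : 1 ≤ n := by omega
    exact_mod_cast this
  set c₀ : ℝ := Real.sqrt (m / n) with hc₀
  have hc₀pos : 0 < c₀ := Real.sqrt_pos.2 (by positivity)
  set C : ℝ := 2 * m + 2 * n * ‖(v : Fin n → ℝ)‖ * ‖(v : Fin n → ℝ)‖ with hC
  have hCpos : 0 < C := by positivity
  have hπ : ∀ w : Λ, ‖π w‖ ≤ C * ‖(w : Fin n → ℝ)‖ := by
    intro w
    calc ‖π w‖ = ‖(2 * m) • (w : Fin n → ℝ) - (B w) • (v : Fin n → ℝ)‖ := rfl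
      _ ≤ ‖(2 * m) • (w : Fin n → ℝ)‖ + ‖(B w) • (v : Fin n → ℝ)‖ := norm_sub_le _ _
      _ ≤ 2 * m * ‖(w : Fin n → ℝ)‖
          + 2 * (n * ‖(w : Fin n → ℝ)‖ * ‖(v : Fin n → ℝ)‖) * ‖(v : Fin n → ℝ)‖ := by
        rw [norm_smul, norm_smul, Real.norm_of_nonneg (by linarith : 0 ≤ 2 * m), Real.norm_eq_abs,
          hB, abs_mul, abs_two]
        gcongr
        exact abs_sum_eps_le ε hε _ _
      _ = _ := by rw [hC]; ring
  have hw : ∀ w : Λ, ∑ j, ε j * (w : Fin n → ℝ) j * (w : Fin n → ℝ) j = m →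
      c₀ ≤ ‖(w : Fin n → ℝ)‖ := by
    intro w hw
    have h1 := abs_sum_eps_le ε hε (w : Fin n → ℝ) w
    rw [hw, abs_of_pos hm] at h1
    rw [hc₀, Real.sqrt_le_left (norm_nonneg _), div_le_iff₀ hn]
    nlinarith
  -- The exponent κ is split between the two directions. Any share between 1 and 2 for ℤ works; with
  -- 3/2 the rest satisfies κ − 3/2 > n − 1, which is at least the rank of Λ'.
  set g : ℤ × Λ' → ℝ := fun p => (1 + |(p.1 : ℝ)|) ^ (-(3 / 2 : ℝ)) * (1 + ‖p.2‖) ^ (-(κ - 3 / 2))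
    with hg
  have hsum : Summable g := by
    refine Summable.mul_of_nonneg (f := fun k : ℤ => (1 + |(k : ℝ)|) ^ (-(3 / 2 : ℝ)))
      (g := fun y : Λ' => (1 + ‖y‖) ^ (-(κ - 3 / 2))) ?_ ?_ (fun _ => by positivity)
      (fun _ => by positivity)
    · refine (Real.summable_abs_int_rpow (b := 3 / 2) (by norm_num)).of_norm_bounded_eventually ?_
      refine (Set.finite_singleton (0 : ℤ)).subset fun z hz => ?_
      by_contra hne
      apply hz
      have hpos : 0 < |(z : ℝ)| := abs_pos.2 (by exact_mod_cast hne)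
      rw [Set.mem_ofPred_eq, Real.norm_of_nonneg (by positivity)]
      exact Real.rpow_le_rpow_of_nonpos hpos (by linarith) (by norm_num)
    · refine ZLattice.summable_one_add_norm_rpow Λ' _ ?_
      have : (Module.finrank ℤ Λ' : ℝ) + 1 ≤ n := by exact_mod_cast hrank
      linarith
  have hmain := summable_comp_of_card_fiber
    (X := {z : ℤ × Λ // ∑ j, ε j * (z.2 : Fin n → ℝ) j * (z.2 : Fin n → ℝ) j = m})
    (fun z => ((z.1.1, π z.1.2) : ℤ × Λ')) g (fun _ => 2)
    (fun _ => by positivity) ?_ (hsum.mul_left 2)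
  · refine (hmain.mul_left ((1 / c₀ + 1) ^ (3 / 2 : ℝ) * (1 / c₀ + C) ^ (κ - 3 / 2))).of_nonneg_of_le
      (fun _ => by positivity) ?_
    rintro ⟨⟨b, w⟩, hz⟩
    simp only [hg]
    set N := max |(b : ℝ)| ‖(w : Fin n → ℝ)‖ with hN
    have hw' := hw w hz
    have hNc : c₀ ≤ N := hw'.trans (le_max_right _ _)
    have hN1 : 1 ≤ 1 / c₀ * N := by rw [one_div, ← div_eq_inv_mul, le_div_iff₀ hc₀pos]; linarith
    have hN0 : 0 < N := hc₀pos.trans_le hNc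
    have e : N ^ (-κ) = N ^ (-(3 / 2 : ℝ)) * N ^ (-(κ - 3 / 2)) := by
      rw [← Real.rpow_add hN0]; ring_nf
    have h1 : N ^ (-(3 / 2 : ℝ)) ≤ (1 / c₀ + 1) ^ (3 / 2 : ℝ) * (1 + |(b : ℝ)|) ^ (-(3 / 2 : ℝ)) := by
      refine rpow_neg_le_of_le_mul (by norm_num) (by positivity) (by positivity) ?_
      have : |(b : ℝ)| ≤ N := le_max_left _ _
      linarith
    have h2 : N ^ (-(κ - 3 / 2)) ≤ (1 / c₀ + C) ^ (κ - 3 / 2) * (1 + ‖π w‖) ^ (-(κ - 3 / 2)) := by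
      refine rpow_neg_le_of_le_mul (by linarith [Nat.one_le_cast (α := ℝ).2 (by omega : 1 ≤ n)])
        (by positivity) (by positivity) ?_
      have := (hπ w).trans (mul_le_mul_of_nonneg_left (le_max_right |(b : ℝ)| _) hCpos.le)
      rw [← hN] at this
      linarith
    rw [e]
    calc _ ≤ _ := mul_le_mul h1 h2 (by positivity) (by positivity)
      _ = _ := by ring
  · rintro ⟨b, y⟩ S hS
    rcases S.eq_empty_or_nonempty with rfl | ⟨⟨⟨b₁, w₁⟩, hz₁⟩, hmem⟩
    · simp
    have h1 := hS _ hmem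
    simp only [Prod.mk.injEq] at h1
    have hcard : S.card ≤ ({(w₁ : Fin n → ℝ), (w₁ : Fin n → ℝ) - (B w₁ / m) • (v : Fin n → ℝ)} :
        Finset (Fin n → ℝ)).card := by
      refine Finset.card_le_card_of_injOn (fun z => (z.1.2 : Fin n → ℝ)) ?_ ?_
      · rintro ⟨⟨b₂, w₂⟩, hz₂⟩ hmem₂
        have h2 := hS _ hmem₂
        simp only [Prod.mk.injEq] at h2
        have h3 : (2 * m) • (w₂ : Fin n → ℝ) - (B w₂) • (v : Fin n → ℝ)
            = (2 * m) • (w₁ : Fin n → ℝ) - (B w₁) • (v : Fin n → ℝ) :=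
          congrArg Subtype.val (h2.2.trans h1.2.symm)
        set t : ℝ := (B w₂ - B w₁) / (2 * m) with ht
        have h4 : (w₂ : Fin n → ℝ) = w₁ + t • (v : Fin n → ℝ) := by
          funext j
          have := congrFun h3 j
          simp only [Pi.sub_apply, Pi.smul_apply, smul_eq_mul] at this
          simp only [Pi.add_apply, Pi.smul_apply, smul_eq_mul, ht]
          field_simp
          linarith
        -- Two points in one fibre differ by tv. Comparing their norms gives a quadratic equation
        -- for t, whose roots correspond to w₁ and to its reflection in v.
        have h5 : m = m + t * B w₁ + t ^ 2 * m := by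
          conv_lhs => rw [← hz₂]
          conv_rhs => rw [← hz₁]
          simp only [h4, hB]
          conv_rhs => rw [hz₁, ← hz₀]
          conv_rhs => rw [hz₀]
          rw [show m + t * (2 * ∑ j, ε j * (w₁ : Fin n → ℝ) j * (v : Fin n → ℝ) j) + t ^ 2 * m
            = (∑ j, ε j * (w₁ : Fin n → ℝ) j * (w₁ : Fin n → ℝ) j)
              + t * (2 * ∑ j, ε j * (w₁ : Fin n → ℝ) j * (v : Fin n → ℝ) j)
              + t ^ 2 * ∑ j, ε j * (v : Fin n → ℝ) j * (v : Fin n → ℝ) j by rw [hz₁, hz₀]]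
          simp only [Finset.mul_sum, ← Finset.sum_add_distrib]
          exact Finset.sum_congr rfl fun _ _ => by simp; ring
        have h6 : t * (B w₁ + t * m) = 0 := by linarith
        rw [Finset.mem_coe, Finset.mem_insert, Finset.mem_singleton]
        rcases mul_eq_zero.1 h6 with h | h
        · left; simp [h4, h]
        · right
          have : t = -(B w₁ / m) := by field_simp; linarith
          simp [h4, this, sub_eq_add_neg]
      · rintro ⟨⟨b₂, w₂⟩, hz₂⟩ hm₂ ⟨⟨b₃, w₃⟩, hz₃⟩ hm₃ h
        have h2 := hS _ hm₂
        have h3 := hS _ hm₃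
        simp only [Prod.mk.injEq] at h2 h3
        simp only [Subtype.mk.injEq, Prod.mk.injEq]
        exact ⟨h2.1.trans h3.1.symm, Subtype.ext h⟩
    exact_mod_cast hcard.trans Finset.card_le_two

/-- Lattice points on the quadric `ab + ∑ ε_j w_j² = m`. -/
theorem summable_quadric (hε : ∀ j, |ε j| ≤ 1) (m : ℝ) (hm : 0 < m) (κ : ℝ) (hκ : n + 1 ≤ κ)
    (hint : ∀ x ∈ Λ, ∀ y ∈ Λ, ∃ k : ℤ, 2 * ∑ j, ε j * x j * y j = k) :
    Summable fun z : {z : ℤ × ℤ × Λ // (z.1 : ℝ) * z.2.1 +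
      ∑ j, ε j * (z.2.2 : Fin n → ℝ) j * (z.2.2 : Fin n → ℝ) j = m} =>
      ‖((z.1.1 : ℝ), (z.1.2.1 : ℝ), (z.1.2.2 : Fin n → ℝ))‖ ^ (-κ) := by
  classical
  set T := {z : ℤ × ℤ × Λ // (z.1 : ℝ) * z.2.1 +
      ∑ j, ε j * (z.2.2 : Fin n → ℝ) j * (z.2.2 : Fin n → ℝ) j = m}
  set F : T → ℝ := fun z => ‖((z.1.1 : ℝ), (z.1.2.1 : ℝ), (z.1.2.2 : Fin n → ℝ))‖ ^ (-κ) with hF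
  have hF0 : ∀ z, 0 ≤ F z := fun z => by positivity
  have hnorm : ∀ z : T, ‖((z.1.1 : ℝ), (z.1.2.1 : ℝ), (z.1.2.2 : Fin n → ℝ))‖
      = max |(z.1.1 : ℝ)| (max |(z.1.2.1 : ℝ)| ‖(z.1.2.2 : Fin n → ℝ)‖) := fun z => by
    simp [Prod.norm_def]
  have hκ0 : 0 < κ := by have : (0 : ℝ) ≤ n := Nat.cast_nonneg n; linarith
  have hcyl := summable_cylinder ε Λ hε m hm κ hκ hint
  -- On S₁ the product ab is a non-zero integer, so divisors control it. On S₂ and S₃ one of a, b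
  -- vanishes, the other is free, and `summable_cylinder` applies.
  set S₁ : Set T := {z | z.1.1 ≠ 0 ∧ z.1.2.1 ≠ 0}
  set S₂ : Set T := {z | z.1.1 = 0}
  set S₃ : Set T := {z | z.1.2.1 = 0}
  have h1 : Summable (S₁.indicator F) := by
    rw [← summable_subtype_iff_indicator]
    set a : ℝ := m + n + 1 with ha
    -- Over a fixed w the product ab = m − q(w) is O((1 + ‖w‖)²). The divisor bound with exponent
    -- 1/3 thus gives fibres of size O((1 + ‖w‖)^(2/3)), and κ − 2/3 still exceeds n.
    have hsum := summable_comp_of_card_fiber (X := S₁) (fun z => z.1.1.2.2)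
      (fun w : Λ => (1 + ‖w‖) ^ (-κ))
      (fun w : Λ => 5 ^ 8 * 2 * a ^ (1 / 3 : ℝ) * (1 + ‖w‖) ^ (2 / 3 : ℝ)) (fun _ => by positivity) ?_
      ?_
    · refine (hsum.mul_left (2 ^ κ)).of_nonneg_of_le (fun z => hF0 _) ?_
      rintro ⟨⟨⟨x, y, w⟩, hz⟩, hx, hy⟩
      simp only at hx hy
      refine rpow_neg_le_of_le_mul hκ0.le (by positivity) (by norm_num) ?_
      rw [Prod.norm_def, Prod.norm_def]
      have h1 : (1 : ℝ) ≤ |(x : ℝ)| := by exact_mod_cast Int.one_le_abs hx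
      have h2 := le_max_left ‖(x : ℝ)‖ (max ‖(y : ℝ)‖ ‖(w : Fin n → ℝ)‖)
      have h3 := (le_max_right ‖(y : ℝ)‖ ‖(w : Fin n → ℝ)‖).trans
        (le_max_right ‖(x : ℝ)‖ (max ‖(y : ℝ)‖ ‖(w : Fin n → ℝ)‖))
      rw [Real.norm_eq_abs (x : ℝ)] at h2 h3
      simp only [Real.norm_eq_abs (x : ℝ)]
      have h4 : ‖w‖ = ‖(w : Fin n → ℝ)‖ := rfl
      linarith
    · intro w S hS
      rcases S.eq_empty_or_nonempty with rfl | ⟨⟨⟨⟨x₀, y₀, w₀⟩, hz₀⟩, hx₀, hy₀⟩, hmem₀⟩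
      · simp; positivity
      simp only at hx₀ hy₀
      have hw₀ : w₀ = w := hS _ hmem₀
      subst hw₀
      have hxy : x₀ * y₀ ≠ 0 := mul_ne_zero hx₀ hy₀
      simp only at hz₀
      have hc : S.card ≤ (x₀ * y₀).natAbs.divisors.card * 2 := by
        have : S.card = (S.image fun z => (z.1.1.1, z.1.1.2.1)).card := by
          refine (Finset.card_image_of_injOn ?_).symm
          rintro ⟨⟨⟨x, y, w⟩, hz⟩, hx⟩ hm₁ ⟨⟨⟨x', y', w'⟩, hz'⟩, hx'⟩ hm₂ h
          have e1 : w = w₀ := hS _ hm₁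
          have e2 : w' = w₀ := hS _ hm₂
          simp only [Prod.mk.injEq] at h
          exact Subtype.ext (Subtype.ext (Prod.ext h.1 (Prod.ext h.2 (e1.trans e2.symm))))
        rw [this]
        refine card_factorisations_le _ hxy _ fun p hp => ?_
        obtain ⟨⟨⟨⟨x, y, w⟩, hz⟩, hx⟩, hm₁, rfl⟩ := Finset.mem_image.1 hp
        have e1 : w = w₀ := hS _ hm₁
        subst e1
        simp only at hz
        have : (x : ℝ) * y = x₀ * y₀ := by linarith
        exact_mod_cast this
      have hd := card_divisors_le_rpow (x₀ * y₀).natAbs (by simpa using hxy)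
      have ht : (((x₀ * y₀).natAbs : ℕ) : ℝ) ≤ a * (1 + ‖w₀‖) ^ 2 := by
        have e1 : (((x₀ * y₀).natAbs : ℕ) : ℝ) = |(x₀ : ℝ) * y₀| := by
          rw [Nat.cast_natAbs]; push_cast; rfl
        have e2 := abs_sum_eps_le ε hε (w₀ : Fin n → ℝ) w₀
        have e3 : (x₀ : ℝ) * y₀ = m - ∑ j, ε j * (w₀ : Fin n → ℝ) j * (w₀ : Fin n → ℝ) j := by
          linarith
        have h4 : ‖w₀‖ = ‖(w₀ : Fin n → ℝ)‖ := rfl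
        have h5 := norm_nonneg (w₀ : Fin n → ℝ)
        rw [e1, e3, h4, ha]
        have hn0 : (0 : ℝ) ≤ n := Nat.cast_nonneg n
        calc _ ≤ |m| + |∑ j, ε j * (w₀ : Fin n → ℝ) j * (w₀ : Fin n → ℝ) j| := abs_sub _ _
          _ ≤ m + n * ‖(w₀ : Fin n → ℝ)‖ * ‖(w₀ : Fin n → ℝ)‖ := by rw [abs_of_pos hm]; linarith
          _ ≤ _ := by nlinarith [mul_nonneg hm.le h5, mul_nonneg hn0 h5, mul_nonneg hm.le (mul_nonneg h5 h5)]
      have ht' : (((x₀ * y₀).natAbs : ℕ) : ℝ) ^ (1 / 3 : ℝ)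
          ≤ a ^ (1 / 3 : ℝ) * (1 + ‖w₀‖) ^ (2 / 3 : ℝ) := by
        refine (Real.rpow_le_rpow (by positivity) ht (by norm_num)).trans (le_of_eq ?_)
        rw [Real.mul_rpow (by positivity) (by positivity), ← Real.rpow_natCast,
          ← Real.rpow_mul (by positivity)]
        norm_num
      calc (S.card : ℝ) ≤ (x₀ * y₀).natAbs.divisors.card * 2 := by exact_mod_cast hc
        _ ≤ 5 ^ 8 * (a ^ (1 / 3 : ℝ) * (1 + ‖w₀‖) ^ (2 / 3 : ℝ)) * 2 := by
            refine mul_le_mul_of_nonneg_right (hd.trans ?_) (by norm_num)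
            exact mul_le_mul_of_nonneg_left ht' (by norm_num)
        _ = _ := by ring
    · have h1 : Summable fun w : Λ => (1 + ‖w‖) ^ (2 / 3 - κ) := by
        refine ZLattice.summable_one_add_norm_rpow Λ _ ?_
        have h2 := finrank_int_le_of_le Λ ⊤ fun _ _ => Submodule.mem_top
        rw [finrank_top, Module.finrank_fin_fun] at h2
        have h3 : (Module.finrank ℤ Λ : ℝ) ≤ n := by exact_mod_cast h2
        linarith
      refine (h1.mul_left (5 ^ 8 * 2 * a ^ (1 / 3 : ℝ))).congr fun w => ?_
      rw [mul_assoc _ _ ((1 + ‖w‖) ^ (-κ)), ← Real.rpow_add (by positivity), sub_eq_add_neg]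
  have h2 : Summable (S₂.indicator F) := by
    rw [← summable_subtype_iff_indicator]
    refine (hcyl.comp_injective (i := fun z : S₂ => ⟨(z.1.1.2.1, z.1.1.2.2), by
      have h := z.1.2; have h0 : z.1.1.1 = 0 := z.2; rw [h0] at h; simpa using h⟩) ?_).congr ?_
    · rintro ⟨⟨⟨x, y, w⟩, hz⟩, hx⟩ ⟨⟨⟨x', y', w'⟩, hz'⟩, hx'⟩ h
      have hx : x = 0 := hx
      have hx' : x' = 0 := hx'
      simp only [Subtype.mk.injEq, Prod.mk.injEq] at h
      exact Subtype.ext (Subtype.ext (Prod.ext (hx.trans hx'.symm) (Prod.ext h.1 h.2)))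
    · rintro ⟨⟨⟨x, y, w⟩, hz⟩, hx⟩
      have hx : x = 0 := hx
      subst hx
      simp only [Function.comp_apply, hF, hnorm]
      simp
  have h3 : Summable (S₃.indicator F) := by
    rw [← summable_subtype_iff_indicator]
    refine (hcyl.comp_injective (i := fun z : S₃ => ⟨(z.1.1.1, z.1.1.2.2), by
      have h := z.1.2; have h0 : z.1.1.2.1 = 0 := z.2; rw [h0] at h; simpa using h⟩) ?_).congr ?_
    · rintro ⟨⟨⟨x, y, w⟩, hz⟩, hx⟩ ⟨⟨⟨x', y', w'⟩, hz'⟩, hx'⟩ h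
      have hx : y = 0 := hx
      have hx' : y' = 0 := hx'
      simp only [Subtype.mk.injEq, Prod.mk.injEq] at h
      exact Subtype.ext (Subtype.ext (Prod.ext h.1 (Prod.ext (hx.trans hx'.symm) h.2)))
    · rintro ⟨⟨⟨x, y, w⟩, hz⟩, hx⟩
      have hx : y = 0 := hx
      subst hx
      simp only [Function.comp_apply, hF, hnorm]
      simp
  refine ((h1.add h2).add h3).of_nonneg_of_le hF0 fun z => ?_
  have i1 : 0 ≤ S₁.indicator F z := Set.indicator_nonneg (fun _ _ => hF0 _) _
  have i2 : 0 ≤ S₂.indicator F z := Set.indicator_nonneg (fun _ _ => hF0 _) _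
  have i3 : 0 ≤ S₃.indicator F z := Set.indicator_nonneg (fun _ _ => hF0 _) _
  by_cases hx : z.1.1 = 0
  · rw [Set.indicator_of_mem (show z ∈ S₂ from hx)]; linarith
  · by_cases hy : z.1.2.1 = 0
    · rw [Set.indicator_of_mem (show z ∈ S₃ from hy)]; linarith
    · rw [Set.indicator_of_mem (show z ∈ S₁ from ⟨hx, hy⟩)]; linarith

end Quadric

/-! ### Counting rational vectors of fixed norm and bounded denominator. -/

namespace LatticeSetup

variable {n : ℕ} [NeZero n] {V : Type*} [AddCommGroup V] [Module ℝ V] (M : LatticeSetup n V)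

theorem bil_int {x y : V} (hx : x ∈ M.L) (hy : y ∈ M.L) : ∃ k : ℤ, M.bil x y = k := by
  obtain ⟨a, ha⟩ := M.even _ (M.L.add_mem hx hy)
  obtain ⟨b, hb⟩ := M.even _ hx
  obtain ⟨c, hc⟩ := M.even _ hy
  exact ⟨a - b - c, by rw [bil, QuadraticMap.polar, ha, hb, hc]; push_cast; ring⟩

/-- The coordinates of x are themselves pairings with basis vectors. -/
theorem eq_zero_of_bil {x : V} (h : ∀ y, M.bil x y = 0) : x = 0 := by
  apply M.coord_injective
  rw [map_zero]
  exact Prod.ext (h _) (Prod.ext (h _) (funext fun k => by simp [coord, h]))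

/-- The dual lattice is contained in `L ⊗ ℚ`. -/
theorem exists_nsmul_mem_of_dual {x : V} (hx : ∀ y ∈ M.L, ∃ k : ℤ, M.bil x y = k) :
    ∃ D : ℕ, 0 < D ∧ D • x ∈ M.L := by
  classical
  obtain ⟨B, hB⟩ := M.lattice
  have hmem : ∀ i, B i ∈ M.L := fun i => hB ▸ Submodule.subset_span ⟨i, rfl⟩
  choose g hg using fun i j => M.bil_int (hmem i) (hmem j)
  choose k hk using fun j => hx _ (hmem j)
  set G : Matrix (Fin (n + 2)) (Fin (n + 2)) ℤ := Matrix.of g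
  have hrepr : ∀ (c : Fin (n + 2) → ℝ) (j), M.bil (∑ i, c i • B i) (B j)
      = Matrix.vecMul c (G.map (Int.cast : ℤ → ℝ)) j := by
    intro c j
    simp [bil_sum_left, bil_smul_left, Matrix.vecMul, dotProduct, hg, G]
  -- A vector in the kernel of the Gram matrix would be orthogonal to everything, contradicting
  -- nondegeneracy.
  have hdet : G.det ≠ 0 := by
    intro h0
    have h1 : (G.map (Int.cast : ℤ → ℝ)).det = 0 := by
      have := (Int.castRingHom ℝ).map_det G
      rw [h0, map_zero] at this
      exact this.symm
    obtain ⟨c, hc, hc0⟩ := Matrix.exists_vecMul_eq_zero_iff.2 h1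
    have h2 : ∑ i, c i • B i = 0 := by
      refine M.eq_zero_of_bil fun y => ?_
      rw [← B.sum_repr y, bil_sum_right]
      refine Finset.sum_eq_zero fun j _ => ?_
      rw [bil_smul_right, hrepr, hc0]; simp
    exact hc (funext fun i => Fintype.linearIndependent_iff.1 B.linearIndependent c h2 i)
  have hx1 : Matrix.vecMul (B.repr x) (G.map (Int.cast : ℤ → ℝ)) = fun j => (k j : ℝ) := by
    funext j
    rw [← hrepr, B.sum_repr, hk]
  -- Cramer's rule: multiplying by the adjugate of the Gram matrix makes the coordinates integral,
  -- so |det G| serves as denominator.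
  have hx2 : ∀ i, (G.det : ℝ) * B.repr x i = ((Matrix.vecMul k G.adjugate) i : ℤ) := by
    intro i
    have h1 := congrArg (fun w => Matrix.vecMul w (G.map (Int.cast : ℤ → ℝ)).adjugate) hx1
    simp only [Matrix.vecMul_vecMul, Matrix.mul_adjugate] at h1
    have h2 := congrFun h1 i
    have h3 : (G.map (Int.cast : ℤ → ℝ)).det = (G.det : ℝ) := by
      have := (Int.castRingHom ℝ).map_det G
      exact this.symm
    have h4 : (G.map (Int.cast : ℤ → ℝ)).adjugate = G.adjugate.map (Int.cast : ℤ → ℝ) :=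
      ((Int.castRingHom ℝ).map_adjugate G).symm
    rw [h3, h4, Matrix.vecMul_smul, Matrix.vecMul_one] at h2
    rw [Pi.smul_apply, smul_eq_mul] at h2
    rw [h2]
    simp [Matrix.vecMul, dotProduct]
  have hmemD : G.det • x ∈ M.L := by
    have : G.det • x = ∑ i, (Matrix.vecMul k G.adjugate i) • B i := by
      rw [← Int.cast_smul_eq_zsmul ℝ]
      conv_lhs => rw [← B.sum_repr x, Finset.smul_sum]
      refine Finset.sum_congr rfl fun i _ => ?_
      rw [smul_smul, hx2, Int.cast_smul_eq_zsmul]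
    rw [this]
    exact M.L.sum_mem fun i _ => M.L.smul_mem _ (hmem i)
  refine ⟨G.det.natAbs, Int.natAbs_pos.2 hdet, ?_⟩
  rw [← natCast_zsmul]
  rcases Int.natAbs_eq G.det with h | h
  · rw [← h]; exact hmemD
  · have : ((G.det.natAbs : ℕ) : ℤ) = -G.det := by omega
    rw [this, neg_smul]; exact M.L.neg_mem hmemD

theorem vec_add (x y : Fin n → ℝ) : M.vec (x + y) = M.vec x + M.vec y := by
  simp [vec, add_smul, Finset.sum_add_distrib]

theorem vec_smul (c : ℝ) (x : Fin n → ℝ) : M.vec (c • x) = c • M.vec x := by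
  simp [vec, mul_smul, Finset.smul_sum]

/-- The lattice `L ∩ W` in the coordinates given by `b`. -/
noncomputable def latticeW : Submodule ℤ (Fin n → ℝ) where
  carrier := {c | M.vec c ∈ M.L}
  add_mem' := fun {x y} hx hy => by
    have hx : M.vec x ∈ M.L := hx
    have hy : M.vec y ∈ M.L := hy
    change M.vec (x + y) ∈ M.L
    rw [vec_add]; exact M.L.add_mem hx hy
  zero_mem' := by change M.vec 0 ∈ M.L; simp [vec]
  smul_mem' := fun k x hx => by
    have hx : M.vec x ∈ M.L := hx
    change M.vec (k • x) ∈ M.L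
    rw [← Int.cast_smul_eq_zsmul ℝ, vec_smul, Int.cast_smul_eq_zsmul]
    exact M.L.smul_mem _ hx

/-- The coordinates as a linear equivalence. -/
noncomputable def coordEquiv : V ≃ₗ[ℝ] ℝ × ℝ × (Fin n → ℝ) :=
  LinearEquiv.ofBijective M.coord ⟨M.coord_injective, fun p => ⟨_, M.coord_ofCoord p⟩⟩

theorem coord_vec (c : Fin n → ℝ) : M.coord (M.vec c) = (0, 0, c) := by
  have := M.coord_ofCoord (0, 0, c)
  simpa [ofCoord] using this

/-- The lattice injects continuously into the ℤ-span of a real basis of the coordinate space, which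
is discrete. -/
instance : DiscreteTopology M.latticeW := by
  obtain ⟨B, hB⟩ := M.lattice
  set B' := B.map M.coordEquiv
  have hmem : ∀ c ∈ M.latticeW, ((0, 0, c) : ℝ × ℝ × (Fin n → ℝ)) ∈
      Submodule.span ℤ (Set.range B') := by
    intro c hc
    have h1 : M.vec c ∈ Submodule.span ℤ (Set.range B) := hB ▸ hc
    have h2 := Submodule.mem_map_of_mem (f := M.coord.restrictScalars ℤ) h1
    rw [Submodule.map_span, ← Set.range_comp] at h2
    rw [← M.coord_vec]
    exact h2
  refine DiscreteTopology.of_continuous_injective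
    (β := Submodule.span ℤ (Set.range B'))
    (f := fun c => ⟨(0, 0, (c : Fin n → ℝ)), hmem c c.2⟩) ?_ ?_
  · exact Continuous.subtype_mk (by fun_prop) _
  · intro c d h
    have := congrArg Subtype.val h
    simp only [Prod.mk.injEq, true_and] at this
    exact Subtype.ext this

/-- Rational vectors of given norm and bounded denominator: convergence of `∑ ‖x‖^{-κ}`. -/
theorem summable_norm_coord (N : ℕ) (hN : 0 < N) (m : ℝ) (hm : 0 < m) (κ : ℝ)
    (hκ : n + 1 ≤ κ) :
    Summable fun x : {x : V // N • x ∈ M.L ∧ M.q x = m} => ‖M.coord x‖ ^ (-κ) := by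
  obtain ⟨D, hD, hDe⟩ := M.exists_nsmul_mem_of_dual M.e'_dual
  obtain ⟨s, hs⟩ := M.even _ hDe
  have hs' : (D : ℝ) ^ 2 * M.q M.e' = s := by
    rw [← hs, ← Nat.cast_smul_eq_nsmul ℝ, QuadraticMap.map_smul, smul_eq_mul]; ring
  -- One power of D makes De' a lattice vector. The second clears the denominator of q(e'), since ẽ'
  -- = e' − q(e')e and D²q(e') = s is an integer. After scaling by K the coordinates along e and ẽ'
  -- are integers and the W-part lies in L.
  set K : ℝ := N * D ^ 2 with hK
  have hKpos : 0 < K := by positivity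
  have hex : ∀ x : {x : V // N • x ∈ M.L ∧ M.q x = m}, ∃ z : ℤ × ℤ × M.latticeW,
      K • M.coord x = ((z.1 : ℝ), (z.2.1 : ℝ), (z.2.2 : Fin n → ℝ)) := by
    rintro ⟨x, hx, -⟩
    obtain ⟨a, ha⟩ := M.e'_dual _ hx
    obtain ⟨b, hb⟩ := M.bil_int hx M.e_mem
    have ha' : N * M.bil x M.e' = a := by
      rw [← ha, ← Nat.cast_smul_eq_nsmul ℝ, ← bil, bil_smul_right, M.bil_comm x]
    have hb' : N * M.bil x M.e = b := by
      rw [← hb, ← Nat.cast_smul_eq_nsmul ℝ, bil_smul_left]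
    set A : ℤ := D ^ 2 * a - s * b
    set Bz : ℤ := D ^ 2 * b
    have hA : K * M.bil x M.et = A := by
      rw [et, bil_sub_right, bil_smul_right, hK]
      push_cast [A]
      rw [← ha', ← hb', ← hs']; ring
    have hBz : K * M.bil x M.e = Bz := by
      push_cast [Bz]; rw [← hb', hK]; ring
    have hmem : M.vec (K • (M.coord x).2.2) ∈ M.L := by
      have h1 : M.vec (M.coord x).2.2 = x - M.bil x M.et • M.e - M.bil x M.e • M.et := by
        conv_rhs => rw [← M.ofCoord_coord x]
        conv_rhs => rw [M.ofCoord_coord x]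
        conv_rhs => enter [1, 1]; rw [← M.ofCoord_coord x]
        simp only [ofCoord, coord, LinearMap.coe_mk, AddHom.coe_mk]
        abel
      have h2 : M.vec (K • (M.coord x).2.2) = (D ^ 2 : ℤ) • (N • x) - A • M.e
          - (D * b) • (D • M.e') + (b * s) • M.e := by
        rw [vec_smul, h1, smul_sub, smul_sub, smul_smul, smul_smul, hA, hBz]
        simp only [← Int.cast_smul_eq_zsmul ℝ, ← Nat.cast_smul_eq_nsmul ℝ, et, smul_sub, smul_smul]
        push_cast [Bz]
        rw [← hs', hK]
        module
      rw [h2]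
      exact M.L.add_mem (M.L.sub_mem (M.L.sub_mem (M.L.smul_mem _ hx) (M.L.smul_mem _ M.e_mem))
        (M.L.smul_mem _ hDe)) (M.L.smul_mem _ M.e_mem)
    exact ⟨(A, Bz, ⟨_, hmem⟩), Prod.ext hA (Prod.ext hBz rfl)⟩
  choose z hz using hex
  have hq : ∀ x : {x : V // N • x ∈ M.L ∧ M.q x = m}, ((z x).1 : ℝ) * (z x).2.1 +
      ∑ j, M.q (M.b j) * ((z x).2.2 : Fin n → ℝ) j * ((z x).2.2 : Fin n → ℝ) j = K ^ 2 * m := by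
    intro x
    have h := hz x
    have h1 : K * M.bil x M.et = (z x).1 := congrArg Prod.fst h
    have h2 : K * M.bil x M.e = (z x).2.1 := congrArg (fun p => p.2.1) h
    have h3 : ∀ j, K * (M.q (M.b j) / 2 * M.bil x (M.b j)) = ((z x).2.2 : Fin n → ℝ) j :=
      fun j => congrFun (congrArg (fun p => p.2.2) h) j
    have h4 : M.q (x : V) = m := x.2.2
    rw [M.q_eq] at h4
    rw [← h1, ← h2]
    refine Eq.trans ?_ (congrArg (fun t => K ^ 2 * t) h4)
    rw [mul_add, Finset.mul_sum]
    congr 1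
    · ring
    · refine Finset.sum_congr rfl fun j _ => ?_
      rw [← h3]
      linear_combination K ^ 2 / 4 * M.q (M.b j) * M.bil (x : V) (M.b j) ^ 2 * M.eps_sq j
  have hε : ∀ j, |M.q (M.b j)| ≤ 1 := fun j => by rw [M.b_norm]; split_ifs <;> simp
  have hint : ∀ x ∈ M.latticeW, ∀ y ∈ M.latticeW,
      ∃ k : ℤ, 2 * ∑ j, M.q (M.b j) * x j * y j = k := fun x hx y hy => by
    rw [← bil_vec_vec]; exact M.bil_int hx hy
  have hsum := summable_quadric (fun j => M.q (M.b j)) M.latticeW hε (K ^ 2 * m) (by positivity) κ hκ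
    hint
  have hinj : Function.Injective fun x : {x : V // N • x ∈ M.L ∧ M.q x = m} =>
      (⟨z x, hq x⟩ : {z : ℤ × ℤ × M.latticeW // (z.1 : ℝ) * z.2.1 +
      ∑ j, M.q (M.b j) * (z.2.2 : Fin n → ℝ) j * (z.2.2 : Fin n → ℝ) j = K ^ 2 * m}) := by
    intro x y h
    have h1 : z x = z y := congrArg Subtype.val h
    have h2 : K • M.coord x = K • M.coord y := by rw [hz, hz, h1]
    exact Subtype.ext (M.coord_injective (smul_right_injective _ hKpos.ne' h2))
  refine ((hsum.comp_injective hinj).mul_left (K ^ κ)).congr fun x => ?_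
  simp only [Function.comp_apply]
  rw [← hz x, norm_smul, Real.norm_of_nonneg hKpos.le, Real.mul_rpow hKpos.le (norm_nonneg _),
    ← mul_assoc, ← Real.rpow_add hKpos, add_neg_cancel, Real.rpow_zero, one_mul]

end LatticeSetup

/-! ### Alternating maps of top degree on a frame -/

section TopDegree

variable {E B : Type*} [AddCommGroup E] [Module ℝ E] [Fintype B]

/-- Only injective index maps contribute, and these are the N! reorderings of one frame. The sign of
a reordering appears in both factors and cancels. -/
theorem sum_conj_alternating_mul {N : ℕ} (e : Fin N ≃ B) (D D' : E [⋀^Fin N]→ₗ[ℝ] ℂ) (f r : B → E) :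
    ∑ a : Fin N → B, conj (D (f ∘ a)) * D' (r ∘ a)
      = (N.factorial : ℂ) * (conj (D (f ∘ e)) * D' (r ∘ e)) := by
  have h : ∑ σ : Equiv.Perm (Fin N), conj (D (f ∘ e)) * D' (r ∘ e)
      = ∑ a : Fin N → B, conj (D (f ∘ a)) * D' (r ∘ a) := by
    refine Finset.sum_of_injOn (fun σ => e ∘ σ) ?_ (fun _ _ => Finset.mem_univ _) ?_ ?_
    · intro σ _ τ _ h
      exact Equiv.ext fun i => e.injective (congrFun h i)
    · intro a _ ha
      have hni : ¬ Function.Injective a := by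
        intro hinj
        apply ha
        have hinj' : Function.Injective (e.symm ∘ a) := e.symm.injective.comp hinj
        refine ⟨Equiv.ofBijective _ ⟨hinj', Finite.injective_iff_surjective.1 hinj'⟩,
          Finset.mem_coe.2 (Finset.mem_univ _), ?_⟩
        funext i
        exact e.apply_symm_apply _
      rw [D.map_eq_zero_of_not_injective _ fun h' => hni h'.of_comp, map_zero, zero_mul]
    · intro σ _
      simp only [← Function.comp_assoc]
      rw [D.map_perm, D'.map_perm]
      rcases Int.units_eq_one_or (Equiv.Perm.sign σ) with h | h <;> simp [h]
  rw [← h, Finset.sum_const, Finset.card_univ, Fintype.card_perm, Fintype.card_fin, nsmul_eq_mul]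

/-- If a completes b to a full frame it already contains every c ≠ b, so off-diagonal sums vanish.
All diagonal sums agree by transposition symmetry, and together they make up the full sum of
`sum_conj_alternating_mul`. -/
theorem sum_conj_cons_mul_cons [DecidableEq B] {l : ℕ} (e : Fin (l + 1) ≃ B) (D : E [⋀^Fin (l + 1)]→ₗ[ℝ] ℂ)
    (f : B → E) (b c : B) :
    ∑ a : Fin l → B, conj (D (f ∘ Fin.cons b a)) * D (f ∘ Fin.cons c a)
      = if b = c then (l.factorial : ℂ) * (conj (D (f ∘ e)) * D (f ∘ e)) else 0 := by
  have bij : ∀ g : Fin (l + 1) → B, Function.Injective g → Function.Bijective g := fun g hg =>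
    (Fintype.bijective_iff_injective_and_card g).2 ⟨hg, Fintype.card_congr e⟩
  split_ifs with hbc
  · subst hbc
    -- Permuting the frame vectors changes D by a sign, which disappears in the product with the
    -- conjugate.
    have key : ∀ (π : Equiv.Perm B) (g : Fin (l + 1) → B),
        conj (D (f ∘ (π ∘ g))) * D (f ∘ (π ∘ g)) = conj (D (f ∘ g)) * D (f ∘ g) := by
      intro π g
      by_cases hg : Function.Injective g
      · let g' := Equiv.ofBijective g (bij g hg)
        have : f ∘ (π ∘ g) = (f ∘ g) ∘ ((g'.trans π).trans g'.symm) := by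
          funext i
          simp only [Function.comp_apply, Equiv.trans_apply]
          congr 1
          exact (Equiv.apply_symm_apply g' _).symm
        rw [this, D.map_perm]
        rcases Int.units_eq_one_or (Equiv.Perm.sign ((g'.trans π).trans g'.symm)) with h | h <;>
          simp [h]
      · rw [D.map_eq_zero_of_not_injective _ fun h' => hg h'.of_comp,
          D.map_eq_zero_of_not_injective _ fun h' => hg (h'.of_comp.of_comp)]
    have hconst : ∀ b', ∑ a : Fin l → B, conj (D (f ∘ Fin.cons b' a)) * D (f ∘ Fin.cons b' a)
        = ∑ a : Fin l → B, conj (D (f ∘ Fin.cons b a)) * D (f ∘ Fin.cons b a) := by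
      intro b'
      refine Fintype.sum_equiv (Equiv.arrowCongr (Equiv.refl _) (Equiv.swap b b')) _ _ fun a => ?_
      rw [← key (Equiv.swap b b') (Fin.cons b' a)]
      have : (Equiv.swap b b') ∘ (Fin.cons b' a : Fin (l + 1) → B)
          = Fin.cons b ((Equiv.arrowCongr (Equiv.refl _) (Equiv.swap b b')) a) := by
        funext i
        refine Fin.cases ?_ (fun i => ?_) i <;> simp
      rw [this]
    have htot := sum_conj_alternating_mul e D D f f
    rw [← (Fin.consEquiv fun _ : Fin (l + 1) => B).sum_comp, Fintype.sum_prod_type] at htot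
    have hl : ((l + 1 : ℕ) : ℂ) ≠ 0 := by exact_mod_cast Nat.succ_ne_zero l
    apply mul_left_cancel₀ hl
    calc _ = ∑ _b' : B, ∑ a : Fin l → B, conj (D (f ∘ Fin.cons b a)) * D (f ∘ Fin.cons b a) := by
          rw [Finset.sum_const, Finset.card_univ, ← Fintype.card_congr e, Fintype.card_fin,
            nsmul_eq_mul]
      _ = ∑ b' : B, ∑ a : Fin l → B, conj (D (f ∘ Fin.cons b' a)) * D (f ∘ Fin.cons b' a) :=
          Finset.sum_congr rfl fun b' _ => (hconst b').symm
      _ = _ := htot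
      _ = _ := by rw [Nat.factorial_succ]; push_cast; ring
  · refine Finset.sum_eq_zero fun a _ => ?_
    by_cases hb : Function.Injective (Fin.cons b a : Fin (l + 1) → B)
    · obtain ⟨i, hi⟩ := (bij _ hb).2 c
      have hc : ¬ Function.Injective (Fin.cons c a : Fin (l + 1) → B) := by
        intro hinj
        revert hi
        refine Fin.cases (fun h => hbc h) (fun j h => ?_) i
        have := @hinj 0 j.succ (by simpa using h.symm)
        exact Fin.succ_ne_zero j this.symm
      rw [D.map_eq_zero_of_not_injective _ fun h' => hc h'.of_comp, mul_zero]
    · rw [D.map_eq_zero_of_not_injective _ fun h' => hb h'.of_comp, map_zero, zero_mul]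

/-- Bilinear extension of the preceding orthogonality. It computes the Hodge operator in codegree
one, where the first slot is an arbitrary tangent vector. -/
theorem sum_conj_cons_mul_cons_eq [DecidableEq B] {l : ℕ} (e : Fin (l + 1) ≃ B) (D : E [⋀^Fin (l + 1)]→ₗ[ℝ] ℂ)
    (f : B → E) (x u : B → ℝ) :
    ∑ a : Fin l → B, conj (D (Fin.cons (∑ b, x b • f b) (f ∘ a)))
        * D (Fin.cons (∑ b, u b • f b) (f ∘ a))
      = (l.factorial : ℂ) * (conj (D (f ∘ e)) * D (f ∘ e)) * ∑ b, ((x b * u b : ℝ) : ℂ) := by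
  have lin : ∀ (y : B → ℝ) (a : Fin l → B), D (Fin.cons (∑ b, y b • f b) (f ∘ a))
      = ∑ b, (y b : ℂ) * D (f ∘ Fin.cons b a) := by
    intro y a
    have h1 : ∀ z : E, (Fin.cons z (f ∘ a) : Fin (l + 1) → E)
        = Function.update (Fin.cons 0 (f ∘ a)) 0 z := fun z => by rw [Fin.update_cons_zero]
    rw [h1, D.map_update_sum]
    refine Finset.sum_congr rfl fun b _ => ?_
    rw [D.map_update_smul, Fin.update_cons_zero, Complex.real_smul]
    congr 2
    funext i
    refine Fin.cases ?_ (fun i => ?_) i <;> simp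
  simp only [lin, map_sum, map_mul, Complex.conj_ofReal, Finset.sum_mul_sum]
  rw [Finset.sum_comm]
  simp_rw [Finset.sum_comm (s := (Finset.univ : Finset (Fin l → B)))]
  have : ∀ b c, ∑ a : Fin l → B, (x b : ℂ) * conj (D (f ∘ Fin.cons b a))
      * ((u c : ℂ) * D (f ∘ Fin.cons c a)) = (x b : ℂ) * u c *
      if b = c then (l.factorial : ℂ) * (conj (D (f ∘ e)) * D (f ∘ e)) else 0 := by
    intro b c
    rw [← sum_conj_cons_mul_cons e D f b c, Finset.mul_sum]
    exact Finset.sum_congr rfl fun _ _ => by ring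
  simp only [this, mul_ite, mul_zero, Finset.sum_ite_eq, Finset.mem_univ, if_true, Finset.mul_sum]
  refine Finset.sum_congr rfl fun b _ => ?_
  push_cast
  ring

end TopDegree

/-- Laplace expansion along a column, with the row operations of an exterior product. -/
theorem sum_alternating_det {l N : ℕ} (h : l + 1 = N) {E : Type*} (θ : Fin N → E → ℂ)
    (v : Fin (l + 1) → E) (a₀ a₁ : Fin N) :
    ∑ i : Fin (l + 1), (-1 : ℂ) ^ (i : ℕ) * (θ a₀ (v i) *
      Matrix.det (Matrix.of fun j : Fin N =>
        (Fin.cons (Pi.single a₁ 1) (fun j a => θ a (i.removeNth v j)) :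
          Fin (l + 1) → Fin N → ℂ) (Fin.cast h.symm j)))
      = if a₀ = a₁ then Matrix.det (Matrix.of fun j a => θ a (v (Fin.cast h.symm j))) else 0 := by
  subst h
  simp only [Fin.cast_eq_self]
  set A : Matrix (Fin (l + 1)) (Fin (l + 1)) ℂ := Matrix.of fun j a => θ a (v j) with hA
  have h1 : ∀ i : Fin (l + 1), Matrix.det (Matrix.of
      (Fin.cons (Pi.single a₁ 1) (fun j a => θ a (i.removeNth v j)) : Fin (l + 1) → Fin (l + 1) → ℂ))
      = (-1) ^ (a₁ : ℕ) * (A.submatrix i.succAbove a₁.succAbove).det := by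
    intro i
    rw [Matrix.det_succ_row_zero, Finset.sum_eq_single a₁]
    · simp only [Matrix.of_apply, Fin.cons_zero, Pi.single_eq_same, mul_one]
      congr 1
    · intro b _ hb
      simp [Pi.single_eq_of_ne hb]
    · simp
  simp only [h1]
  -- The alternating sum is the expansion along column a₁ of the matrix in which that column has
  -- been replaced by the values of θ a₀. For a₀ ≠ a₁ two columns coincide.
  have h2 := Matrix.det_succ_column (A.updateCol a₁ fun i => θ a₀ (v i)) a₁
  have h3 : ∀ i : Fin (l + 1), (A.updateCol a₁ fun i => θ a₀ (v i)).submatrix i.succAbove a₁.succAbove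
      = A.submatrix i.succAbove a₁.succAbove := by
    intro i
    ext r s
    simp [Fin.succAbove_ne]
  simp only [h3, Matrix.updateCol_self] at h2
  have h4 : (A.updateCol a₁ fun i => θ a₀ (v i)).det = if a₀ = a₁ then A.det else 0 := by
    split_ifs with h
    · subst h
      congr 1
      ext r s
      by_cases hs : s = a₀
      · subst hs; simp [hA]
      · simp [hs]
    · refine Matrix.det_zero_of_column_eq h fun i => ?_
      simp [h, hA]
  rw [← h4, h2]
  exact Finset.sum_congr rfl fun i _ => by rw [pow_add]; ring

theorem contractFirst_one_apply {n N l : ℕ} (h : 1 + l = N) (h' : l + 1 = N)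
    (η : (Fin n → ℂ) [⋀^Fin N]→L[ℝ] ℂ) (r : Fin 1 → Fin n → ℂ) (w : Fin l → Fin n → ℂ) :
    contractFirst h η r w
      = η (fun i => (Fin.cons (r 0) w : Fin (l + 1) → Fin n → ℂ) (Fin.cast h'.symm i)) := by
  subst h'
  change η _ = η _
  congr 1
  funext i
  refine Fin.cases ?_ (fun i => ?_) i
  · have : Fin.cast h.symm (0 : Fin (l + 1)) = Fin.castAdd l (0 : Fin 1) := by ext; simp
    rw [this, Fin.append_left]; simp
  · have : Fin.cast h.symm i.succ = Fin.natAdd 1 i := by ext; simp [add_comm]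
    rw [this, Fin.append_right]; simp

/-! ### The coordinate volume form -/

/-- The index `a` of the coframe corresponds to `dz_i` or `dz̄_i` where `a = 2 i` or `2 i + 1`. -/
def frameIndex (n : ℕ) : Fin (2 * n) ≃ Fin n × Fin 2 :=
  (finCongr (mul_comm 2 n)).trans finProdFinEquiv.symm

theorem coframe_eq {n : ℕ} (a : Fin (2 * n)) (v : Fin n → ℂ) :
    coframe a v = if (frameIndex n a).2 = 0 then v (frameIndex n a).1
      else conj (v (frameIndex n a).1) := by
  have h : (frameIndex n a).2 = 0 ↔ (a : ℕ) % 2 = 0 := by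
    rw [Fin.ext_iff]; rfl
  simp only [coframe, h]
  rfl

theorem coframe_symm {n : ℕ} (i : Fin n) (t : Fin 2) (v : Fin n → ℂ) :
    coframe ((frameIndex n).symm (i, t)) v = if t = 0 then v i else conj (v i) := by
  rw [coframe_eq, Equiv.apply_symm_apply]

theorem coordinateVolume_apply {n : ℕ} (v : Fin (2 * n) → Fin n → ℂ) :
    coordinateVolume n v = Matrix.det (Matrix.of fun j a => coframe a (v j)) := rfl

/-- A real matrix acting on `ℂⁿ`. -/
noncomputable def realMulVec {n : ℕ} (h : Matrix (Fin n) (Fin n) ℝ) (v : Fin n → ℂ) : Fin n → ℂ :=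
  fun i => ∑ k, (h i k : ℂ) * v k

open scoped Kronecker in
-- A real matrix acts in the same way on the dz and on the dz̄, so the coframe matrix is multiplied
-- by hᵀ ⊗ 1 and the determinant appears squared.
theorem coordinateVolume_realMulVec {n : ℕ} (h : Matrix (Fin n) (Fin n) ℝ)
    (v : Fin (2 * n) → Fin n → ℂ) :
    coordinateVolume n (fun j => realMulVec h (v j)) = (h.det : ℂ) ^ 2 * coordinateVolume n v := by
  set K : Matrix (Fin n × Fin 2) (Fin n × Fin 2) ℂ :=
    (h.map (Complex.ofReal)).transpose ⊗ₖ (1 : Matrix (Fin 2) (Fin 2) ℂ) with hK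
  have h1 : (Matrix.of fun j a => coframe a (realMulVec h (v j)) : Matrix (Fin (2 * n)) _ ℂ)
      = (Matrix.of fun j a => coframe a (v j)) * K.submatrix (frameIndex n) (frameIndex n) := by
    ext j a
    rw [Matrix.mul_apply, ← (frameIndex n).symm.sum_comp, Fintype.sum_prod_type]
    simp only [Matrix.of_apply, coframe_symm, Matrix.submatrix_apply, Equiv.apply_symm_apply, hK,
      Matrix.kroneckerMap_apply, Matrix.transpose_apply, Matrix.map_apply, coframe_eq a]
    simp only [Fin.sum_univ_two, realMulVec]
    obtain ⟨i, t⟩ := frameIndex n a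
    obtain rfl | rfl : t = 0 ∨ t = 1 := by omega
    · simp [mul_comm]
    · simp [mul_comm]
  rw [coordinateVolume_apply, h1, Matrix.det_mul, Matrix.det_submatrix_equiv_self, hK,
    Matrix.det_kronecker]
  have h2 : (h.map Complex.ofReal).det = (h.det : ℂ) := (Complex.ofRealHom.map_det h).symm
  simp [h2, coordinateVolume_apply, mul_comm]

namespace LatticeSetup

open scoped Kronecker in
-- Each coordinate contributes the determinant of dz, dz̄ on the pair (1, i), which is −2i.
theorem coordinateVolume_frame (n : ℕ) :
    coordinateVolume n (frame ∘ frameIndex n) = (-2 * Complex.I) ^ n := by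
  set S : Matrix (Fin 2) (Fin 2) ℂ := !![1, 1; Complex.I, -Complex.I] with hS
  have h1 : (Matrix.of fun j a => coframe a ((frame ∘ frameIndex n) j) : Matrix (Fin (2 * n)) _ ℂ)
      = ((1 : Matrix (Fin n) (Fin n) ℂ) ⊗ₖ S).submatrix (frameIndex n) (frameIndex n) := by
    ext j a
    simp only [Matrix.of_apply, Function.comp_apply, Matrix.submatrix_apply,
      Matrix.kroneckerMap_apply, coframe_eq, frame]
    obtain ⟨i, t⟩ := frameIndex n a
    obtain ⟨k, s⟩ := frameIndex n j
    by_cases hik : i = k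
    · subst hik
      fin_cases t <;> fin_cases s <;> simp [hS]
    · simp [Pi.single_eq_of_ne hik, Matrix.one_apply_ne (Ne.symm hik)]
  rw [coordinateVolume_apply, h1, Matrix.det_submatrix_equiv_self, Matrix.det_kronecker]
  simp [hS, Matrix.det_fin_two]
  ring

variable {n : ℕ} [NeZero n] {V : Type*} [AddCommGroup V] [Module ℝ V] (M : LatticeSetup n V)

theorem raisedFrame_eq (Z : Fin n → ℂ) (a : Fin n × Fin 2) :
    M.raisedFrame Z a = realMulVec (Matrix.of (M.hInv Z)) (frame a) := by
  funext j
  simp [raisedFrame, realMulVec, frame, Pi.single_apply, mul_comm]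

theorem hInv_symm (Z : Fin n → ℂ) (i j : Fin n) : M.hInv Z i j = M.hInv Z j i := by
  rw [hInv, hInv]
  by_cases h : i = j
  · subst h; rfl
  · rw [if_neg h, if_neg (Ne.symm h)]; ring

/-- A rank-one perturbation of a diagonal matrix. The matrix determinant lemma gives the factor 1 −
2 = −1, because ∑ ε_i y_i² = q(Y). It cancels the sign of ∏(−ε_i) = −1. -/
theorem det_hInv {Z : Fin n → ℂ} (hZ : 0 < M.qY Z) :
    (Matrix.of (M.hInv Z)).det = (2 * M.qY Z) ^ n := by
  set d : Fin n → ℝ := fun i => -(2 * M.qY Z * M.q (M.b i)) with hd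
  have hd0 : ∀ i, d i ≠ 0 := fun i => by
    rw [hd]; simp only [ne_eq, neg_eq_zero, mul_eq_zero, not_or]
    exact ⟨⟨two_ne_zero, hZ.ne'⟩, fun h => by have := M.eps_sq i; rw [h] at this; simp at this⟩
  have hu : IsUnit (Matrix.diagonal d).det := by
    rw [Matrix.det_diagonal]
    exact (Finset.prod_ne_zero_iff.2 fun i _ => hd0 i).isUnit
  have h1 : Matrix.of (M.hInv Z) = Matrix.diagonal d + Matrix.replicateCol Unit (fun i => 4 * (Z i).im)
      * Matrix.replicateRow Unit (fun i => (Z i).im) := by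
    ext i j
    simp only [Matrix.of_apply, hInv, Matrix.add_apply, Matrix.diagonal_apply, Matrix.mul_apply,
      Matrix.replicateCol_apply, Matrix.replicateRow_apply, Finset.univ_unique, Finset.sum_const,
      Finset.card_singleton, one_smul, hd]
    split_ifs <;> ring
  have h2 : (Matrix.diagonal d)⁻¹ = Matrix.diagonal fun i => (d i)⁻¹ := by
    apply Matrix.inv_eq_right_inv
    rw [Matrix.diagonal_mul_diagonal]
    simp [hd0]
  have h3 : ∀ i, (d i)⁻¹ = -(M.q (M.b i) / (2 * M.qY Z)) := by
    intro i
    refine inv_eq_of_mul_eq_one_right ?_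
    rw [hd]
    field_simp
    linear_combination M.eps_sq i
  have h4 : (1 + Matrix.replicateRow Unit (fun i => (Z i).im) * (Matrix.diagonal d)⁻¹
      * Matrix.replicateCol Unit (fun i => 4 * (Z i).im)).det = -1 := by
    rw [Matrix.det_unique, h2]
    simp only [Matrix.add_apply, Matrix.one_apply_eq, Matrix.mul_apply, Matrix.diagonal_apply,
      Matrix.replicateCol_apply, Matrix.replicateRow_apply, mul_ite, mul_zero, Finset.sum_ite_eq',
      Finset.mem_univ, if_true, h3]
    have h5 : ∑ i, (Z i).im * -(M.q (M.b i) / (2 * M.qY Z)) * (4 * (Z i).im)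
        = -(2 / M.qY Z) * ∑ i, M.q (M.b i) * (Z i).im ^ 2 := by
      rw [Finset.mul_sum]
      exact Finset.sum_congr rfl fun i _ => by field_simp; ring
    rw [h5, ← M.qY_eq]
    field_simp
    norm_num
  rw [h1, Matrix.det_add_replicateCol_mul_replicateRow hu, h4, Matrix.det_diagonal]
  have h5 : ∏ i, d i = (2 * M.qY Z) ^ n * ∏ i, -(M.q (M.b i)) := by
    rw [← Fin.prod_const, ← Finset.prod_mul_distrib]
    exact Finset.prod_congr rfl fun i _ => by rw [hd]; ring
  have h6 : ∏ i, -(M.q (M.b i)) = -1 := by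
    rw [← Finset.mul_prod_erase _ _ (Finset.mem_univ (0 : Fin n)), M.b_zero, Finset.prod_eq_one]
    · ring
    · intro i hi
      rw [M.b_ne_zero (Finset.ne_of_mem_erase hi)]; ring
  rw [h5, h6]; ring

/-- The density of `dμ` with respect to the coordinate volume form. -/
noncomputable def volDensity (Z : Fin n → ℂ) : ℂ := 1 / (4 * Complex.I * M.qY Z) ^ n

/-- This is the normalisation *̄dμ = 1: here 4^n is the squared modulus of the coordinate volume on
the frame, and (2q(Y))^(2n) comes from raising all 2n indices. -/
theorem volDensity_norm {Z : Fin n → ℂ} (hZ : 0 < M.qY Z) :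
    conj (M.volDensity Z) * M.volDensity Z * (4 : ℂ) ^ n * ((2 * M.qY Z : ℝ) : ℂ) ^ (2 * n) = 1 := by
  have h0 : (M.qY Z : ℂ) ≠ 0 := by exact_mod_cast hZ.ne'
  simp only [volDensity, map_div₀, map_one, map_pow, map_mul, Complex.conj_I, Complex.conj_ofReal,
    map_ofNat]
  rw [div_mul_div_comm, ← mul_pow, one_mul, div_mul_eq_mul_div, div_mul_eq_mul_div, one_mul,
    pow_mul, ← mul_pow, ← div_pow]
  have : (4 : ℂ) * ((2 * M.qY Z : ℝ) : ℂ) ^ 2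
      / (4 * -Complex.I * M.qY Z * (4 * Complex.I * M.qY Z)) = 1 := by
    rw [div_eq_one_iff_eq]
    · push_cast
      linear_combination (16 * (M.qY Z : ℂ) ^ 2) * Complex.I_sq
    · simp [h0]
  rw [this, one_pow]

end LatticeSetup

theorem one_add_degree (n : ℕ) [NeZero n] : 1 + (2 * n - 2 + 1) = 2 * n := by
  have := NeZero.pos n
  omega

theorem degree_add_one (n : ℕ) [NeZero n] : 2 * n - 2 + 1 + 1 = 2 * n := by
  have := NeZero.pos n
  omega

/-- A determinant as a linear function of its first row. -/
noncomputable def detCons {l N : ℕ} (h : l + 1 = N) (g : Fin l → Fin N → ℂ) :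
    (Fin N → ℂ) →ₗ[ℂ] ℂ where
  toFun ρ := Matrix.det (Matrix.of fun j : Fin N =>
    (Fin.cons ρ g : Fin (l + 1) → Fin N → ℂ) (Fin.cast h.symm j))
  map_add' x y := by
    subst h
    have : ∀ ρ, (Matrix.of fun j : Fin (l + 1) =>
        (Fin.cons ρ g : Fin (l + 1) → Fin (l + 1) → ℂ) (Fin.cast rfl j))
        = Matrix.updateRow (Matrix.of (Fin.cons 0 g : Fin (l + 1) → Fin (l + 1) → ℂ)) 0 ρ := by
      intro ρ
      ext i j
      refine Fin.cases ?_ (fun i => ?_) i <;> simp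
    rw [this, this, this, Matrix.det_updateRow_add]
  map_smul' c x := by
    subst h
    have : ∀ ρ, (Matrix.of fun j : Fin (l + 1) =>
        (Fin.cons ρ g : Fin (l + 1) → Fin (l + 1) → ℂ) (Fin.cast rfl j))
        = Matrix.updateRow (Matrix.of (Fin.cons 0 g : Fin (l + 1) → Fin (l + 1) → ℂ)) 0 ρ := by
      intro ρ
      ext i j
      refine Fin.cases ?_ (fun i => ?_) i <;> simp
    rw [this, this, Matrix.det_updateRow_smul]
    rfl

theorem detCons_coframe {l n : ℕ} (h : l + 1 = 2 * n) (v : Fin n → ℂ) (w : Fin l → Fin n → ℂ) :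
    detCons h (fun j a => coframe a (w j)) (fun a => coframe a v)
      = coordinateVolume n (fun i => (Fin.cons v w : Fin (l + 1) → Fin n → ℂ)
        (Fin.cast h.symm i)) := by
  rw [coordinateVolume_apply]
  change Matrix.det _ = _
  congr 1
  ext i j
  simp only [Matrix.of_apply]
  refine Fin.cases (motive := fun i => (Fin.cons (fun a => coframe a v)
    (fun j a => coframe a (w j)) : Fin (l + 1) → Fin (2 * n) → ℂ) i j
      = coframe j ((Fin.cons v w : Fin (l + 1) → Fin n → ℂ) i)) ?_ (fun i => ?_) (Fin.cast h.symm i)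
    <;> simp

/-! ### Forms of type (n, n − 1) as contractions of the volume form. -/

section AntiContract

variable {n : ℕ} [NeZero n]

/-- The contraction of the coordinate volume form with the `(0, 1)`-part of a real tangent
vector. -/
noncomputable def antiContract (v : Fin n → ℂ) : (Fin n → ℂ) [⋀^Fin (2 * n - 2 + 1)]→L[ℝ] ℂ :=
  (1 / 2 : ℂ) • (contractFirst (one_add_degree n) (coordinateVolume n) (fun _ => v)
    + Complex.I • contractFirst (one_add_degree n) (coordinateVolume n) (fun _ => Complex.I • v))

theorem antiContract_apply_volume (v : Fin n → ℂ) (w : Fin (2 * n - 2 + 1) → Fin n → ℂ) :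
    antiContract v w = 1 / 2 * (coordinateVolume n (fun i =>
        (Fin.cons v w : Fin (2 * n - 2 + 1 + 1) → Fin n → ℂ) (Fin.cast (degree_add_one n).symm i))
      + Complex.I * coordinateVolume n (fun i =>
        (Fin.cons (Complex.I • v) w : Fin (2 * n - 2 + 1 + 1) → Fin n → ℂ)
          (Fin.cast (degree_add_one n).symm i))) := by
  simp only [antiContract, ContinuousAlternatingMap.smul_apply, ContinuousAlternatingMap.add_apply,
    contractFirst_one_apply _ (degree_add_one n), smul_eq_mul]

/-- In (v + i·(iv))/2 the values of the dz_k cancel and those of the dz̄_k survive, so only the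
columns dz̄_k of the determinant contribute. -/
theorem antiContract_apply (v : Fin n → ℂ) (w : Fin (2 * n - 2 + 1) → Fin n → ℂ) :
    antiContract v w = ∑ k, conj (v k) * detCons (degree_add_one n) (fun j a => coframe a (w j))
      (Pi.single ((frameIndex n).symm (k, 1)) 1) := by
  rw [antiContract_apply_volume, ← detCons_coframe (degree_add_one n),
    ← detCons_coframe (degree_add_one n), ← smul_eq_mul Complex.I,
    ← map_smul, ← map_add, ← smul_eq_mul, ← map_smul]
  simp only [← smul_eq_mul (conj (v _)), ← map_smul, ← map_sum]
  congr 1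
  funext a
  obtain ⟨⟨i, t⟩, rfl⟩ := (frameIndex n).symm.surjective a
  simp only [Pi.smul_apply, Pi.add_apply, coframe_symm, Finset.sum_apply, Pi.single_apply,
    smul_eq_mul, Equiv.apply_eq_iff_eq, Prod.mk.injEq]
  fin_cases t
  · simp [← mul_assoc]
  · simp [← mul_assoc]
    ring

/-- The contraction of the coordinate volume form with `∂/∂z̄_k`. -/
noncomputable def theta (k : Fin n) : (Fin n → ℂ) [⋀^Fin (2 * n - 2 + 1)]→L[ℝ] ℂ :=
  antiContract (Pi.single k 1)

theorem theta_apply (k : Fin n) (w : Fin (2 * n - 2 + 1) → Fin n → ℂ) :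
    theta k w = detCons (degree_add_one n) (fun j a => coframe a (w j))
      (Pi.single ((frameIndex n).symm (k, 1)) 1) := by
  rw [theta, antiContract_apply, Finset.sum_eq_single k]
  · simp
  · intro i _ hi; simp [Pi.single_eq_of_ne hi]
  · simp

theorem antiContract_eq (v : Fin n → ℂ) : antiContract v = ∑ k, conj (v k) • theta k := by
  ext w
  rw [antiContract_apply, ContinuousAlternatingMap.sum_apply]
  exact Finset.sum_congr rfl fun k _ => by
    rw [ContinuousAlternatingMap.smul_apply, theta_apply, smul_eq_mul]

/-- In wedge notation this is dz̄_k ∧ θ_j = δ_kj · vol, the relation that turns ∂̄ of an (n, n −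
1)-form into a divergence. -/
theorem sum_conj_mul_theta (v : Fin (2 * n - 2 + 1 + 1) → Fin n → ℂ) (j k : Fin n) :
    ∑ i : Fin (2 * n - 2 + 1 + 1), (-1 : ℂ) ^ (i : ℕ) * (conj (v i k) * theta j (i.removeNth v))
      = if k = j then coordinateVolume n (fun i => v (Fin.cast (degree_add_one n).symm i))
        else 0 := by
  have := sum_alternating_det (degree_add_one n) (fun a => coframe a) v
    ((frameIndex n).symm (k, 1)) ((frameIndex n).symm (j, 1))
  simp only [coframe_symm, Equiv.apply_eq_iff_eq, Prod.mk.injEq, and_true] at this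
  simp only [theta_apply]
  rw [coordinateVolume_apply]
  exact this

/-- The forms `theta k` are of type `(n, n - 1)`. -/
theorem theta_smul (k : Fin n) (c : ℂ) (w : Fin (2 * n - 2 + 1) → Fin n → ℂ) :
    theta k (fun i => c • w i) = c ^ n * conj c ^ (n - 1) * theta k w := by
  have hn := NeZero.pos n
  rcases eq_or_ne c 0 with rfl | hc
  · rw [zero_pow hn.ne', zero_mul, zero_mul]
    exact (theta k).map_coord_zero 0 (by simp)
  -- Scaling the vectors by c scales each dz column by c and each dz̄ column by its conjugate. The
  -- column of dz̄_k has been contracted away, which accounts for the type (n, n − 1) instead of (n,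
  -- n).
  set d : Fin (2 * n) → ℂ := fun a => if (frameIndex n a).2 = 0 then c else conj c with hd
  have hc' : conj c ≠ 0 := by simpa using hc
  have h1 : ∀ (ρ : Fin (2 * n) → ℂ), detCons (degree_add_one n) (fun j a => coframe a (c • w j))
      (fun a => ρ a * d a) = detCons (degree_add_one n) (fun j a => coframe a (w j)) ρ * ∏ a, d a := by
    intro ρ
    change Matrix.det _ = Matrix.det _ * _
    rw [← Matrix.det_diagonal, ← Matrix.det_mul]
    congr 1
    ext i j
    rw [Matrix.mul_diagonal]
    simp only [Matrix.of_apply]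
    refine Fin.cases (motive := fun i => (Fin.cons (fun a => ρ a * d a)
      (fun j a => coframe a (c • w j)) : Fin (2 * n - 2 + 1 + 1) → Fin (2 * n) → ℂ) i j
      = (Fin.cons ρ (fun j a => coframe a (w j)) : Fin (2 * n - 2 + 1 + 1) → Fin (2 * n) → ℂ) i j
        * d j) ?_ (fun i => ?_) _
    · simp
    · simp only [Fin.cons_succ, coframe_eq, hd, Pi.smul_apply, smul_eq_mul, map_mul]
      split_ifs <;> ring
  have h2 : ∏ a, d a = c ^ n * conj c ^ n := by
    rw [← (frameIndex n).symm.prod_comp, Fintype.prod_prod_type]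
    simp [hd, Fin.prod_univ_two, mul_pow]
  have h3 : (Pi.single ((frameIndex n).symm (k, 1)) 1 : Fin (2 * n) → ℂ)
      = (conj c)⁻¹ • fun a => (Pi.single ((frameIndex n).symm (k, 1)) 1 : Fin (2 * n) → ℂ) a * d a := by
    funext a
    by_cases ha : a = (frameIndex n).symm (k, 1)
    · subst ha; simp [hd, hc']
    · simp [Pi.single_eq_of_ne ha]
  rw [theta_apply, theta_apply, h3, map_smul, h1, ← h3, h2, smul_eq_mul]
  obtain ⟨m, rfl⟩ : ∃ m, n = m + 1 := ⟨n - 1, by omega⟩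
  simp only [Nat.add_sub_cancel]
  field_simp
  ring

end AntiContract

open Topology in
/-- The derivatives `∂f/∂z̄_k` of `f` at `Z` are `d k`. -/
structure HasDbar {n : ℕ} (f : (Fin n → ℂ) → ℂ) (d : Fin n → ℂ) (Z : Fin n → ℂ) : Prop where
  differentiableAt : DifferentiableAt ℝ f Z
  eq : ∀ v, Form.conjLinearPart (fderiv ℝ f Z) v = ∑ k, d k * conj (v k)

/-! ### The Dolbeault operator in coordinates. -/

section Dbar

open Topology

variable {n : ℕ}

theorem conjLinearPart_apply {F : Type*} [NormedAddCommGroup F] [NormedSpace ℝ F] [NormedSpace ℂ F]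
    [SMulCommClass ℝ ℂ F] (T : (Fin n → ℂ) →L[ℝ] F) (v : Fin n → ℂ) :
    Form.conjLinearPart T v = (1 / 2 : ℂ) • (T v + Complex.I • T (Complex.I • v)) := rfl

theorem conjLinearPart_fderiv_sum_smul {ι F : Type*} [Fintype ι] [NormedAddCommGroup F]
    [NormedSpace ℝ F] [NormedSpace ℂ F] [SMulCommClass ℝ ℂ F] [IsScalarTower ℝ ℂ F]
    {φ : ι → (Fin n → ℂ) → ℂ} {d : ι → Fin n → ℂ} {Z : Fin n → ℂ}
    (hφ : ∀ j, HasDbar (φ j) (d j) Z) (θ : ι → F) (Φ : (Fin n → ℂ) → F)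
    (hΦ : Φ =ᶠ[𝓝 Z] fun Z => ∑ j, φ j Z • θ j) (v : Fin n → ℂ) :
    Form.conjLinearPart (fderiv ℝ Φ Z) v = ∑ j, (∑ k, d j k * conj (v k)) • θ j := by
  have h : HasFDerivAt (fun Z => ∑ j, φ j Z • θ j)
      (∑ j, (fderiv ℝ (φ j) Z).smulRight (θ j)) Z :=
    HasFDerivAt.fun_sum fun j _ => ((hφ j).differentiableAt.hasFDerivAt).smul_const (θ j)
  rw [hΦ.fderiv_eq, h.fderiv, conjLinearPart_apply]
  simp only [sum_apply, ContinuousLinearMap.smulRight_apply, Finset.smul_sum,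
    ← Finset.sum_add_distrib]
  refine Finset.sum_congr rfl fun j _ => ?_
  rw [← (hφ j).eq, conjLinearPart_apply, smul_smul, ← add_smul, smul_smul, smul_eq_mul, smul_eq_mul]

theorem dbar_apply {k : ℕ} (Φ : Form n k) (Z : Fin n → ℂ) (v : Fin (k + 1) → Fin n → ℂ) :
    Form.dbar Φ Z v = ∑ i : Fin (k + 1), (-1 : ℤ) ^ (i : ℕ) •
      Form.conjLinearPart (fderiv ℝ Φ Z) (v i) (i.removeNth v) := by
  rw [Form.dbar, ContinuousAlternatingMap.alternatizeUncurryFin_apply]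

theorem dbar_sum_theta [NeZero n] {φ : Fin n → (Fin n → ℂ) → ℂ} {d : Fin n → Fin n → ℂ}
    {Z : Fin n → ℂ} (hφ : ∀ j, HasDbar (φ j) (d j) Z) (Φ : Form n (2 * n - 2 + 1))
    (hΦ : Φ =ᶠ[𝓝 Z] fun Z => ∑ j, φ j Z • theta j) (v : Fin (2 * n - 2 + 1 + 1) → Fin n → ℂ) :
    Form.dbar Φ Z v = (∑ j, d j j) *
      coordinateVolume n (fun i => v (Fin.cast (degree_add_one n).symm i)) := by
  rw [dbar_apply]
  simp only [conjLinearPart_fderiv_sum_smul hφ _ Φ hΦ, ContinuousAlternatingMap.sum_apply,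
    ContinuousAlternatingMap.smul_apply, zsmul_eq_mul, smul_eq_mul, Finset.sum_mul, Finset.mul_sum]
  push_cast
  rw [Finset.sum_comm]
  refine Finset.sum_congr rfl fun j _ => ?_
  rw [Finset.sum_comm]
  have := fun k => sum_conj_mul_theta v j k
  calc _ = ∑ k, d j k * ∑ i : Fin (2 * n - 2 + 1 + 1),
        (-1 : ℂ) ^ (i : ℕ) * (conj (v i k) * theta j (i.removeNth v)) := by
        refine Finset.sum_congr rfl fun k _ => ?_
        rw [Finset.mul_sum]
        exact Finset.sum_congr rfl fun i _ => by ring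
    _ = _ := by simp [this]

/-- The form `dz̄_k`. -/
noncomputable def dzbar (k : Fin n) : (Fin n → ℂ) [⋀^Fin 1]→L[ℝ] ℂ :=
  ContinuousAlternatingMap.ofSubsingleton ℝ (Fin n → ℂ) ℂ (0 : Fin 1)
    ((Complex.conjCLE : ℂ →L[ℝ] ℂ).comp (ContinuousLinearMap.proj k))

theorem dzbar_apply (k : Fin n) (v : Fin 1 → Fin n → ℂ) : dzbar k v = conj (v 0 k) := rfl

/-- The antisymmetrisation of a symmetric matrix of derivatives is zero. -/
theorem dbar_sum_dzbar_eq_zero {η : Fin n → (Fin n → ℂ) → ℂ} {d : Fin n → Fin n → ℂ}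
    {Z : Fin n → ℂ} (hη : ∀ j, HasDbar (η j) (d j) Z) (hd : ∀ j k, d j k = d k j) (Φ : Form n 1)
    (hΦ : Φ =ᶠ[𝓝 Z] fun Z => ∑ j, η j Z • dzbar j) : Form.dbar Φ Z = 0 := by
  ext v
  change _ = (0 : ℂ)
  rw [dbar_apply, Fin.sum_univ_two]
  simp only [conjLinearPart_fderiv_sum_smul hη _ Φ hΦ, ContinuousAlternatingMap.sum_apply,
    ContinuousAlternatingMap.smul_apply, dzbar_apply, smul_eq_mul, Finset.sum_mul]
  have h0 : (0 : Fin 2).removeNth v 0 = v 1 := rfl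
  have h1 : (1 : Fin 2).removeNth v 0 = v 0 := rfl
  rw [h0, h1, Finset.sum_comm (γ := Fin n)]
  simp only [Fin.val_zero, pow_zero, one_smul, Fin.val_one, pow_one, neg_smul]
  rw [← sub_eq_add_neg, sub_eq_zero]
  refine Finset.sum_congr rfl fun j _ => Finset.sum_congr rfl fun k _ => ?_
  rw [hd]; ring

theorem dbar_ofFun {f : (Fin n → ℂ) → ℂ} {d : Fin n → ℂ} {Z : Fin n → ℂ} (hf : HasDbar f d Z)
    (Φ : Form n 0) (hΦ : Φ =ᶠ[𝓝 Z] Form.ofFun f) (v : Fin (0 + 1) → Fin n → ℂ) :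
    Form.dbar Φ Z v = ∑ k, d k * conj (v 0 k) := by
  have h := conjLinearPart_fderiv_sum_smul (ι := Unit) (fun _ => hf)
    (fun _ => ContinuousAlternatingMap.constOfIsEmpty ℝ (Fin n → ℂ) (Fin 0) (1 : ℂ)) Φ
    (hΦ.trans (Filter.Eventually.of_forall fun Z => by
      ext v; simp [Form.ofFun]))
  rw [dbar_apply, Fin.sum_univ_one, h]
  simp

theorem dbar_eq_zero_of_eventuallyEq {k : ℕ} {Φ : Form n k} {Z : Fin n → ℂ}
    (h : Φ =ᶠ[𝓝 Z] fun _ => 0) : Form.dbar Φ Z = 0 := by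
  ext v
  rw [dbar_apply, h.fderiv_eq]
  simp [conjLinearPart_apply]

end Dbar

/-- Moving the last slot to the front is a cyclic rotation of l + 1 slots, which has sign (−1)^l. -/
theorem contractFirst_last_apply {n N l : ℕ} (h : l + 1 = N)
    (η : (Fin n → ℂ) [⋀^Fin N]→L[ℝ] ℂ) (r : Fin l → Fin n → ℂ) (w : Fin 1 → Fin n → ℂ) :
    contractFirst h η r w = (-1) ^ l *
      η (fun i => (Fin.cons (w 0) r : Fin (l + 1) → Fin n → ℂ) (Fin.cast h.symm i)) := by
  subst h
  have h1 : (fun i => Fin.append r w (Fin.cast rfl i))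
      = (Fin.cons (w 0) r : Fin (l + 1) → Fin n → ℂ) ∘ finRotate (l + 1) := by
    funext i
    rw [Fin.append_right_eq_snoc, Fin.snoc_eq_cons_rotate]
    rfl
  change η (fun i => Fin.append r w (Fin.cast rfl i)) = _
  rw [h1]
  have h2 := η.toAlternatingMap.map_perm (Fin.cons (w 0) r : Fin (l + 1) → Fin n → ℂ)
    (finRotate (l + 1))
  rw [sign_finRotate] at h2
  refine h2.trans ?_
  rw [Nat.add_sub_cancel]
  simp only [Fin.cast_eq_self, Units.smul_def, Units.val_pow_eq_pow_val, Units.val_neg,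
    Units.val_one, zsmul_eq_mul]
  push_cast
  rfl

theorem contractFirst_zero_apply {n N l : ℕ} (h : l + 0 = N)
    (η : (Fin n → ℂ) [⋀^Fin N]→L[ℝ] ℂ) (r : Fin l → Fin n → ℂ) (w : Fin 0 → Fin n → ℂ) :
    contractFirst h η r w = η (fun i => r (Fin.cast h.symm i)) := by
  subst h
  change η _ = η _
  congr 1
  funext i
  exact Fin.append_left r w i

/-! ### The Hodge operator in the three degrees that occur. -/

namespace LatticeSetup

variable {n : ℕ}

theorem coordinateVolume_cast_frame {N : ℕ} (h : N = 2 * n) (e : Fin N ≃ Fin n × Fin 2)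
    (he : ∀ i, e i = frameIndex n (Fin.cast h i)) :
    coordinateVolume n (fun i => frame (e (Fin.cast h.symm i))) = (-2 * Complex.I) ^ n := by
  rw [← coordinateVolume_frame]
  congr 1
  funext i
  simp [he]

theorem conj_mul_self_pow : conj ((-2 * Complex.I) ^ n) * (-2 * Complex.I) ^ n = (4 : ℂ) ^ n := by
  rw [map_pow, ← mul_pow]
  congr 1
  simp only [map_mul, map_neg, Complex.conj_I, map_ofNat]
  linear_combination -4 * Complex.I_sq

theorem realMulVec_mul (A B : Matrix (Fin n) (Fin n) ℝ) (v : Fin n → ℂ) :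
    realMulVec A (realMulVec B v) = realMulVec (A * B) v := by
  funext i
  simp only [realMulVec, Matrix.mul_apply, Finset.mul_sum]
  push_cast
  simp only [Finset.sum_mul]
  rw [Finset.sum_comm]
  exact Finset.sum_congr rfl fun _ _ => Finset.sum_congr rfl fun _ _ => by ring

/-- The real coordinates of a vector in `ℂⁿ` with respect to `frame`. -/
def realCoord (x : Fin n → ℂ) (b : Fin n × Fin 2) : ℝ := ![(x b.1).re, (x b.1).im] b.2

theorem sum_realCoord (x : Fin n → ℂ) : ∑ b, realCoord x b • (frame b : Fin n → ℂ) = x := by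
  funext i
  rw [Finset.sum_apply, Fintype.sum_prod_type]
  simp only [Fin.sum_univ_two, Pi.smul_apply, realCoord, frame]
  simp only [Pi.single_apply]
  simp [Complex.re_add_im, Finset.sum_add_distrib]

variable [NeZero n] {V : Type*} [AddCommGroup V] [Module ℝ V] (M : LatticeSetup n V)

theorem hodgeStar_apply (p q : ℕ) {k l : ℕ} (h : k + l = 2 * n) (Φ : Form n k) (Z : Fin n → ℂ)
    (w : Fin l → Fin n → ℂ) : M.hodgeStar p q h Φ Z w =
      (4 : ℂ) ^ ((p : ℤ) - q) / (Nat.factorial k : ℂ) * ∑ a : Fin k → Fin n × Fin 2,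
        conj (Φ Z fun s => frame (a s)) * (M.volDensity Z *
          contractFirst h (coordinateVolume n) (fun s => M.raisedFrame Z (a s)) w) := by
  rw [hodgeStar, ContinuousAlternatingMap.smul_apply, ContinuousAlternatingMap.sum_apply]
  rfl

/-- The vector `v` with indices raised by `h^{ij}`. -/
noncomputable def raise (Z : Fin n → ℂ) (v : Fin n → ℂ) : Fin n → ℂ :=
  realMulVec (Matrix.of (M.hInv Z)) v

theorem raise_apply (Z v : Fin n → ℂ) (i : Fin n) : M.raise Z v i = ∑ k, (M.hInv Z i k : ℂ) * v k :=
  rfl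

/-- The Hodge operator on `(0, 1)`-forms. -/
theorem hodgeStar_one (Φ : Form n 1) (Z β : Fin n → ℂ)
    (hΦ : ∀ v, Φ Z v = ∑ k, β k * conj (v 0 k)) :
    M.hodgeStar 0 1 (one_add_degree n) Φ Z
      = (1 / 2 * M.volDensity Z) • antiContract (M.raise Z β) := by
  ext w
  rw [hodgeStar_apply, ← (Equiv.funUnique (Fin 1) (Fin n × Fin 2)).symm.sum_comp,
    Fintype.sum_prod_type]
  simp only [hΦ, Fin.sum_univ_two, contractFirst_one_apply _ (degree_add_one n), raisedFrame_eq]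
  -- On the pair b_i, ib_i the form takes the values β_i and −iβ_i. The two contractions combine to
  -- twice the contraction with the (0,1)-part, so the prefactor 1/4 becomes 1/2.
  have h0 : ∀ i : Fin n, ∑ k, β k * conj ((frame (i, 0) : Fin n → ℂ) k) = β i := by
    intro i
    simp [frame, Pi.single_apply, apply_ite conj]
  have h1 : ∀ i : Fin n, ∑ k, β k * conj ((frame (i, 1) : Fin n → ℂ) k) = -Complex.I * β i := by
    intro i
    simp [frame, Pi.single_apply, apply_ite conj]
    ring
  have e : ∀ (i : Fin n) (t : Fin 2) (s : Fin 1),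
      (Equiv.funUnique (Fin 1) (Fin n × Fin 2)).symm (i, t) s = (i, t) := fun _ _ _ => rfl
  simp only [e, h0, h1]
  have h2 : ∀ i : Fin n, realMulVec (Matrix.of (M.hInv Z)) (frame (i, 1))
      = Complex.I • realMulVec (Matrix.of (M.hInv Z)) (frame (i, 0)) := by
    intro i
    funext j
    simp [realMulVec, frame, Pi.single_apply, mul_comm]
  have h3 : ∀ i : Fin n, antiContract (realMulVec (Matrix.of (M.hInv Z)) (frame (i, 0))) w
      = ∑ j, (M.hInv Z j i : ℂ) * theta j w := by
    intro i
    rw [antiContract_eq, ContinuousAlternatingMap.sum_apply]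
    refine Finset.sum_congr rfl fun j _ => ?_
    simp [realMulVec, frame, Pi.single_apply]
  have h4 : antiContract (M.raise Z β) w = ∑ i, conj (β i) * ∑ j, (M.hInv Z j i : ℂ) * theta j w := by
    rw [antiContract_eq, ContinuousAlternatingMap.sum_apply]
    simp only [ContinuousAlternatingMap.smul_apply, raise_apply, map_sum, map_mul,
      Complex.conj_ofReal, smul_eq_mul, Finset.sum_mul, Finset.mul_sum]
    rw [Finset.sum_comm]
    exact Finset.sum_congr rfl fun i _ => Finset.sum_congr rfl fun j _ => by ring
  rw [ContinuousAlternatingMap.smul_apply, h4]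
  simp only [← h3, antiContract_apply_volume, h2, smul_eq_mul, Finset.mul_sum]
  refine Finset.sum_congr rfl fun i _ => ?_
  simp only [map_mul, map_neg, Complex.conj_I]
  norm_num
  ring

/-- The Hodge operator on forms of top degree. -/
theorem hodgeStar_top (Φ : Form n (2 * n - 2 + 1 + 1)) {Z : Fin n → ℂ} (hZ : 0 < M.qY Z) (g : ℂ)
    (hΦ : ∀ v, Φ Z v = g * coordinateVolume n (fun i => v (Fin.cast (degree_add_one n).symm i)))
    (w : Fin 0 → Fin n → ℂ) :
    M.hodgeStar n n degree_eq Φ Z w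
      = conj g * M.volDensity Z * 4 ^ n * ((2 * M.qY Z : ℝ) : ℂ) ^ (2 * n) := by
  set e : Fin (2 * n - 2 + 1 + 1) ≃ Fin n × Fin 2 :=
    (finCongr (degree_add_one n)).trans (frameIndex n) with he
  set D : (Fin n → ℂ) [⋀^Fin (2 * n - 2 + 1 + 1)]→ₗ[ℝ] ℂ :=
    (coordinateVolume n).toAlternatingMap.domDomCongr (finCongr (degree_add_one n).symm) with hD
  have hDv : ∀ v, D v = coordinateVolume n (fun i => v (Fin.cast (degree_add_one n).symm i)) :=
    fun _ => rfl
  have hsum := sum_conj_alternating_mul e D D frame (M.raisedFrame Z)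
  have hr : D (M.raisedFrame Z ∘ e) = ((2 * M.qY Z : ℝ) : ℂ) ^ (2 * n) * D (frame ∘ e) := by
    rw [hDv, hDv]
    simp only [Function.comp_apply, raisedFrame_eq]
    rw [coordinateVolume_realMulVec, M.det_hInv hZ]
    push_cast
    ring
  have hf : D (frame ∘ e) = (-2 * Complex.I) ^ n :=
    (hDv _).trans (coordinateVolume_cast_frame (degree_add_one n) e fun _ => rfl)
  rw [hr, hf, mul_left_comm (conj _), conj_mul_self_pow] at hsum
  rw [hodgeStar_apply]
  simp only [hΦ, contractFirst_zero_apply]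
  have h2 : ∀ a : Fin (2 * n - 2 + 1 + 1) → Fin n × Fin 2,
      conj (g * coordinateVolume n (fun i => frame (a (Fin.cast (degree_add_one n).symm i))))
        * (M.volDensity Z * coordinateVolume n
          (fun i => M.raisedFrame Z (a (Fin.cast (degree_eq (n := n)).symm i))))
      = conj g * M.volDensity Z * (conj (D (frame ∘ a)) * D (M.raisedFrame Z ∘ a)) := by
    intro a
    rw [map_mul, hDv, hDv]
    simp only [Function.comp_apply]
    ring
  rw [Finset.sum_congr rfl fun a _ => h2 a, ← Finset.mul_sum, hsum, sub_self, zpow_zero]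
  have h3 : ((2 * n - 2 + 1 + 1).factorial : ℂ) ≠ 0 := by exact_mod_cast Nat.factorial_ne_zero _
  field_simp

theorem exists_raise_eq {Z : Fin n → ℂ} (hZ : 0 < M.qY Z) (w : Fin n → ℂ) :
    ∃ u, M.raise Z u = w := by
  refine ⟨realMulVec (Matrix.of (M.hInv Z))⁻¹ w, ?_⟩
  rw [raise, realMulVec_mul, Matrix.mul_nonsing_inv]
  · funext i
    simp [realMulVec, Matrix.one_apply, apply_ite Complex.ofReal]
  · rw [M.det_hInv hZ]
    exact (pow_pos (by linarith) _).ne'.isUnit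

/-- The Hodge operator on `(n, n - 1)`-forms. -/
theorem hodgeStar_antiContract (Φ : Form n (2 * n - 2 + 1)) {Z : Fin n → ℂ} (hZ : 0 < M.qY Z)
    (x : Fin n → ℂ) (hΦ : Φ Z = antiContract (M.raise Z x)) (w : Fin 1 → Fin n → ℂ) :
    M.hodgeStar n (n - 1) (degree_add_one n) Φ Z w
      = -2 * M.volDensity Z * 4 ^ n * ((2 * M.qY Z : ℝ) : ℂ) ^ (2 * n) * ∑ k, x k * conj (w 0 k) := by
  -- Writing the free vector as a raised vector puts h into all 2n slots at once, so that det h²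
  -- factors out of the volume form.
  obtain ⟨u, hu⟩ := M.exists_raise_eq hZ (w 0)
  set e : Fin (2 * n - 2 + 1 + 1) ≃ Fin n × Fin 2 :=
    (finCongr (degree_add_one n)).trans (frameIndex n) with he
  set D : (Fin n → ℂ) [⋀^Fin (2 * n - 2 + 1 + 1)]→ₗ[ℝ] ℂ :=
    (coordinateVolume n).toAlternatingMap.domDomCongr (finCongr (degree_add_one n).symm) with hD
  have hDv : ∀ v, D v = coordinateVolume n (fun i => v (Fin.cast (degree_add_one n).symm i)) :=
    fun _ => rfl
  have hf : D (frame ∘ e) = (-2 * Complex.I) ^ n :=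
    (hDv _).trans (coordinateVolume_cast_frame (degree_add_one n) e fun _ => rfl)
  have hsum : ∀ y, ∑ a : Fin (2 * n - 2 + 1) → Fin n × Fin 2,
      conj (D (Fin.cons y (frame ∘ a))) * D (Fin.cons u (frame ∘ a))
      = ((2 * n - 2 + 1).factorial : ℂ) * 4 ^ n
        * ∑ i, (((y i).re * (u i).re + (y i).im * (u i).im : ℝ) : ℂ) := by
    intro y
    have := sum_conj_cons_mul_cons_eq e D frame (realCoord y) (realCoord u)
    rw [sum_realCoord, sum_realCoord, hf, conj_mul_self_pow, Fintype.sum_prod_type] at this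
    rw [this]
    congr 1
    refine Finset.sum_congr rfl fun i _ => ?_
    rw [Fin.sum_univ_two]
    simp [realCoord]
  have hr : ∀ a : Fin (2 * n - 2 + 1) → Fin n × Fin 2,
      contractFirst (degree_add_one n) (coordinateVolume n) (fun s => M.raisedFrame Z (a s)) w
        = -((2 * M.qY Z : ℝ) : ℂ) ^ (2 * n) * D (Fin.cons u (frame ∘ a)) := by
    intro a
    rw [contractFirst_last_apply, hDv, ← hu]
    have h1 : (fun i => (Fin.cons (M.raise Z u) (fun s => M.raisedFrame Z (a s)) :
        Fin (2 * n - 2 + 1 + 1) → Fin n → ℂ) (Fin.cast (degree_add_one n).symm i))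
        = fun i => realMulVec (Matrix.of (M.hInv Z)) ((Fin.cons u (frame ∘ a) :
          Fin (2 * n - 2 + 1 + 1) → Fin n → ℂ) (Fin.cast (degree_add_one n).symm i)) := by
      funext i
      refine Fin.cases (motive := fun i => (Fin.cons (M.raise Z u) (fun s => M.raisedFrame Z (a s)) :
        Fin (2 * n - 2 + 1 + 1) → Fin n → ℂ) i = realMulVec (Matrix.of (M.hInv Z))
          ((Fin.cons u (frame ∘ a) : Fin (2 * n - 2 + 1 + 1) → Fin n → ℂ) i)) rfl (fun i => ?_) _
      simp only [Fin.cons_succ, Function.comp_apply, raisedFrame_eq]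
    rw [h1, coordinateVolume_realMulVec, M.det_hInv hZ]
    -- The degree 2n − 1 is odd; this is the origin of the minus sign in the result.
    have h2 : (-1 : ℂ) ^ (2 * n - 2 + 1) = -1 := Odd.neg_one_pow ⟨n - 1, by omega⟩
    rw [h2]
    push_cast
    ring
  have hl : ∀ a : Fin (2 * n - 2 + 1) → Fin n × Fin 2, Φ Z (fun s => frame (a s))
      = 1 / 2 * (D (Fin.cons (M.raise Z x) (frame ∘ a))
        + Complex.I * D (Fin.cons (Complex.I • M.raise Z x) (frame ∘ a))) := by
    intro a
    rw [hΦ, antiContract_apply_volume]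
    rfl
  rw [hodgeStar_apply]
  simp only [hr, hl]
  have h2 : ∀ a : Fin (2 * n - 2 + 1) → Fin n × Fin 2,
      conj (1 / 2 * (D (Fin.cons (M.raise Z x) (frame ∘ a))
        + Complex.I * D (Fin.cons (Complex.I • M.raise Z x) (frame ∘ a))))
        * (M.volDensity Z * (-((2 * M.qY Z : ℝ) : ℂ) ^ (2 * n) * D (Fin.cons u (frame ∘ a))))
      = -(1 / 2) * M.volDensity Z * ((2 * M.qY Z : ℝ) : ℂ) ^ (2 * n) *
        (conj (D (Fin.cons (M.raise Z x) (frame ∘ a))) * D (Fin.cons u (frame ∘ a))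
        - Complex.I * (conj (D (Fin.cons (Complex.I • M.raise Z x) (frame ∘ a)))
          * D (Fin.cons u (frame ∘ a)))) := by
    intro a
    simp only [map_mul, map_add, Complex.conj_I, map_div₀, map_one, map_ofNat]
    ring
  rw [Finset.sum_congr rfl fun a _ => h2 a, ← Finset.mul_sum, Finset.sum_sub_distrib,
    ← Finset.mul_sum, hsum, hsum]
  have h3 : ((2 * n - 2 + 1).factorial : ℂ) ≠ 0 := by exact_mod_cast Nat.factorial_ne_zero _
  have h4 : (4 : ℂ) ^ ((n : ℤ) - ((n - 1 : ℕ) : ℤ)) = 4 := by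
    have := NeZero.pos n
    rw [Nat.cast_sub (by omega)]
    norm_num
  -- The real inner products with the raised vector and with i times it assemble to the hermitian
  -- pairing. Symmetry of h then moves the index from x to u.
  have h5 : ∑ i, (((M.raise Z x i).re * (u i).re + (M.raise Z x i).im * (u i).im : ℝ) : ℂ)
      - Complex.I * ∑ i, ((((Complex.I • M.raise Z x) i).re * (u i).re
        + ((Complex.I • M.raise Z x) i).im * (u i).im : ℝ) : ℂ) = ∑ k, x k * conj (w 0 k) := by
    have h6 : ∑ i, M.raise Z x i * conj (u i) = ∑ k, x k * conj (w 0 k) := by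
      rw [← hu]
      simp only [raise_apply, map_sum, map_mul, Complex.conj_ofReal, Finset.sum_mul, Finset.mul_sum]
      rw [Finset.sum_comm]
      refine Finset.sum_congr rfl fun i _ => Finset.sum_congr rfl fun j _ => ?_
      rw [M.hInv_symm]; ring
    rw [← h6, Finset.mul_sum, ← Finset.sum_sub_distrib]
    refine Finset.sum_congr rfl fun i _ => ?_
    apply Complex.ext <;> simp
  rw [← h5, h4]
  field_simp
  ring

end LatticeSetup

/-! ### Rules of calculus for ∂/∂z̄. -/

namespace HasDbar

variable {n : ℕ} {f g : (Fin n → ℂ) → ℂ} {d d' : Fin n → ℂ} {Z : Fin n → ℂ}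

theorem congr_deriv (h : HasDbar f d Z) (hd : d = d') : HasDbar f d' Z := hd ▸ h

open Topology in
theorem congr_of_eventuallyEq (h : HasDbar f d Z) (hg : g =ᶠ[𝓝 Z] f) : HasDbar g d Z :=
  ⟨h.differentiableAt.congr_of_eventuallyEq hg, fun v => by rw [hg.fderiv_eq, h.eq]⟩

theorem of_differentiableAt (h : DifferentiableAt ℂ f Z) : HasDbar f (fun _ => 0) Z := by
  refine ⟨h.restrictScalars ℝ, fun v => ?_⟩
  rw [h.fderiv_restrictScalars ℝ, conjLinearPart_apply]
  simp only [ContinuousLinearMap.coe_restrictScalars', map_smul, smul_smul, Complex.I_mul_I]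
  simp

theorem const (c : ℂ) : HasDbar (fun _ => c) (fun _ => 0) Z :=
  of_differentiableAt (differentiableAt_const c)

theorem add (hf : HasDbar f d Z) (hg : HasDbar g d' Z) :
    HasDbar (fun Z => f Z + g Z) (fun k => d k + d' k) Z := by
  refine ⟨hf.1.add hg.1, fun v => ?_⟩
  rw [fderiv_fun_add hf.1 hg.1, conjLinearPart_apply]
  simp only [add_mul, Finset.sum_add_distrib, ← hf.2, ← hg.2, conjLinearPart_apply,
    add_apply, smul_eq_mul]
  ring

theorem mul (hf : HasDbar f d Z) (hg : HasDbar g d' Z) :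
    HasDbar (fun Z => f Z * g Z) (fun k => d k * g Z + f Z * d' k) Z := by
  refine ⟨hf.1.mul hg.1, fun v => ?_⟩
  rw [fderiv_fun_mul hf.1 hg.1, conjLinearPart_apply]
  have h : ∑ k, (d k * g Z + f Z * d' k) * conj (v k)
      = g Z * ∑ k, d k * conj (v k) + f Z * ∑ k, d' k * conj (v k) := by
    rw [Finset.mul_sum, Finset.mul_sum, ← Finset.sum_add_distrib]
    exact Finset.sum_congr rfl fun _ _ => by ring
  rw [h, ← hf.2, ← hg.2]
  simp only [conjLinearPart_apply, add_apply, smul_eq_mul,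
    smul_apply]
  ring

theorem const_mul (c : ℂ) (hf : HasDbar f d Z) :
    HasDbar (fun Z => c * f Z) (fun k => c * d k) Z :=
  ((const c).mul hf).congr_deriv (by funext k; ring)

theorem neg (hf : HasDbar f d Z) : HasDbar (fun Z => -f Z) (fun k => -d k) Z := by
  simpa using hf.const_mul (-1)

theorem sub (hf : HasDbar f d Z) (hg : HasDbar g d' Z) :
    HasDbar (fun Z => f Z - g Z) (fun k => d k - d' k) Z := by
  simpa [sub_eq_add_neg] using hf.add hg.neg

theorem sum {ι : Type*} {s : Finset ι} {F : ι → (Fin n → ℂ) → ℂ} {D : ι → Fin n → ℂ}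
    (h : ∀ i ∈ s, HasDbar (F i) (D i) Z) :
    HasDbar (fun Z => ∑ i ∈ s, F i Z) (fun k => ∑ i ∈ s, D i k) Z := by
  classical
  induction s using Finset.induction_on with
  | empty => simpa using const 0
  | insert a s ha ih =>
    simp only [Finset.sum_insert ha]
    exact (h a (Finset.mem_insert_self _ _)).add
      (ih fun i hi => h i (Finset.mem_insert_of_mem hi))

/-- The chain rule for a holomorphic function of one variable. -/
theorem comp_hasDerivAt {φ : ℂ → ℂ} {φ' : ℂ} (hφ : HasDerivAt φ φ' (f Z)) (hf : HasDbar f d Z) :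
    HasDbar (fun Z => φ (f Z)) (fun k => φ' * d k) Z := by
  have h1 : HasFDerivAt (fun Z => φ (f Z)) (φ' • fderiv ℝ f Z) Z := by
    have := (hφ.hasFDerivAt.restrictScalars ℝ).comp Z hf.1.hasFDerivAt
    refine this.congr_fderiv ?_
    ext v
    simp [mul_comm]
  refine ⟨h1.differentiableAt, fun v => ?_⟩
  rw [h1.fderiv, conjLinearPart_apply]
  simp only [mul_assoc, ← Finset.mul_sum, ← hf.2, conjLinearPart_apply,
    smul_apply, smul_eq_mul]
  ring

theorem inv (hf : HasDbar f d Z) (h0 : f Z ≠ 0) :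
    HasDbar (fun Z => (f Z)⁻¹) (fun k => -d k / f Z ^ 2) Z :=
  (comp_hasDerivAt (hasDerivAt_inv h0) hf).congr_deriv (by funext k; ring)

theorem zpow (hf : HasDbar f d Z) (h0 : f Z ≠ 0) (m : ℤ) :
    HasDbar (fun Z => f Z ^ m) (fun k => m * f Z ^ (m - 1) * d k) Z :=
  comp_hasDerivAt (hasDerivAt_zpow m (f Z) (Or.inl h0)) hf

theorem pow (hf : HasDbar f d Z) (m : ℕ) :
    HasDbar (fun Z => f Z ^ m) (fun k => m * f Z ^ (m - 1) * d k) Z :=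
  comp_hasDerivAt (hasDerivAt_pow m (f Z)) hf

/-- The chain rule for a real function of a real valued function. -/
theorem comp_ofReal {s : (Fin n → ℂ) → ℝ} {φ : ℝ → ℝ} {φ' : ℝ} (hφ : HasDerivAt φ φ' (s Z))
    (hs : HasDbar (fun Z => (s Z : ℂ)) d Z) :
    HasDbar (fun Z => ((φ (s Z) : ℝ) : ℂ)) (fun k => φ' * d k) Z := by
  have hs' : DifferentiableAt ℝ s Z := by
    have := (Complex.reCLM.differentiableAt (x := (s Z : ℂ))).comp Z hs.1
    simpa [Function.comp_def] using this
  have h1 : fderiv ℝ (fun Z => (s Z : ℂ)) Z = Complex.ofRealCLM.comp (fderiv ℝ s Z) :=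
    (Complex.ofRealCLM.hasFDerivAt.comp Z hs'.hasFDerivAt).fderiv
  have h2 : HasFDerivAt (fun Z => ((φ (s Z) : ℝ) : ℂ))
      ((φ' : ℂ) • fderiv ℝ (fun Z => (s Z : ℂ)) Z) Z := by
    have := Complex.ofRealCLM.hasFDerivAt.comp Z (hφ.hasFDerivAt.comp Z hs'.hasFDerivAt)
    refine this.congr_fderiv ?_
    rw [h1]
    ext v
    simp [mul_comm]
  refine ⟨h2.differentiableAt, fun v => ?_⟩
  rw [h2.fderiv, conjLinearPart_apply]
  simp only [mul_assoc, ← Finset.mul_sum, ← hs.2, conjLinearPart_apply,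
    smul_apply, smul_eq_mul]
  ring

theorem coord (k : Fin n) : HasDbar (fun Z => Z k) (fun _ => 0) Z :=
  of_differentiableAt (by fun_prop)

theorem conj_coord (k : Fin n) :
    HasDbar (fun Z => conj (Z k)) (fun l => if l = k then 1 else 0) Z := by
  have h : HasFDerivAt (fun Z : Fin n → ℂ => conj (Z k))
      ((Complex.conjCLE : ℂ →L[ℝ] ℂ).comp (ContinuousLinearMap.proj (R := ℝ) k)) Z :=
    ((Complex.conjCLE : ℂ →L[ℝ] ℂ).hasFDerivAt).comp Z (hasFDerivAt_apply k Z)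
  refine ⟨h.differentiableAt, fun v => ?_⟩
  rw [h.fderiv, conjLinearPart_apply]
  simp [← mul_assoc]
  ring

theorem im_eq (z : ℂ) : ((z.im : ℝ) : ℂ) = -Complex.I / 2 * (z - conj z) := by
  rw [Complex.sub_conj]
  push_cast
  linear_combination (z.im : ℂ) * Complex.I_sq

theorem im_coord (k : Fin n) :
    HasDbar (fun Z => (((Z k).im : ℝ) : ℂ)) (fun l => if l = k then Complex.I / 2 else 0) Z := by
  simp only [im_eq]
  refine (((coord k).sub (conj_coord k)).const_mul _).congr_deriv ?_
  funext l
  split_ifs <;> ring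

end HasDbar

/-! ### The derivatives of (x, ψ(Z)), q(Y) and their quotient. -/

namespace LatticeSetup

variable {n : ℕ} [NeZero n] {V : Type*} [AddCommGroup V] [Module ℝ V] (M : LatticeSetup n V)

theorem qY_eq_complex (Z : Fin n → ℂ) :
    (M.qY Z : ℂ) = ∑ k, (M.q (M.b k) : ℂ) * ((Z k).im : ℂ) ^ 2 := by
  rw [qY_eq]; push_cast; rfl

theorem hasDbar_qY (Z : Fin n → ℂ) :
    HasDbar (fun Z => (M.qY Z : ℂ)) (fun k => Complex.I * M.q (M.b k) * ((Z k).im : ℂ)) Z := by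
  simp only [qY_eq_complex]
  refine (HasDbar.sum fun k _ => ((HasDbar.im_coord k).pow 2).const_mul _).congr_deriv ?_
  funext l
  rw [Finset.sum_eq_single l]
  · simp; ring
  · intro k _ hk; simp [Ne.symm hk]
  · simp

theorem differentiable_pairPsi (x : V) : Differentiable ℂ (M.pairPsi x) := by
  have : M.pairPsi x = fun Z => (M.bil x M.et : ℂ) - M.bil x M.e * M.qC Z
      + ∑ k, (M.bil x (M.b k) : ℂ) * Z k := funext fun Z => M.pairPsi_eq x Z
  rw [this]
  unfold qC
  fun_prop

theorem hasDbar_pairPsi (x : V) (Z : Fin n → ℂ) : HasDbar (M.pairPsi x) (fun _ => 0) Z :=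
  HasDbar.of_differentiableAt (M.differentiable_pairPsi x Z)

theorem conj_pairPsi (x : V) (Z : Fin n → ℂ) : conj (M.pairPsi x Z) =
    M.bil x M.et - M.bil x M.e * (∑ k, (M.q (M.b k) : ℂ) * conj (Z k) ^ 2)
      + ∑ k, (M.bil x (M.b k) : ℂ) * conj (Z k) := by
  rw [pairPsi_eq, qC]
  simp

theorem pairPsi_conj (x : V) (Z : Fin n → ℂ) :
    M.pairPsi x (fun j => conj (Z j)) = conj (M.pairPsi x Z) := by
  rw [conj_pairPsi, pairPsi_eq, qC]

/-- The derivative `∂/∂z̄_k` of the complex conjugate of `(x, ψ(Z))`. -/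
noncomputable def dPair (x : V) (Z : Fin n → ℂ) (k : Fin n) : ℂ :=
  M.bil x (M.b k) - 2 * M.bil x M.e * M.q (M.b k) * conj (Z k)

theorem hasDbar_conj_pairPsi (x : V) (Z : Fin n → ℂ) :
    HasDbar (fun Z => conj (M.pairPsi x Z)) (M.dPair x Z) Z := by
  simp only [conj_pairPsi]
  refine (((HasDbar.const _).sub ((HasDbar.sum fun k _ =>
    ((HasDbar.conj_coord k).pow 2).const_mul _).const_mul _)).add
    (HasDbar.sum fun k _ => (HasDbar.conj_coord k).const_mul _)).congr_deriv ?_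
  funext l
  rw [Finset.sum_eq_single l (by intro k _ hk; simp [Ne.symm hk]) (by simp),
    Finset.sum_eq_single l (by intro k _ hk; simp [Ne.symm hk]) (by simp), dPair]
  simp
  ring

theorem hasDbar_dPair (x : V) (Z : Fin n → ℂ) (k : Fin n) :
    HasDbar (fun Z => M.dPair x Z k)
      (fun l => if l = k then -2 * M.bil x M.e * M.q (M.b k) else 0) Z := by
  unfold dPair
  refine ((HasDbar.const _).sub ((HasDbar.conj_coord k).const_mul _)).congr_deriv ?_
  funext l
  split_ifs <;> ring

/-- Taylor expansion of the quadratic polynomial (x, ψ(·)) at Z̄ in the direction 2iY, since Z = Z̄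
+ 2iY. -/
theorem sum_im_mul_dPair (x : V) (Z : Fin n → ℂ) :
    ∑ k, ((Z k).im : ℂ) * M.dPair x Z k = -Complex.I / 2 *
      (M.pairPsi x Z - conj (M.pairPsi x Z) - 4 * M.bil x M.e * M.qY Z) := by
  rw [conj_pairPsi, pairPsi_eq, qC, qY_eq_complex]
  have : (M.bil x M.et : ℂ) - M.bil x M.e * (∑ j, (M.q (M.b j) : ℂ) * Z j ^ 2)
      + ∑ k, (M.bil x (M.b k) : ℂ) * Z k - ((M.bil x M.et : ℂ)
      - M.bil x M.e * (∑ k, (M.q (M.b k) : ℂ) * conj (Z k) ^ 2)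
      + ∑ k, (M.bil x (M.b k) : ℂ) * conj (Z k))
      - 4 * M.bil x M.e * ∑ k, (M.q (M.b k) : ℂ) * ((Z k).im : ℂ) ^ 2
      = ∑ k, ((M.bil x (M.b k) : ℂ) * (Z k - conj (Z k))
        - M.bil x M.e * M.q (M.b k) * (Z k ^ 2 - conj (Z k) ^ 2)
        - 4 * M.bil x M.e * (M.q (M.b k) * ((Z k).im : ℂ) ^ 2)) := by
    simp only [Finset.sum_sub_distrib, mul_sub, ← Finset.mul_sum, mul_assoc]
    ring
  rw [this, Finset.mul_sum]
  refine Finset.sum_congr rfl fun k _ => ?_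
  rw [dPair, HasDbar.im_eq]
  linear_combination (Complex.I / 2 * M.bil x M.e * M.q (M.b k) * (Z k - conj (Z k)) ^ 2)
    * Complex.I_sq * -1

/-- Completing the square: the norm of the gradient of a quadratic polynomial is its discriminant
plus a multiple of its value. -/
theorem sum_eps_mul_dPair_sq (x : V) (Z : Fin n → ℂ) :
    ∑ k, (M.q (M.b k) : ℂ) * M.dPair x Z k ^ 2
      = 4 * (M.q x - M.bil x M.e * conj (M.pairPsi x Z)) := by
  have h : ∀ k, (M.q (M.b k) : ℂ) * M.q (M.b k) = 1 := fun k => by exact_mod_cast M.eps_sq k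
  rw [conj_pairPsi, q_eq]
  push_cast
  have : (4 : ℂ) * (M.bil x M.et * M.bil x M.e + ∑ k, (M.q (M.b k) : ℂ) / 4 * M.bil x (M.b k) ^ 2
      - M.bil x M.e * (M.bil x M.et - M.bil x M.e * (∑ k, (M.q (M.b k) : ℂ) * conj (Z k) ^ 2)
      + ∑ k, (M.bil x (M.b k) : ℂ) * conj (Z k)))
      = ∑ k, (4 * ((M.q (M.b k) : ℂ) / 4 * M.bil x (M.b k) ^ 2)
        + 4 * M.bil x M.e * M.bil x M.e * (M.q (M.b k) * conj (Z k) ^ 2)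
        - 4 * M.bil x M.e * (M.bil x (M.b k) * conj (Z k))) := by
    simp only [Finset.sum_sub_distrib, Finset.sum_add_distrib, ← Finset.mul_sum]
    ring
  rw [this]
  refine Finset.sum_congr rfl fun k _ => ?_
  rw [dPair]
  linear_combination (-4 * (M.bil x (M.b k) : ℂ) * M.bil x M.e * conj (Z k)
    + 4 * M.bil x M.e ^ 2 * conj (Z k) ^ 2 * M.q (M.b k)) * h k

/-- The coefficients of `∂̄((x, ψ(Z̄)) / q(Y))`. -/
noncomputable def betaCoeff (x : V) (Z : Fin n → ℂ) (k : Fin n) : ℂ :=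
  M.dPair x Z k / M.qY Z
    - Complex.I * M.q (M.b k) * ((Z k).im : ℂ) * conj (M.pairPsi x Z) / (M.qY Z : ℂ) ^ 2

theorem hasDbar_quotient (x : V) {Z : Fin n → ℂ} (hZ : 0 < M.qY Z) :
    HasDbar (fun Z => conj (M.pairPsi x Z) / M.qY Z) (M.betaCoeff x Z) Z := by
  have h0 : (M.qY Z : ℂ) ≠ 0 := by exact_mod_cast hZ.ne'
  simp only [div_eq_mul_inv]
  refine ((M.hasDbar_conj_pairPsi x Z).mul ((M.hasDbar_qY Z).inv h0)).congr_deriv ?_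
  funext k
  rw [betaCoeff]
  ring

/-- The coefficients of `p_Z(x)` with respect to the forms `ι_{∂/∂z̄_j} dμ`. -/
noncomputable def pCoeff (x : V) (Z : Fin n → ℂ) (j : Fin n) : ℂ :=
  Complex.I * ((Z j).im : ℂ) * conj (M.pairPsi x Z) - M.qY Z * M.q (M.b j) * M.dPair x Z j

theorem conj_dPair (x : V) (Z : Fin n → ℂ) (k : Fin n) : conj (M.dPair x Z k)
    = M.dPair x Z k - 4 * Complex.I * M.bil x M.e * M.q (M.b k) * ((Z k).im : ℂ) := by
  simp only [dPair, map_sub, map_mul, Complex.conj_ofReal, Complex.conj_conj, map_ofNat,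
    HasDbar.im_eq]
  linear_combination (2 * (M.bil x M.e : ℂ) * M.q (M.b k) * (Z k - conj (Z k))) * -Complex.I_sq

/-- The coefficients `pCoeff` are, up to conjugation and the factor q(Y)/2, those of ∂̄((x,
ψ(Z̄))/q(Y)) with the index raised. This identifies p_Z(x) as a contraction of dμ. -/
theorem raise_betaCoeff (x : V) {Z : Fin n → ℂ} (hZ : 0 < M.qY Z) (j : Fin n) :
    1 / 2 * (M.qY Z : ℂ) * M.raise Z (M.betaCoeff x Z) j = conj (M.pCoeff x Z j) := by
  have h0 : (M.qY Z : ℂ) ≠ 0 := by exact_mod_cast hZ.ne'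
  have hε : (M.q (M.b j) : ℂ) * M.q (M.b j) = 1 := by exact_mod_cast M.eps_sq j
  have h1 : M.raise Z (M.betaCoeff x Z) j = 4 * ((Z j).im : ℂ) * ∑ k, ((Z k).im : ℂ) * M.betaCoeff x Z k
      - 2 * M.qY Z * M.q (M.b j) * M.betaCoeff x Z j := by
    simp only [raise_apply, hInv]
    push_cast
    simp only [sub_mul, Finset.sum_sub_distrib, Finset.mul_sum, apply_ite Complex.ofReal]
    congr 1
    · exact Finset.sum_congr rfl fun _ _ => by ring
    · simp
  have h2 : ∑ k, ((Z k).im : ℂ) * M.betaCoeff x Z k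
      = (∑ k, ((Z k).im : ℂ) * M.dPair x Z k) / M.qY Z
        - Complex.I * conj (M.pairPsi x Z) / (M.qY Z : ℂ) ^ 2
          * ∑ k, (M.q (M.b k) : ℂ) * ((Z k).im : ℂ) ^ 2 := by
    rw [Finset.mul_sum, Finset.sum_div, ← Finset.sum_sub_distrib]
    exact Finset.sum_congr rfl fun _ _ => by rw [betaCoeff]; ring
  rw [h1, h2, sum_im_mul_dPair, ← qY_eq_complex, pCoeff, betaCoeff]
  simp only [map_sub, map_mul, Complex.conj_ofReal, Complex.conj_conj, Complex.conj_I, conj_dPair]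
  field_simp
  linear_combination (4 * ((Z j).im : ℂ) * Complex.I * conj (M.pairPsi x Z)
    - 16 * ((Z j).im : ℂ) * Complex.I * M.qY Z * M.bil x M.e) * hε

/-- Up to the factor q(Y)/2 this is the squared length of ∂̄((x, ψ(Z̄))/q(Y)). The value is
−4q(x_{Z⁻}), which cancels the pole 1/(s − m) in the derivative of the radial factor. -/
theorem sum_pCoeff_mul_betaCoeff (x : V) {Z : Fin n → ℂ} (hZ : 0 < M.qY Z) :
    ∑ j, M.pCoeff x Z j * M.betaCoeff x Z j
      = M.pairPsi x Z * conj (M.pairPsi x Z) / M.qY Z - 4 * M.q x := by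
  have h0 : (M.qY Z : ℂ) ≠ 0 := by exact_mod_cast hZ.ne'
  have hε : ∀ j, (M.q (M.b j) : ℂ) * M.q (M.b j) = 1 := fun j => by exact_mod_cast M.eps_sq j
  have h1 : ∑ j, M.pCoeff x Z j * M.betaCoeff x Z j =
      2 * Complex.I * conj (M.pairPsi x Z) / M.qY Z * ∑ k, ((Z k).im : ℂ) * M.dPair x Z k
      + conj (M.pairPsi x Z) ^ 2 / (M.qY Z : ℂ) ^ 2 * ∑ k, (M.q (M.b k) : ℂ) * ((Z k).im : ℂ) ^ 2
      - ∑ k, (M.q (M.b k) : ℂ) * M.dPair x Z k ^ 2 := by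
    rw [Finset.mul_sum, Finset.mul_sum, ← Finset.sum_add_distrib, ← Finset.sum_sub_distrib]
    refine Finset.sum_congr rfl fun j _ => ?_
    rw [pCoeff, betaCoeff]
    field_simp
    linear_combination (M.qY Z * Complex.I * ((Z j).im : ℂ) * conj (M.pairPsi x Z)
      * M.dPair x Z j) * hε j - ((Z j).im : ℂ) ^ 2 * conj (M.pairPsi x Z) ^ 2 * M.q (M.b j)
      * Complex.I_sq
  rw [h1, sum_im_mul_dPair, ← qY_eq_complex, sum_eps_mul_dPair_sq]
  field_simp
  linear_combination (conj (M.pairPsi x Z) * (-(M.pairPsi x Z) + conj (M.pairPsi x Z)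
    + 4 * M.qY Z * M.bil x M.e)) * Complex.I_sq

end LatticeSetup

/-! ### The hypergeometric function and the radial differential equation. -/

section Hypergeometric

theorem ringChoose_eq_ascPochhammer (a : ℝ) (k : ℕ) :
    Ring.choose (a + k - 1) k = (k.factorial : ℝ)⁻¹ * (ascPochhammer ℝ k).eval a := by
  have h := Ring.factorial_nsmul_multichoose_eq_ascPochhammer a k
  rw [Polynomial.ascPochhammer_smeval_eq_eval, Ring.multichoose_eq, nsmul_eq_mul] at h
  rw [← h, inv_mul_cancel_left₀ (by positivity)]

/-- With c = b + 1 the quotient of Pochhammer symbols telescopes to b/(b + k). The series is thus a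
weighted binomial series and is dominated by it. -/
theorem ordinaryHypergeometricCoefficient_add_one (a : ℝ) {b : ℝ} (hb : 0 < b) (k : ℕ) :
    ordinaryHypergeometricCoefficient a b (b + 1) k
      = Ring.choose (a + k - 1) k * (b / (b + k)) := by
  have h1 : ∀ k : ℕ, (ascPochhammer ℝ k).eval (b + 1) * b = (ascPochhammer ℝ k).eval b * (b + k) := by
    intro k
    rw [← ascPochhammer_succ_eval, ascPochhammer_succ_left, Polynomial.eval_mul,
      Polynomial.eval_comp]
    simp [mul_comm]
  have h2 : 0 < (ascPochhammer ℝ k).eval (b + 1) := ascPochhammer_pos k _ (by linarith)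
  have h3 : (0 : ℝ) < b + k := by positivity
  rw [ringChoose_eq_ascPochhammer, ordinaryHypergeometricCoefficient]
  field_simp
  linear_combination -((ascPochhammer ℝ k).eval a) * h1 k

variable {A : Type*} [NormedRing A] [NormedAlgebra ℝ A] [NormOneClass A]

/-- Only the norms of the coefficients matter, so the bound passes from ℝ to any normed algebra with
a unit of norm 1. It is used below for the algebra of bounded families. -/
theorem one_le_radius_binomial (a : ℝ) :
    1 ≤ (FormalMultilinearSeries.ofScalars A fun k : ℕ => Ring.choose (a + k - 1) k).radius := by
  refine (Real.one_div_one_sub_rpow_hasFPowerSeriesOnBall_zero a).r_le.trans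
    (FormalMultilinearSeries.radius_le_of_le fun k => ?_)
  rw [FormalMultilinearSeries.ofScalars_norm, FormalMultilinearSeries.ofScalars_norm]

theorem one_le_radius_hypergeometric (a : ℝ) {b : ℝ} (hb : 0 < b) :
    1 ≤ (ordinaryHypergeometricSeries A a b (b + 1)).radius := by
  refine (Real.one_div_one_sub_rpow_hasFPowerSeriesOnBall_zero a).r_le.trans
    (FormalMultilinearSeries.radius_le_of_le fun k => ?_)
  rw [ordinaryHypergeometricSeries, FormalMultilinearSeries.ofScalars_norm,
    FormalMultilinearSeries.ofScalars_norm, ordinaryHypergeometricCoefficient_add_one a hb, norm_mul]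
  have h3 : (0 : ℝ) < b + k := by positivity
  refine mul_le_of_le_one_right (norm_nonneg _) ?_
  rw [Real.norm_of_nonneg (by positivity), div_le_one h3]
  linarith [(Nat.cast_nonneg k : (0 : ℝ) ≤ k)]

theorem hasFPowerSeriesOnBall_hypergeometric [CompleteSpace A] (a : ℝ) {b : ℝ} (hb : 0 < b) :
    HasFPowerSeriesOnBall (ordinaryHypergeometric a b (b + 1) : A → A)
      (ordinaryHypergeometricSeries A a b (b + 1)) 0 1 :=
  ((ordinaryHypergeometricSeries A a b (b + 1)).hasFPowerSeriesOnBall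
    (zero_lt_one.trans_le (one_le_radius_hypergeometric a hb))).mono zero_lt_one
      (one_le_radius_hypergeometric a hb)

/-- The hypergeometric function `F(a, b; b + 1; x)` satisfies `x F' + b F = b (1 - x) ^ (-a)`. -/
theorem hasDerivAt_hypergeometric (a : ℝ) {b : ℝ} (hb : 0 < b) {x : ℝ} (hx : |x| < 1) :
    ∃ F' : ℝ, HasDerivAt (ordinaryHypergeometric a b (b + 1)) F' x ∧
      x * F' + b * ordinaryHypergeometric a b (b + 1) x = b * (1 / (1 - x) ^ a) := by
  set F : ℝ → ℝ := ordinaryHypergeometric a b (b + 1) with hF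
  have hp := hasFPowerSeriesOnBall_hypergeometric (A := ℝ) a hb
  have hx' : x ∈ Metric.eball (0 : ℝ) 1 := by
    rw [Metric.mem_eball, edist_zero_right, enorm_eq_nnnorm]
    exact_mod_cast hx
  have hd : DifferentiableAt ℝ F x :=
    (hp.analyticAt_of_mem hx').differentiableAt
  refine ⟨_, hd.hasDerivAt, ?_⟩
  have h1 := hp.fderiv.hasSum hx'
  rw [zero_add] at h1
  have h2 := h1.mapL (ContinuousLinearMap.apply ℝ ℝ x)
  simp only [ContinuousLinearMap.apply_apply, FormalMultilinearSeries.derivSeries_apply_diag] at h2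
  have h3 : fderiv ℝ F x x = x * deriv F x := by
    rw [← fderiv_apply_one_eq_deriv, ← smul_eq_mul, ← map_smul]
    simp
  have h4 := hp.hasSum hx'
  rw [zero_add] at h4
  have h5 := (Real.one_div_one_sub_rpow_hasFPowerSeriesOnBall_zero a).hasSum hx'
  rw [zero_add] at h5
  -- The operator xF' + bF multiplies the k-th coefficient by k + b, which cancels the weight b/(b +
  -- k) and leaves b times the binomial series.
  have h6 : HasSum (fun k : ℕ => (k : ℝ) * ordinaryHypergeometricSeries ℝ a b (b + 1) k fun _ => x)
      (fderiv ℝ F x x) := by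
    rw [← hasSum_nat_add_iff' 1]
    simpa [nsmul_eq_mul] using h2
  rw [← h3]
  refine (h6.add (h4.mul_left b)).unique ((h5.mul_left b).congr_fun fun k => ?_)
  rw [ordinaryHypergeometricSeries, FormalMultilinearSeries.ofScalars_apply_eq,
    FormalMultilinearSeries.ofScalars_apply_eq, ordinaryHypergeometricCoefficient_add_one a hb]
  have h7 : (0 : ℝ) < b + k := by positivity
  simp only [smul_eq_mul]
  field_simp
  ring

/-- The radial factor of `p̃`, as a function of `s = q(x_{Z⁺})`, for `m = q(x)`. -/
noncomputable def radial (n : ℕ) (κ : ℤ) (m s : ℝ) : ℝ :=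
  ((-(m - s)) ^ ((n : ℝ) / 2))⁻¹ * s ^ ((n : ℝ) / 2 - κ) *
    ordinaryHypergeometric (1 - (n : ℝ) / 2) (κ - (n : ℝ) / 2) (κ - (n : ℝ) / 2 + 1) (m / s)
      / (-((4 : ℝ) ^ κ * (κ - (n : ℝ) / 2)))

/-- Isolates s^(-κ) times power series in m/s; in this form the factor can be evaluated on bounded
families. -/
theorem radial_eq (n : ℕ) (κ : ℤ) {m s : ℝ} (hm : 0 < m) (hs : m < s) :
    radial n κ m s = (-((4 : ℝ) ^ κ * (κ - (n : ℝ) / 2)))⁻¹ * (s ^ κ)⁻¹ *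
      (1 / (1 - m / s) ^ ((n : ℝ) / 2)) *
      ordinaryHypergeometric (1 - (n : ℝ) / 2) (κ - (n : ℝ) / 2) (κ - (n : ℝ) / 2 + 1) (m / s) := by
  have hs0 : 0 < s := hm.trans hs
  have h1 : -(m - s) = s * (1 - m / s) := by field_simp; ring
  have h2 : 0 < 1 - m / s := by rw [sub_pos, div_lt_one hs0]; exact hs
  have h3 : s ^ ((n : ℝ) / 2) ≠ 0 := (Real.rpow_pos_of_pos hs0 _).ne'
  rw [radial, h1, Real.mul_rpow hs0.le h2.le, Real.rpow_sub hs0, Real.rpow_intCast]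
  field_simp

/-- This is the equation (s − m)G' + (n/2)G = (4s)^(-κ). The product rule reduces it to the
first-order relation of `hasDerivAt_hypergeometric`, and it is the reason for the parameters of the
hypergeometric function. -/
theorem hasDerivAt_radial (n : ℕ) {κ : ℤ} (hκ : (n : ℝ) / 2 < κ) {m s : ℝ} (hm : 0 < m)
    (hs : m < s) : HasDerivAt (radial n κ m)
      (-((n : ℝ) / 2) / (s - m) * radial n κ m s + ((4 : ℝ) ^ κ)⁻¹ * (s - m)⁻¹ * (s ^ κ)⁻¹) s := by
  have hs0 : 0 < s := hm.trans hs
  have hsm : 0 < -(m - s) := by linarith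
  have hb : 0 < (κ : ℝ) - (n : ℝ) / 2 := by linarith
  have hx : |m / s| < 1 := by rw [abs_of_pos (by positivity), div_lt_one hs0]; exact hs
  obtain ⟨F', hF', hode⟩ := hasDerivAt_hypergeometric (1 - (n : ℝ) / 2) hb hx
  have d1 : HasDerivAt (fun s : ℝ => ((-(m - s)) ^ ((n : ℝ) / 2)))
      (1 * ((n : ℝ) / 2) * (-(m - s)) ^ ((n : ℝ) / 2 - 1)) s :=
    HasDerivAt.rpow_const (((hasDerivAt_id s).const_sub m).neg.congr_deriv (by simp)) (Or.inl hsm.ne')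
  have d2 : HasDerivAt (fun s : ℝ => s ^ ((n : ℝ) / 2 - κ))
      (((n : ℝ) / 2 - κ) * s ^ ((n : ℝ) / 2 - κ - 1)) s :=
    Real.hasDerivAt_rpow_const (Or.inl hs0.ne')
  have d3 : HasDerivAt (fun s : ℝ => m / s) (-m / s ^ 2) s := by
    simpa [div_eq_mul_inv, mul_comm] using (hasDerivAt_inv hs0.ne').const_mul m
  have hp : (-(m - s)) ^ ((n : ℝ) / 2) ≠ 0 := (Real.rpow_pos_of_pos hsm _).ne'
  have d4 := (((d1.inv hp).mul d2).mul (hF'.comp s d3)).div_const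
    (-((4 : ℝ) ^ κ * (κ - (n : ℝ) / 2)))
  refine d4.congr_deriv ?_
  have e1 : 1 - m / s = -(m - s) / s := by field_simp; ring
  have e2 : (-(m - s)) ^ ((n : ℝ) / 2 - 1) = (-(m - s)) ^ ((n : ℝ) / 2) / (-(m - s)) := by
    rw [Real.rpow_sub hsm, Real.rpow_one]
  have e3 : s ^ ((n : ℝ) / 2 - κ - 1) = s ^ ((n : ℝ) / 2) / s ^ κ / s := by
    rw [Real.rpow_sub hs0, Real.rpow_sub hs0, Real.rpow_one, Real.rpow_intCast]
  have e4 : s ^ ((n : ℝ) / 2 - κ) = s ^ ((n : ℝ) / 2) / s ^ κ := by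
    rw [Real.rpow_sub hs0, Real.rpow_intCast]
  have e5 : 1 / (1 - m / s) ^ (1 - (n : ℝ) / 2)
      = (-(m - s)) ^ ((n : ℝ) / 2) / (-(m - s)) / (s ^ ((n : ℝ) / 2) / s) := by
    rw [e1, Real.div_rpow hsm.le hs0.le, Real.rpow_sub hsm, Real.rpow_sub hs0, Real.rpow_one,
      Real.rpow_one]
    field_simp
  rw [e5] at hode
  rw [radial, e2, e3, e4]
  simp only [Pi.mul_apply, Pi.inv_apply, Function.comp_apply, e4]
  set F := ordinaryHypergeometric (1 - (n : ℝ) / 2) (κ - (n : ℝ) / 2) (κ - (n : ℝ) / 2 + 1) (m / s)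
  set P := (-(m - s)) ^ ((n : ℝ) / 2)
  have hR : s ^ ((n : ℝ) / 2) ≠ 0 := (Real.rpow_pos_of_pos hs0 _).ne'
  set R := s ^ ((n : ℝ) / 2)
  have hK : s ^ κ ≠ 0 := (zpow_pos hs0 _).ne'
  set K := s ^ κ
  set T := (4 : ℝ) ^ κ
  have hT : T ≠ 0 := by positivity
  have hF'' : m * F' = s * ((κ - (n : ℝ) / 2) * (P / (-(m - s)) / (R / s)))
      - s * (κ - (n : ℝ) / 2) * F := by
    have := congrArg (fun t => s * t) hode
    simp only [mul_add] at this
    have e6 : s * (m / s * F') = m * F' := by field_simp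
    rw [e6] at this
    linear_combination this
  set b := (κ : ℝ) - (n : ℝ) / 2 with hbdef
  have hn2 : (n : ℝ) / 2 = κ - b := by rw [hbdef]; ring
  have hms : s - m ≠ 0 := by linarith
  have hms' : -(m - s) = s - m := by ring
  rw [hms'] at hF'' ⊢
  have e7 : F' = (s * (b * (P / (s - m) / (R / s))) - s * b * F) / m := by
    rw [← hF'']; field_simp
  rw [e7]
  field_simp
  ring

end Hypergeometric

/-! ### The divergence of p̃ and the closedness of its Hodge dual. -/

namespace LatticeSetup

open Topology

variable {n : ℕ} [NeZero n] {V : Type*} [AddCommGroup V] [Module ℝ V] (M : LatticeSetup n V)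

theorem continuous_qY : Continuous M.qY := by
  have : M.qY = fun Z => ∑ j, M.q (M.b j) * (Z j).im ^ 2 := funext M.qY_eq
  rw [this]
  fun_prop

theorem qPos_eq_complex (x : V) (Z : Fin n → ℂ) : (M.qPos x Z : ℂ)
    = M.pairPsi x Z * (conj (M.pairPsi x Z) / M.qY Z) / 4 := by
  rw [qPos_eq]
  push_cast
  rw [← Complex.mul_conj]
  ring

/-- Here q(x_{Z⁺}) is a quarter of the product of the holomorphic (x, ψ(Z)) with (x, ψ(Z̄))/q(Y), so
its ∂̄ is proportional to that of the second factor. -/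
theorem hasDbar_qPos (x : V) {Z : Fin n → ℂ} (hZ : 0 < M.qY Z) :
    HasDbar (fun Z => (M.qPos x Z : ℂ)) (fun k => M.pairPsi x Z / 4 * M.betaCoeff x Z k) Z := by
  simp only [qPos_eq_complex, div_eq_mul_inv _ (4 : ℂ)]
  refine (((M.hasDbar_pairPsi x Z).mul (M.hasDbar_quotient x hZ)).mul
    (HasDbar.const (4 : ℂ)⁻¹)).congr_deriv ?_
  funext k
  ring

theorem hasDbar_pCoeff (x : V) (Z : Fin n → ℂ) (j : Fin n) :
    HasDbar (fun Z => M.pCoeff x Z j) (fun l =>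
      (if l = j then -conj (M.pairPsi x Z) / 2 + 2 * M.bil x M.e * M.qY Z else 0)
      + Complex.I * ((Z j).im : ℂ) * M.dPair x Z l
      - Complex.I * M.q (M.b l) * ((Z l).im : ℂ) * M.q (M.b j) * M.dPair x Z j) Z := by
  have hε : (M.q (M.b j) : ℂ) * M.q (M.b j) = 1 := by exact_mod_cast M.eps_sq j
  refine ((((HasDbar.im_coord j).const_mul Complex.I).mul (M.hasDbar_conj_pairPsi x Z)).sub
    (((M.hasDbar_qY Z).mul (HasDbar.const (M.q (M.b j) : ℂ))).mul
      (M.hasDbar_dPair x Z j))).congr_deriv ?_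
  funext l
  split_ifs with h
  · linear_combination (conj (M.pairPsi x Z) / 2) * Complex.I_sq
      + (2 * M.bil x M.e * M.qY Z) * hε
  · ring

theorem sum_eps_mul_im_mul_pCoeff (x : V) (Z : Fin n → ℂ) :
    ∑ j, (M.q (M.b j) : ℂ) * ((Z j).im : ℂ) * M.pCoeff x Z j = Complex.I * M.qY Z *
      ((M.pairPsi x Z + conj (M.pairPsi x Z)) / 2 - 2 * M.bil x M.e * M.qY Z) := by
  have hε : ∀ j, (M.q (M.b j) : ℂ) * M.q (M.b j) = 1 := fun j => by exact_mod_cast M.eps_sq j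
  have h1 : ∑ j, (M.q (M.b j) : ℂ) * ((Z j).im : ℂ) * M.pCoeff x Z j =
      Complex.I * conj (M.pairPsi x Z) * ∑ k, (M.q (M.b k) : ℂ) * ((Z k).im : ℂ) ^ 2
      - M.qY Z * ∑ k, ((Z k).im : ℂ) * M.dPair x Z k := by
    rw [Finset.mul_sum, Finset.mul_sum, ← Finset.sum_sub_distrib]
    refine Finset.sum_congr rfl fun j _ => ?_
    rw [pCoeff]
    linear_combination (-((Z j).im : ℂ) * M.qY Z * M.dPair x Z j) * hε j
  rw [h1, sum_im_mul_dPair, ← qY_eq_complex]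
  ring

theorem hasDbar_volDensity {Z : Fin n → ℂ} (hZ : 0 < M.qY Z) :
    HasDbar M.volDensity (fun k => -(n : ℂ) * M.volDensity Z / M.qY Z
      * (Complex.I * M.q (M.b k) * ((Z k).im : ℂ))) Z := by
  have h0 : (M.qY Z : ℂ) ≠ 0 := by exact_mod_cast hZ.ne'
  have h1 : M.volDensity = fun Z => ((4 * Complex.I * M.qY Z) ^ n)⁻¹ := by
    funext Z; rw [volDensity, one_div]
  have h2 : 4 * Complex.I * (M.qY Z : ℂ) ≠ 0 := by simp [h0]
  rw [h1]
  refine ((((M.hasDbar_qY Z).const_mul (4 * Complex.I)).pow n).inv (pow_ne_zero n h2)).congr_deriv ?_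
  funext k
  obtain ⟨m, hm⟩ : ∃ m, n = m + 1 := ⟨n - 1, by have := NeZero.pos n; omega⟩
  have h3 : (4 * Complex.I * (M.qY Z : ℂ)) ^ n
      = (4 * Complex.I * (M.qY Z : ℂ)) ^ (n - 1) * (4 * Complex.I * (M.qY Z : ℂ)) := by
    rw [← pow_succ, show n - 1 + 1 = n by omega]
  have h4 := pow_ne_zero (n - 1) h2
  rw [h3]
  set E := (4 * Complex.I * (M.qY Z : ℂ)) ^ (n - 1)
  have hI := Complex.I_ne_zero
  field_simp
  linear_combination (-(n : ℂ) * M.q (M.b k) * ((Z k).im : ℂ)) * h3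

/-- The coefficients of `p̃_Z(x)` with respect to the forms `theta j`. -/
noncomputable def termCoeff (κ : ℤ) (x : V) (Z : Fin n → ℂ) (j : Fin n) : ℂ :=
  M.pairPsi x Z ^ (κ - 1) * (radial n κ (M.q x) (M.qPos x Z) : ℝ) *
    (M.pCoeff x Z j * M.volDensity Z)

/-- The divergence of the coefficients of `p̃_Z(x)`. -/
noncomputable def termDiv (κ : ℤ) (x : V) (Z : Fin n → ℂ) : ℂ :=
  M.volDensity Z * (M.qY Z / conj (M.pairPsi x Z)) ^ κ

theorem pairPsi_ne_zero_of_lt {x : V} {Z : Fin n → ℂ} (hx : 0 < M.q x) (h : M.q x < M.qPos x Z) :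
    M.pairPsi x Z ≠ 0 := by
  intro h0
  rw [qPos_eq, h0] at h
  simp at h
  linarith

theorem hasDbar_radial {κ : ℤ} (hκ : (n : ℝ) / 2 < κ) {x : V} {Z : Fin n → ℂ} (hZ : 0 < M.qY Z)
    (hx : 0 < M.q x) (h : M.q x < M.qPos x Z) :
    HasDbar (fun Z => ((radial n κ (M.q x) (M.qPos x Z) : ℝ) : ℂ)) (fun k =>
      ((-((n : ℝ) / 2) / (M.qPos x Z - M.q x) * radial n κ (M.q x) (M.qPos x Z)
        + ((4 : ℝ) ^ κ)⁻¹ * (M.qPos x Z - M.q x)⁻¹ * (M.qPos x Z ^ κ)⁻¹ : ℝ) : ℂ)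
        * (M.pairPsi x Z / 4 * M.betaCoeff x Z k)) Z :=
  HasDbar.comp_ofReal (hasDerivAt_radial n hκ hx h) (M.hasDbar_qPos x hZ)

/-- The derivative of the radial factor contributes 4(s − m) through `sum_pCoeff_mul_betaCoeff`. The
derivatives of `pCoeff` and of the density add up to (n/2)(x, ψ(Z)). The radial equation evaluates
the sum of the two. -/
theorem exists_hasDbar_termCoeff {κ : ℤ} (hκ : (n : ℝ) / 2 < κ) {x : V} {Z : Fin n → ℂ}
    (hZ : 0 < M.qY Z) (hx : 0 < M.q x) (h : M.q x < M.qPos x Z) :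
    ∃ d : Fin n → Fin n → ℂ, (∀ j, HasDbar (fun Z => M.termCoeff κ x Z j) (d j) Z) ∧
      ∑ j, d j j = M.termDiv κ x Z := by
  have h0 : (M.qY Z : ℂ) ≠ 0 := by exact_mod_cast hZ.ne'
  have ha := M.pairPsi_ne_zero_of_lt hx h
  have ha' : conj (M.pairPsi x Z) ≠ 0 := by simpa using ha
  refine ⟨_, fun j => (((HasDbar.zpow (M.hasDbar_pairPsi x Z) ha (κ - 1)).mul
    (M.hasDbar_radial hκ hZ hx h)).mul ((M.hasDbar_pCoeff x Z j).mul (M.hasDbar_volDensity hZ))), ?_⟩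
  set a := M.pairPsi x Z with hadef
  set G := radial n κ (M.q x) (M.qPos x Z)
  set s := M.qPos x Z with hs
  set vc := M.volDensity Z
  have hsm : ((s : ℂ) - M.q x) ≠ 0 := by
    have : s - M.q x ≠ 0 := by linarith
    exact_mod_cast this
  have hsC : (4 : ℂ) * s = a * conj a / M.qY Z := by rw [hs, qPos_eq_complex]; ring
  have hs0 : (s : ℂ) ≠ 0 := by
    have : s ≠ 0 := by linarith
    exact_mod_cast this
  set c1 : ℂ := a ^ (κ - 1) * (a / 4) * vc * (-((n : ℂ) / 2) / (s - M.q x) * G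
    + ((4 : ℂ) ^ κ)⁻¹ * (s - M.q x : ℂ)⁻¹ * ((s : ℂ) ^ κ)⁻¹)
  have h1 : ∑ j, M.pCoeff x Z j * M.betaCoeff x Z j = 4 * (s - M.q x) := by
    rw [M.sum_pCoeff_mul_betaCoeff x hZ, ← hadef, ← hsC]; ring
  have h2 := M.sum_eps_mul_im_mul_pCoeff x Z
  have hε : ∀ j, (M.q (M.b j) : ℂ) * M.q (M.b j) = 1 := fun j => by exact_mod_cast M.eps_sq j
  have h3 : termDiv M κ x Z = vc * a ^ κ * ((4 : ℂ) ^ κ)⁻¹ * ((s : ℂ) ^ κ)⁻¹ := by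
    rw [termDiv, mul_assoc, mul_assoc, ← mul_inv, ← mul_zpow, hsC, ← div_eq_mul_inv, ← div_zpow]
    congr 2
    field_simp
    rw [← hadef, div_self ha']
  have h4 : a ^ (κ - 1) * a = a ^ κ := by rw [← zpow_add_one₀ ha, sub_add_cancel]
  -- Separates the three contributions to the trace: radial factor, diagonal derivatives of
  -- `pCoeff`, density. The off-diagonal type terms of `pCoeff` cancel on the diagonal because ε_j²
  -- = 1.
  trans c1 * ∑ j, M.pCoeff x Z j * M.betaCoeff x Z j
    + a ^ (κ - 1) * G * vc * (n * (-conj a / 2 + 2 * M.bil x M.e * M.qY Z))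
    + a ^ (κ - 1) * G * vc * (-(n : ℂ) / M.qY Z * Complex.I)
      * ∑ j, (M.q (M.b j) : ℂ) * ((Z j).im : ℂ) * M.pCoeff x Z j
  · have : (n : ℂ) * (-conj a / 2 + 2 * M.bil x M.e * M.qY Z)
        = ∑ j : Fin n, (-conj a / 2 + 2 * M.bil x M.e * M.qY Z) := by
      rw [Finset.sum_const, Finset.card_univ, Fintype.card_fin, nsmul_eq_mul]
    rw [this, Finset.mul_sum, Finset.mul_sum, Finset.mul_sum, ← Finset.sum_add_distrib,
      ← Finset.sum_add_distrib]
    refine Finset.sum_congr rfl fun j _ => ?_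
    simp only [if_true]
    push_cast
    linear_combination (-Complex.I * (Z j).im * M.dPair x Z j * a ^ (κ - 1) * G * vc) * hε j
  · rw [h1, h2, h3, ← h4]
    simp only [c1, ← hadef]
    field_simp
    ring_nf
    simp only [Complex.I_sq]
    ring

/-- The form with these coefficients is ∂̄ of a function; accordingly the matrix of derivatives is
symmetric in k and l. -/
theorem hasDbar_betaCoeff (x : V) {Z : Fin n → ℂ} (hZ : 0 < M.qY Z) (k : Fin n) :
    HasDbar (fun Z => M.betaCoeff x Z k) (fun l =>
      (if l = k then -2 * M.bil x M.e * M.q (M.b k) / M.qY Z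
        + M.q (M.b k) * conj (M.pairPsi x Z) / (2 * (M.qY Z : ℂ) ^ 2) else 0)
      - Complex.I * (M.q (M.b l) * ((Z l).im : ℂ) * M.dPair x Z k
        + M.q (M.b k) * ((Z k).im : ℂ) * M.dPair x Z l) / (M.qY Z : ℂ) ^ 2
      - 2 * M.q (M.b k) * ((Z k).im : ℂ) * M.q (M.b l) * ((Z l).im : ℂ) * conj (M.pairPsi x Z)
        / (M.qY Z : ℂ) ^ 3) Z := by
  have h0 : (M.qY Z : ℂ) ≠ 0 := by exact_mod_cast hZ.ne'
  simp only [betaCoeff, div_eq_mul_inv]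
  refine (((M.hasDbar_dPair x Z k).mul ((M.hasDbar_qY Z).inv h0)).sub
    ((((HasDbar.im_coord k).const_mul (Complex.I * M.q (M.b k))).mul
      (M.hasDbar_conj_pairPsi x Z)).mul
      (((M.hasDbar_qY Z).pow 2).inv (pow_ne_zero 2 h0)))).congr_deriv ?_
  funext l
  split_ifs with h
  · field_simp
    ring_nf
    simp only [Complex.I_sq]
    ring
  · field_simp
    ring_nf
    simp only [Complex.I_sq]
    ring

/-- The coefficients of `*̄ p̃_Z(x)` with respect to the forms `dz̄_k`. -/
noncomputable def starCoeff (κ : ℤ) (x : V) (Z : Fin n → ℂ) (k : Fin n) : ℂ :=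
  (conj (M.pairPsi x Z) / M.qY Z) ^ (κ - 1) * (radial n κ (M.q x) (M.qPos x Z) : ℝ)
    * M.betaCoeff x Z k

/-- Both scalar factors have ∂̄ proportional to β, the vector of `betaCoeff`. The derivative matrix
is therefore a multiple of ββᵀ plus a multiple of the symmetric matrix of derivatives of β. -/
theorem exists_hasDbar_starCoeff {κ : ℤ} (hκ : (n : ℝ) / 2 < κ) {x : V} {Z : Fin n → ℂ}
    (hZ : 0 < M.qY Z) (hx : 0 < M.q x) (h : M.q x < M.qPos x Z) :
    ∃ d : Fin n → Fin n → ℂ, (∀ j, HasDbar (fun Z => M.starCoeff κ x Z j) (d j) Z) ∧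
      ∀ j k, d j k = d k j := by
  have h0 : (M.qY Z : ℂ) ≠ 0 := by exact_mod_cast hZ.ne'
  have ha := M.pairPsi_ne_zero_of_lt hx h
  have ha' : conj (M.pairPsi x Z) / M.qY Z ≠ 0 := div_ne_zero (by simpa using ha) h0
  refine ⟨_, fun j => ((HasDbar.zpow (M.hasDbar_quotient x hZ) ha' (κ - 1)).mul
    (M.hasDbar_radial hκ hZ hx h)).mul (M.hasDbar_betaCoeff x hZ j), fun j k => ?_⟩
  -- The diagonal terms come as conditionals with j and k interchanged, and are matched before the
  -- polynomial identity is checked.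
  have h1 : ∀ c : V → Fin n → ℂ, ∀ j k, (if k = j then c x j else 0) = if j = k then c x k else 0 := by
    intro c j k
    by_cases hjk : j = k
    · simp [hjk]
    · rw [if_neg hjk, if_neg (Ne.symm hjk)]
  have h2 := h1 (fun _ k => -2 * M.bil x M.e * M.q (M.b k) / M.qY Z
        + M.q (M.b k) * conj (M.pairPsi x Z) / (2 * (M.qY Z : ℂ) ^ 2)) j k
  beta_reduce at h2
  rw [h2]
  ring

/-- `p_Z(x)` in terms of the forms `theta j`. -/
theorem pForm_eq (x : V) {Z : Fin n → ℂ} (hZ : 0 < M.qY Z) :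
    M.pForm x Z = ∑ j, (M.pCoeff x Z j * M.volDensity Z) • theta j := by
  have hf : (fun Z => M.pairPsi x (fun j => conj (Z j)) / M.qY Z)
      = fun Z => conj (M.pairPsi x Z) / M.qY Z := funext fun Z => by rw [pairPsi_conj]
  have h1 := M.hodgeStar_one (Form.dbar (Form.ofFun fun Z => conj (M.pairPsi x Z) / M.qY Z)) Z
    (M.betaCoeff x Z) (fun v => dbar_ofFun (M.hasDbar_quotient x hZ) _ Filter.EventuallyEq.rfl v)
  have h2 : M.pForm x Z = ((M.qY Z : ℂ) ^ (1 : ℤ)) • M.hodgeStar 0 1 (one_add_degree n)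
      (Form.dbar (Form.ofFun fun Z => conj (M.pairPsi x Z) / M.qY Z)) Z := by
    rw [pForm, xi, hodgeStarWeight, hf]
  rw [h2, h1, antiContract_eq, smul_smul, Finset.smul_sum]
  refine Finset.sum_congr rfl fun j _ => ?_
  rw [smul_smul]
  congr 1
  have h3 := congrArg conj (M.raise_betaCoeff x hZ j)
  rw [Complex.conj_conj] at h3
  rw [← h3]
  simp only [map_mul, Complex.conj_ofReal, map_div₀, map_one, map_ofNat, zpow_one]
  ring

theorem pTilde_eq (κ : ℤ) (x : V) {Z : Fin n → ℂ} (hZ : 0 < M.qY Z) :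
    M.pTilde κ x Z = ∑ j, M.termCoeff κ x Z j • theta j := by
  rw [pTilde, M.pForm_eq x hZ, Finset.smul_sum]
  refine Finset.sum_congr rfl fun j _ => ?_
  rw [smul_smul, termCoeff, radial, qNeg_eq]

/-- `ξ_{-κ}` of an `(n, n - 1)`-form with differentiable coefficients. -/
theorem xiTop_eq (κ : ℤ) {φ : Fin n → (Fin n → ℂ) → ℂ} {d : Fin n → Fin n → ℂ} {Z : Fin n → ℂ}
    (hZ : 0 < M.qY Z) (hφ : ∀ j, HasDbar (φ j) (d j) Z) (Φ : Form n (2 * n - 2 + 1))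
    (hΦ : Φ =ᶠ[𝓝 Z] fun Z => ∑ j, φ j Z • theta j) :
    M.xiTop (-κ) Φ Z = (M.qY Z : ℂ) ^ (-κ) * (conj (∑ j, d j j) * M.volDensity Z * 4 ^ n
      * ((2 * M.qY Z : ℝ) : ℂ) ^ (2 * n)) := by
  have h1 := M.hodgeStar_top (Form.dbar Φ) hZ (∑ j, d j j) (fun v => dbar_sum_theta hφ Φ hΦ v)
    Fin.elim0
  have hn : n - 1 + 1 = n := by have := NeZero.pos n; omega
  have h2 : M.xiTop (-κ) Φ Z = (M.qY Z : ℂ) ^ (-κ) *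
      M.hodgeStar n (n - 1 + 1) degree_eq (Form.dbar Φ) Z Fin.elim0 := rfl
  rw [h2, hn, h1]

theorem conj_termDiv_mul (κ : ℤ) (x : V) {Z : Fin n → ℂ} (hZ : 0 < M.qY Z) :
    (M.qY Z : ℂ) ^ (-κ) * (conj (M.termDiv κ x Z) * M.volDensity Z * 4 ^ n
      * ((2 * M.qY Z : ℝ) : ℂ) ^ (2 * n)) = 1 / M.pairPsi x Z ^ κ := by
  have h0 : (M.qY Z : ℂ) ^ κ ≠ 0 := zpow_ne_zero _ (by exact_mod_cast hZ.ne')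
  have h1 := M.volDensity_norm hZ
  rw [termDiv, map_mul, map_zpow₀, map_div₀, Complex.conj_conj, Complex.conj_ofReal, div_zpow,
    zpow_neg]
  trans ((M.qY Z : ℂ) ^ κ)⁻¹ * ((M.qY Z : ℂ) ^ κ) / M.pairPsi x Z ^ κ
    * (conj (M.volDensity Z) * M.volDensity Z * 4 ^ n * ((2 * M.qY Z : ℝ) : ℂ) ^ (2 * n))
  · ring
  · rw [h1, inv_mul_cancel₀ h0, mul_one]

/-- The Hodge operator on the form with coefficients `φ j = conj (raise x j)`. -/
theorem hodgeStarWeight_eq (κ : ℤ) (Φ : Form n (2 * n - 2 + 1)) {Z x φ : Fin n → ℂ}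
    (hZ : 0 < M.qY Z) (hΦ : Φ Z = ∑ j, φ j • theta j) (hφ : ∀ j, φ j = conj (M.raise Z x j)) :
    M.hodgeStarWeight (-κ) n (n - 1) (degree_add_one n) Φ Z
      = ∑ k, ((M.qY Z : ℂ) ^ (-κ) * (-2 * M.volDensity Z * 4 ^ n * ((2 * M.qY Z : ℝ) : ℂ) ^ (2 * n))
        * x k) • dzbar k := by
  have h1 : Φ Z = antiContract (M.raise Z x) := by
    rw [hΦ, antiContract_eq]
    exact Finset.sum_congr rfl fun j _ => by rw [hφ]
  ext w
  have h2 := M.hodgeStar_antiContract Φ hZ x h1 w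
  rw [ContinuousAlternatingMap.sum_apply]
  simp only [ContinuousAlternatingMap.smul_apply, dzbar_apply, smul_eq_mul, mul_assoc]
  rw [← Finset.mul_sum]
  have h3 : M.hodgeStarWeight (-κ) n (n - 1) (degree_add_one n) Φ Z w
      = (M.qY Z : ℂ) ^ (-κ) * M.hodgeStar n (n - 1) (degree_add_one n) Φ Z w := rfl
  rw [h3, h2]
  simp only [Finset.mul_sum, mul_assoc]

/-- The vector whose conjugate, with indices raised, has the coefficients of `p̃_Z(x)`. -/
noncomputable def lowered (κ : ℤ) (x : V) (Z : Fin n → ℂ) (k : Fin n) : ℂ :=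
  conj (M.pairPsi x Z) ^ (κ - 1) * (radial n κ (M.q x) (M.qPos x Z) : ℝ) *
    (conj (M.volDensity Z) * (1 / 2 * M.qY Z)) * M.betaCoeff x Z k

theorem conj_raise_lowered (κ : ℤ) (x : V) {Z : Fin n → ℂ} (hZ : 0 < M.qY Z) (j : Fin n) :
    M.termCoeff κ x Z j = conj (M.raise Z (M.lowered κ x Z) j) := by
  have h1 : M.raise Z (M.lowered κ x Z) j = conj (M.pairPsi x Z) ^ (κ - 1) *
      (radial n κ (M.q x) (M.qPos x Z) : ℝ) * conj (M.volDensity Z) * conj (M.pCoeff x Z j) := by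
    rw [← M.raise_betaCoeff x hZ, raise_apply, raise_apply, Finset.mul_sum, Finset.mul_sum]
    refine Finset.sum_congr rfl fun k _ => ?_
    rw [lowered]
    ring
  rw [h1, termCoeff]
  simp only [map_mul, map_zpow₀, Complex.conj_conj, Complex.conj_ofReal]
  ring

/-- The normalisation of the volume leaves exactly −1, so that *̄_{-κ}p̃ = −∑ `starCoeff` dz̄_k. -/
theorem lowered_mul (κ : ℤ) (x : V) {Z : Fin n → ℂ} (hZ : 0 < M.qY Z) (k : Fin n) :
    (M.qY Z : ℂ) ^ (-κ) * (-2 * M.volDensity Z * 4 ^ n * ((2 * M.qY Z : ℝ) : ℂ) ^ (2 * n))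
      * M.lowered κ x Z k = -M.starCoeff κ x Z k := by
  have h0 : (M.qY Z : ℂ) ≠ 0 := by exact_mod_cast hZ.ne'
  have h1 := M.volDensity_norm hZ
  have h2 : (M.qY Z : ℂ) ^ (-κ) * M.qY Z = ((M.qY Z : ℂ) ^ (κ - 1))⁻¹ := by
    rw [← zpow_add_one₀ h0, ← zpow_neg]
    congr 1
    ring
  rw [lowered, starCoeff, div_zpow, div_eq_mul_inv (_ ^ (κ - 1)), ← h2]
  linear_combination (-((M.qY Z : ℂ) ^ (-κ) * M.qY Z * conj (M.pairPsi x Z) ^ (κ - 1)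
    * (radial n κ (M.q x) (M.qPos x Z) : ℝ) * M.betaCoeff x Z k)) * h1

end LatticeSetup

/-! ### Complex linear changes of variable: A acts on the dz and Ā on the dz̄. -/

theorem coordinateVolume_mulVec {n : ℕ} (A : Matrix (Fin n) (Fin n) ℂ)
    (v : Fin (2 * n) → Fin n → ℂ) :
    coordinateVolume n (fun j => A.mulVec (v j)) = A.det * conj A.det * coordinateVolume n v := by
  set K : Matrix (Fin n × Fin 2) (Fin n × Fin 2) ℂ :=
    Matrix.blockDiagonal ![A.transpose, (A.map conj).transpose] with hK
  have h1 : (Matrix.of fun j a => coframe a (A.mulVec (v j)) : Matrix (Fin (2 * n)) _ ℂ)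
      = (Matrix.of fun j a => coframe a (v j)) * K.submatrix (frameIndex n) (frameIndex n) := by
    ext j a
    rw [Matrix.mul_apply, ← (frameIndex n).symm.sum_comp, Fintype.sum_prod_type]
    simp only [Matrix.of_apply, coframe_symm, Matrix.submatrix_apply, Equiv.apply_symm_apply, hK,
      Matrix.blockDiagonal_apply, coframe_eq a]
    simp only [Fin.sum_univ_two, Matrix.mulVec, dotProduct]
    obtain ⟨i, t⟩ := frameIndex n a
    obtain rfl | rfl : t = 0 ∨ t = 1 := by omega
    · simp [mul_comm]
    · simp [mul_comm]
  rw [coordinateVolume_apply, h1, Matrix.det_mul, Matrix.det_submatrix_equiv_self, hK,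
    Matrix.det_blockDiagonal, Fin.prod_univ_two]
  have h2 : (A.map conj).det = conj A.det := ((starRingEnd ℂ).map_det A).symm
  simp [h2, coordinateVolume_apply, mul_comm]

theorem antiContract_smul {n : ℕ} [NeZero n] (c : ℂ) (v : Fin n → ℂ) :
    antiContract (c • v) = conj c • antiContract v := by
  simp [antiContract_eq, Finset.smul_sum, smul_smul]

theorem antiContract_mulVec {n : ℕ} [NeZero n] (A : Matrix (Fin n) (Fin n) ℂ) (v : Fin n → ℂ)
    (w : Fin (2 * n - 2 + 1) → Fin n → ℂ) :
    antiContract (A.mulVec v) (fun i => A.mulVec (w i))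
      = A.det * conj A.det * antiContract v w := by
  have h : ∀ u : Fin n → ℂ, coordinateVolume n (fun i =>
      (Fin.cons (A.mulVec u) (fun i => A.mulVec (w i)) : Fin (2 * n - 2 + 1 + 1) → Fin n → ℂ)
        (Fin.cast (degree_add_one n).symm i))
      = A.det * conj A.det * coordinateVolume n (fun i =>
        (Fin.cons u w : Fin (2 * n - 2 + 1 + 1) → Fin n → ℂ)
          (Fin.cast (degree_add_one n).symm i)) := by
    intro u
    rw [← coordinateVolume_mulVec]
    congr 1
    funext i
    refine Fin.cases (motive := fun i => (Fin.cons (A.mulVec u) (fun i => A.mulVec (w i)) :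
      Fin (2 * n - 2 + 1 + 1) → Fin n → ℂ) i
      = A.mulVec ((Fin.cons u w : Fin (2 * n - 2 + 1 + 1) → Fin n → ℂ) i)) ?_ (fun i => ?_) _
    · simp
    · simp
  rw [antiContract_apply_volume, antiContract_apply_volume, ← Matrix.mulVec_smul, h, h]
  ring

/-! ### The functional ψ(Z), its derivative, and the invariant bilinear form on functionals. -/

namespace LatticeSetup

open Topology

variable {n : ℕ} [NeZero n] {V : Type*} [AddCommGroup V] [Module ℝ V] (M : LatticeSetup n V)

/-- The bilinear form dual to `bil` on the complex valued functionals on `V`. -/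
noncomputable def dualForm (f g : V →ₗ[ℝ] ℂ) : ℂ :=
  f M.e * g M.et + f M.et * g M.e + ∑ k, (M.q (M.b k) : ℂ) / 2 * (f (M.b k) * g (M.b k))

/-- The functional `x ↦ (x, u) + i (x, w)`. -/
noncomputable def functional (u w : V) : V →ₗ[ℝ] ℂ where
  toFun x := M.bil x u + Complex.I * M.bil x w
  map_add' x y := by simp only [bil_add_left]; push_cast; ring
  map_smul' c x := by
    simp only [bil_smul_left, RingHom.id_apply, Complex.real_smul]; push_cast; ring

theorem functional_apply (u w x : V) :
    M.functional u w x = M.bil x u + Complex.I * M.bil x w := rfl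

theorem exists_functional (f : V →ₗ[ℝ] ℂ) : ∃ u w, f = M.functional u w := by
  have h : ∀ ℓ : V →ₗ[ℝ] ℝ, ∃ u, ∀ x, ℓ x = M.bil x u := by
    intro ℓ
    refine ⟨M.ofCoord (ℓ M.et, ℓ M.e, fun k => M.q (M.b k) / 2 * ℓ (M.b k)), fun x => ?_⟩
    conv_lhs => rw [← M.ofCoord_coord x]
    simp only [ofCoord, coord, LinearMap.coe_mk, AddHom.coe_mk, map_add, map_smul, smul_eq_mul,
      vec, map_sum, bil_add_right, bil_smul_right, bil_sum_right]
    congr 1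
    · ring
    · exact Finset.sum_congr rfl fun k _ => by ring
  obtain ⟨u, hu⟩ := h (Complex.reLm.comp f)
  obtain ⟨w, hw⟩ := h (Complex.imLm.comp f)
  refine ⟨u, w, LinearMap.ext fun x => ?_⟩
  rw [functional_apply, ← hu, ← hw, mul_comm Complex.I]
  exact (Complex.re_add_im _).symm

/-- Identifies `dualForm` with the complex bilinear extension of the form on V, which makes its
invariance under isometries visible. -/
theorem dualForm_functional (u w u' w' : V) :
    M.dualForm (M.functional u w) (M.functional u' w')
      = M.bil u u' - M.bil w w' + Complex.I * (M.bil u w' + M.bil w u') := by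
  rw [M.bil_eq u u', M.bil_eq w w', M.bil_eq u w', M.bil_eq w u', dualForm]
  push_cast
  simp only [functional_apply, M.bil_comm M.e, M.bil_comm M.et, M.bil_comm (M.b _)]
  have : ∑ k, (M.q (M.b k) : ℂ) / 2 * ((M.bil u (M.b k) + Complex.I * M.bil w (M.b k))
      * (M.bil u' (M.b k) + Complex.I * M.bil w' (M.b k)))
      = ∑ k, (M.q (M.b k) : ℂ) / 2 * M.bil u (M.b k) * M.bil u' (M.b k)
        - ∑ k, (M.q (M.b k) : ℂ) / 2 * M.bil w (M.b k) * M.bil w' (M.b k)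
        + Complex.I * (∑ k, (M.q (M.b k) : ℂ) / 2 * M.bil u (M.b k) * M.bil w' (M.b k)
        + ∑ k, (M.q (M.b k) : ℂ) / 2 * M.bil w (M.b k) * M.bil u' (M.b k)) := by
    rw [← Finset.sum_add_distrib, Finset.mul_sum, ← Finset.sum_sub_distrib,
      ← Finset.sum_add_distrib]
    refine Finset.sum_congr rfl fun k _ => ?_
    linear_combination ((M.q (M.b k) : ℂ) / 2 * M.bil w (M.b k) * M.bil w' (M.b k)) * Complex.I_sq
  rw [this]
  linear_combination ((M.bil w M.e : ℂ) * M.bil w' M.et + M.bil w M.et * M.bil w' M.e)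
    * Complex.I_sq

variable {σ : V ≃ₗ[ℝ] V}

theorem bil_map (hσ : ∀ x, M.q (σ x) = M.q x) (x y : V) : M.bil (σ x) (σ y) = M.bil x y := by
  simp only [bil, QuadraticMap.polar, ← map_add, hσ]

theorem bil_map_right (hσ : ∀ x, M.q (σ x) = M.q x) (x y : V) :
    M.bil x (σ y) = M.bil (σ⁻¹ x) y := by
  rw [← M.bil_map hσ (σ⁻¹ x) y]
  congr 1
  exact (σ.apply_symm_apply x).symm

theorem q_inv (hσ : ∀ x, M.q (σ x) = M.q x) (x : V) : M.q (σ⁻¹ x) = M.q x := by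
  rw [← hσ (σ⁻¹ x)]
  congr 1
  exact σ.apply_symm_apply x

theorem dualForm_comp (hσ : ∀ x, M.q (σ x) = M.q x) (f g : V →ₗ[ℝ] ℂ) :
    M.dualForm (f.comp (σ⁻¹ : V ≃ₗ[ℝ] V).toLinearMap) (g.comp (σ⁻¹ : V ≃ₗ[ℝ] V).toLinearMap)
      = M.dualForm f g := by
  obtain ⟨u, w, rfl⟩ := M.exists_functional f
  obtain ⟨u', w', rfl⟩ := M.exists_functional g
  have h : ∀ u w, (M.functional u w).comp (σ⁻¹ : V ≃ₗ[ℝ] V).toLinearMap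
      = M.functional (σ u) (σ w) := by
    intro u w
    refine LinearMap.ext fun x => ?_
    rw [functional_apply, M.bil_map_right hσ, M.bil_map_right hσ]
    rfl
  rw [h, h, dualForm_functional, dualForm_functional]
  simp only [M.bil_map hσ]

theorem dualForm_add_left (f f' g : V →ₗ[ℝ] ℂ) :
    M.dualForm (f + f') g = M.dualForm f g + M.dualForm f' g := by
  simp only [dualForm, LinearMap.add_apply, add_mul, mul_add, Finset.sum_add_distrib]
  ring

theorem dualForm_smul_left (c : ℂ) (f g : V →ₗ[ℝ] ℂ) :
    M.dualForm (c • f) g = c * M.dualForm f g := by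
  simp only [dualForm, LinearMap.smul_apply, smul_eq_mul, mul_add, Finset.mul_sum]
  congr 1
  · ring
  · exact Finset.sum_congr rfl fun _ _ => by ring

theorem dualForm_comm (f g : V →ₗ[ℝ] ℂ) : M.dualForm f g = M.dualForm g f := by
  simp only [dualForm, mul_comm (g _)]
  ring

theorem dualForm_add_right (f g g' : V →ₗ[ℝ] ℂ) :
    M.dualForm f (g + g') = M.dualForm f g + M.dualForm f g' := by
  rw [dualForm_comm, dualForm_add_left, dualForm_comm, M.dualForm_comm g']

theorem dualForm_smul_right (c : ℂ) (f g : V →ₗ[ℝ] ℂ) :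
    M.dualForm f (c • g) = c * M.dualForm f g := by
  rw [dualForm_comm, dualForm_smul_left, dualForm_comm]

/-- The functional `x ↦ (x, ψ(Z))`. -/
noncomputable def psi (Z : Fin n → ℂ) : V →ₗ[ℝ] ℂ := M.functional (M.psiRe Z) (M.psiIm Z)

theorem psi_apply (Z : Fin n → ℂ) (x : V) : M.psi Z x = M.pairPsi x Z := rfl

/-- The complex conjugate of `psi`. -/
noncomputable def psiBar (Z : Fin n → ℂ) : V →ₗ[ℝ] ℂ :=
  (Complex.conjAe : ℂ →ₗ[ℝ] ℂ).comp (M.psi Z)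

theorem psiBar_apply (Z : Fin n → ℂ) (x : V) : M.psiBar Z x = conj (M.pairPsi x Z) := rfl

/-- The derivative of `psi` at `Z` in direction `v`. -/
noncomputable def dpsi (Z v : Fin n → ℂ) : V →ₗ[ℝ] ℂ where
  toFun x := ∑ k, conj (M.dPair x Z k) * v k
  map_add' x y := by
    rw [← Finset.sum_add_distrib]
    refine Finset.sum_congr rfl fun k _ => ?_
    simp only [dPair, bil_add_left, map_sub, map_mul, Complex.conj_ofReal, map_ofNat]
    push_cast
    ring
  map_smul' c x := by
    rw [RingHom.id_apply, Finset.smul_sum]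
    refine Finset.sum_congr rfl fun k _ => ?_
    simp only [dPair, bil_smul_left, map_sub, map_mul, Complex.conj_ofReal, map_ofNat,
      Complex.real_smul]
    push_cast
    ring

theorem dpsi_apply (Z v : Fin n → ℂ) (x : V) : M.dpsi Z v x =
    ∑ k, ((M.bil x (M.b k) : ℂ) - 2 * M.bil x M.e * M.q (M.b k) * Z k) * v k := by
  change ∑ k, conj (M.dPair x Z k) * v k = _
  simp only [dPair, map_sub, map_mul, Complex.conj_ofReal, map_ofNat, Complex.conj_conj]

theorem hasFDerivAt_pairPsi (x : V) (Z : Fin n → ℂ) :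
    HasFDerivAt (M.pairPsi x) (∑ k, conj (M.dPair x Z k) • ContinuousLinearMap.proj (R := ℂ)
      (φ := fun _ : Fin n => ℂ) k) Z := by
  have h1 : M.pairPsi x = fun Z => (M.bil x M.et : ℂ) - M.bil x M.e * (∑ k, (M.q (M.b k) : ℂ) * Z k ^ 2)
      + ∑ k, (M.bil x (M.b k) : ℂ) * Z k := funext fun Z => M.pairPsi_eq x Z
  have h2 : ∀ k, HasFDerivAt (fun Z : Fin n → ℂ => Z k) (ContinuousLinearMap.proj (R := ℂ)
      (φ := fun _ : Fin n => ℂ) k) Z := fun k => hasFDerivAt_apply k Z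
  rw [h1]
  refine (((hasFDerivAt_const _ Z).sub ((HasFDerivAt.fun_sum fun k _ =>
    ((h2 k).pow 2).const_mul _).const_mul _)).add
    (HasFDerivAt.fun_sum fun k _ => (h2 k).const_mul _)).congr_fderiv ?_
  ext v
  simp only [dPair, map_sub, map_mul, Complex.conj_ofReal, map_ofNat, Complex.conj_conj,
    zero_sub, add_apply, neg_apply, smul_apply, sum_apply, smul_eq_mul, ContinuousLinearMap.proj_apply,
    Finset.mul_sum, ← Finset.sum_neg_distrib, ← Finset.sum_add_distrib]
  refine Finset.sum_congr rfl fun k _ => ?_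
  simp
  ring

theorem fderiv_pairPsi_apply (x : V) (Z v : Fin n → ℂ) :
    fderiv ℂ (M.pairPsi x) Z v = M.dpsi Z v x := by
  rw [(M.hasFDerivAt_pairPsi x Z).fderiv]
  simp [dpsi]

theorem psi_e (Z : Fin n → ℂ) : M.psi Z M.e = 1 := by
  simp [psi_apply, pairPsi_eq, bil_e_e, bil_e_et, bil_e_b]

theorem psi_et (Z : Fin n → ℂ) : M.psi Z M.et = -M.qC Z := by
  simp [psi_apply, pairPsi_eq, bil_et_e, bil_et_et, bil_et_b]

theorem psi_b (Z : Fin n → ℂ) (k : Fin n) : M.psi Z (M.b k) = 2 * M.q (M.b k) * Z k := by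
  simp [psi_apply, pairPsi_eq, bil_b_e, bil_b_et, bil_b_b, apply_ite Complex.ofReal]

theorem dpsi_e (Z v : Fin n → ℂ) : M.dpsi Z v M.e = 0 := by
  simp [dpsi_apply, bil_e_e, bil_e_b]

theorem dpsi_et (Z v : Fin n → ℂ) : M.dpsi Z v M.et = ∑ k, -2 * (M.q (M.b k) : ℂ) * Z k * v k := by
  simp [dpsi_apply, bil_et_e, bil_et_b]

theorem dpsi_b (Z v : Fin n → ℂ) (k : Fin n) : M.dpsi Z v (M.b k) = 2 * M.q (M.b k) * v k := by
  simp [dpsi_apply, bil_b_e, bil_b_b, apply_ite Complex.ofReal]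

theorem eps_sq_complex (k : Fin n) : (M.q (M.b k) : ℂ) * M.q (M.b k) = 1 := by
  exact_mod_cast M.eps_sq k

/-- The term −q(Z)e in ψ(Z) is there to make ψ(Z) isotropic. -/
theorem dualForm_psi_psi (Z : Fin n → ℂ) : M.dualForm (M.psi Z) (M.psi Z) = 0 := by
  have h : ∑ k, (M.q (M.b k) : ℂ) / 2 * (M.psi Z (M.b k) * M.psi Z (M.b k)) = 2 * M.qC Z := by
    rw [qC, Finset.mul_sum]
    refine Finset.sum_congr rfl fun k _ => ?_
    rw [psi_b]
    linear_combination (2 * (M.q (M.b k) : ℂ) * Z k ^ 2) * M.eps_sq_complex k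
  rw [dualForm, h, psi_e, psi_et]
  ring

theorem dualForm_psiBar_psi (Z : Fin n → ℂ) :
    M.dualForm (M.psiBar Z) (M.psi Z) = 4 * M.qY Z := by
  simp only [dualForm, psiBar_apply, ← psi_apply, psi_e, psi_et, psi_b, map_one, map_neg, map_mul,
    Complex.conj_ofReal, map_ofNat, qC, map_sum, map_pow, qY_eq_complex, Finset.mul_sum, one_mul,
    mul_one, ← Finset.sum_neg_distrib, ← Finset.sum_add_distrib]
  refine Finset.sum_congr rfl fun k _ => ?_
  rw [HasDbar.im_eq]
  linear_combination (2 * (M.q (M.b k) : ℂ) * Z k * conj (Z k)) * M.eps_sq_complex k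
    - ((M.q (M.b k) : ℂ) * (Z k - conj (Z k)) ^ 2) * Complex.I_sq

theorem dualForm_psi_dpsi (Z v : Fin n → ℂ) : M.dualForm (M.psi Z) (M.dpsi Z v) = 0 := by
  simp only [dualForm, psi_e, psi_et, psi_b, dpsi_e, dpsi_et, dpsi_b, one_mul, mul_zero, add_zero,
    ← Finset.sum_add_distrib]
  refine Finset.sum_eq_zero fun k _ => ?_
  linear_combination (2 * (M.q (M.b k) : ℂ) * Z k * v k) * M.eps_sq_complex k

theorem dualForm_psiBar_dpsi (Z v : Fin n → ℂ) : M.dualForm (M.psiBar Z) (M.dpsi Z v)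
    = -4 * Complex.I * ∑ k, (M.q (M.b k) : ℂ) * ((Z k).im : ℂ) * v k := by
  simp only [dualForm, psiBar_apply, ← psi_apply, psi_e, psi_et, psi_b, dpsi_e, dpsi_et, dpsi_b,
    map_one, map_mul, Complex.conj_ofReal, map_ofNat, one_mul, mul_zero, add_zero,
    ← Finset.sum_add_distrib, Finset.mul_sum]
  refine Finset.sum_congr rfl fun k _ => ?_
  rw [HasDbar.im_eq]
  linear_combination (2 * (M.q (M.b k) : ℂ) * conj (Z k) * v k) * M.eps_sq_complex k
    - (2 * (M.q (M.b k) : ℂ) * (Z k - conj (Z k)) * v k) * Complex.I_sq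

theorem dualForm_dpsi_dpsi (Z v w : Fin n → ℂ) : M.dualForm (M.dpsi Z v) (M.dpsi Z w)
    = 2 * ∑ k, (M.q (M.b k) : ℂ) * v k * w k := by
  simp only [dualForm, dpsi_e, dpsi_b, zero_mul, mul_zero, add_zero, zero_add, Finset.mul_sum]
  refine Finset.sum_congr rfl fun k _ => ?_
  linear_combination (2 * (M.q (M.b k) : ℂ) * v k * w k) * M.eps_sq_complex k

end LatticeSetup

/-! ### Equivariance under isometries. -/

namespace LatticeSetup

open Topology

variable {n : ℕ} [NeZero n] {V : Type*} [AddCommGroup V] [Module ℝ V] (M : LatticeSetup n V)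
  {σ : V ≃ₗ[ℝ] V} {Z : Fin n → ℂ}

theorem e_ne_zero : M.e ≠ 0 := by
  intro h
  have := M.bil_e_et
  rw [h, bil, ← zero_smul ℝ (0 : V), QuadraticMap.polar_smul_left] at this
  simp at this

theorem pairAct_eq (hσ : ∀ x, M.q (σ x) = M.q x) (x : V) (Z : Fin n → ℂ) :
    M.pairAct x σ Z = M.pairPsi (σ⁻¹ x) Z := by
  rw [pairAct, M.bil_map_right hσ, M.bil_map_right hσ, pairPsi]

theorem autFactor_eq (hσ : ∀ x, M.q (σ x) = M.q x) (Z : Fin n → ℂ) :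
    M.autFactor σ Z = M.pairPsi (σ⁻¹ M.e) Z := M.pairAct_eq hσ _ _

/-- The factor is the pairing of ψ(Z) with σ⁻¹e. A non-zero isotropic vector cannot be orthogonal to
a positive plane whose complement is negative definite. -/
theorem autFactor_ne_zero (hσ : ∀ x, M.q (σ x) = M.q x) (hZ : 0 < M.qY Z) :
    M.autFactor σ Z ≠ 0 := by
  rw [M.autFactor_eq hσ]
  intro h
  have h1 := M.q_neg_of_pairPsi_eq_zero hZ h (by rw [M.q_inv hσ, M.e_isotropic])
  exact M.e_ne_zero ((LinearEquiv.map_eq_zero_iff _).1 h1)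

theorem act_apply (hσ : ∀ x, M.q (σ x) = M.q x) (Z : Fin n → ℂ) (k : Fin n) :
    M.act σ Z k = M.q (M.b k) / 2 * M.pairPsi (σ⁻¹ (M.b k)) Z / M.autFactor σ Z := by
  rw [act, M.pairAct_eq hσ]

theorem linearMap_eq (f : V →ₗ[ℝ] ℂ) (x : V) : f x = M.bil x M.et * f M.e + M.bil x M.e * f M.et
    + ∑ k, (M.q (M.b k) : ℂ) / 2 * M.bil x (M.b k) * f (M.b k) := by
  conv_lhs => rw [← M.ofCoord_coord x]
  simp only [ofCoord, coord, LinearMap.coe_mk, AddHom.coe_mk, map_add, map_smul, vec, map_sum,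
    Complex.real_smul]
  push_cast
  rfl

/-- The definition of the action forces agreement on e and on the b_k. Agreement on ẽ' follows
because both functionals are isotropic. -/
theorem autFactor_smul_psi_act (hσ : ∀ x, M.q (σ x) = M.q x) (hZ : 0 < M.qY Z) :
    M.autFactor σ Z • M.psi (M.act σ Z)
      = (M.psi Z).comp (σ⁻¹ : V ≃ₗ[ℝ] V).toLinearMap := by
  have hj := M.autFactor_ne_zero hσ hZ
  have h0 := M.dualForm_comp hσ (M.psi Z) (M.psi Z)
  rw [dualForm_psi_psi] at h0
  set φ := (M.psi Z).comp (σ⁻¹ : V ≃ₗ[ℝ] V).toLinearMap with hφ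
  have he : φ M.e = M.autFactor σ Z := (M.autFactor_eq hσ Z).symm
  have hb : ∀ k, M.act σ Z k = M.q (M.b k) / 2 * φ (M.b k) / M.autFactor σ Z := fun k =>
    M.act_apply hσ Z k
  have hq : M.autFactor σ Z ^ 2 * M.qC (M.act σ Z) = -(M.autFactor σ Z * φ M.et) := by
    have h1 : M.autFactor σ Z ^ 2 * M.qC (M.act σ Z)
        = ∑ k, (M.q (M.b k) : ℂ) / 2 * (φ (M.b k) * φ (M.b k)) / 2 := by
      rw [qC, Finset.mul_sum]
      refine Finset.sum_congr rfl fun k _ => ?_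
      rw [hb]
      field_simp
      linear_combination ((M.q (M.b k) : ℂ) * φ (M.b k) ^ 2) * M.eps_sq_complex k
    rw [h1, ← Finset.sum_div]
    rw [dualForm, he] at h0
    linear_combination h0 / 2
  refine LinearMap.ext fun x => ?_
  rw [M.linearMap_eq φ x, he, LinearMap.smul_apply, psi_apply, pairPsi_eq, smul_eq_mul, mul_add,
    mul_sub, Finset.mul_sum]
  congr 1
  · have h2 : M.autFactor σ Z * M.qC (M.act σ Z) = -φ M.et :=
      mul_left_cancel₀ hj (by linear_combination hq)
    linear_combination (-(M.bil x M.e : ℂ)) * h2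
  · refine Finset.sum_congr rfl fun k _ => ?_
    rw [hb]
    field_simp

theorem pairPsi_act (hσ : ∀ x, M.q (σ x) = M.q x) (hZ : 0 < M.qY Z) (x : V) :
    M.autFactor σ Z * M.pairPsi x (M.act σ Z) = M.pairPsi (σ⁻¹ x) Z := by
  have := LinearMap.congr_fun (M.autFactor_smul_psi_act hσ hZ) x
  exact this

theorem conj_smul_psiBar_act (hσ : ∀ x, M.q (σ x) = M.q x) (hZ : 0 < M.qY Z) :
    conj (M.autFactor σ Z) • M.psiBar (M.act σ Z)
      = (M.psiBar Z).comp (σ⁻¹ : V ≃ₗ[ℝ] V).toLinearMap := by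
  refine LinearMap.ext fun x => ?_
  rw [LinearMap.smul_apply, psiBar_apply, smul_eq_mul, ← map_mul, M.pairPsi_act hσ hZ]
  rfl

theorem qY_act (hσ : ∀ x, M.q (σ x) = M.q x) (hZ : 0 < M.qY Z) :
    conj (M.autFactor σ Z) * M.autFactor σ Z * M.qY (M.act σ Z) = M.qY Z := by
  have h := M.dualForm_comp hσ (M.psiBar Z) (M.psi Z)
  rw [← M.autFactor_smul_psi_act hσ hZ, ← M.conj_smul_psiBar_act hσ hZ, dualForm_smul_left,
    dualForm_smul_right, dualForm_psiBar_psi, dualForm_psiBar_psi] at h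
  linear_combination h / 4

theorem qY_act_real (hσ : ∀ x, M.q (σ x) = M.q x) (hZ : 0 < M.qY Z) :
    Complex.normSq (M.autFactor σ Z) * M.qY (M.act σ Z) = M.qY Z := by
  have := M.qY_act hσ hZ
  rw [mul_comm (conj _), Complex.mul_conj] at this
  exact_mod_cast this

theorem qY_act_pos (hσ : ∀ x, M.q (σ x) = M.q x) (hZ : 0 < M.qY Z) : 0 < M.qY (M.act σ Z) := by
  have h := M.qY_act_real hσ hZ
  exact pos_of_mul_pos_right (h ▸ hZ) (Complex.normSq_nonneg _)

theorem qPos_act (hσ : ∀ x, M.q (σ x) = M.q x) (hZ : 0 < M.qY Z) (x : V) :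
    M.qPos x (M.act σ Z) = M.qPos (σ⁻¹ x) Z := by
  have hj : Complex.normSq (M.autFactor σ Z) ≠ 0 := by
    simpa using M.autFactor_ne_zero hσ hZ
  have h0 := (M.qY_act_pos hσ hZ).ne'
  rw [qPos_eq, qPos_eq, ← M.pairPsi_act hσ hZ, ← M.qY_act_real hσ hZ, Complex.normSq_mul]
  field_simp

theorem qNeg_act (hσ : ∀ x, M.q (σ x) = M.q x) (hZ : 0 < M.qY Z) (x : V) :
    M.qNeg x (M.act σ Z) = M.qNeg (σ⁻¹ x) Z := by
  rw [qNeg_eq, qNeg_eq, M.qPos_act hσ hZ, M.q_inv hσ]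

theorem differentiableAt_act (hσ : ∀ x, M.q (σ x) = M.q x) (hZ : 0 < M.qY Z) :
    DifferentiableAt ℂ (M.act σ) Z := by
  rw [differentiableAt_pi]
  intro k
  have h1 : (fun Z => M.act σ Z k) = fun Z =>
      M.q (M.b k) / 2 * M.pairPsi (σ⁻¹ (M.b k)) Z / M.pairPsi (σ⁻¹ M.e) Z := by
    funext Z
    rw [M.act_apply hσ, M.autFactor_eq hσ]
  rw [h1]
  have h2 : M.pairPsi (σ⁻¹ M.e) Z ≠ 0 := by
    rw [← M.autFactor_eq hσ]
    exact M.autFactor_ne_zero hσ hZ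
  simp only [div_eq_mul_inv _ (M.pairPsi _ _)]
  exact ((M.differentiable_pairPsi _ Z).const_mul _).fun_mul
    ((M.differentiable_pairPsi _ Z).fun_inv h2)

/-- The Jacobian matrix of the action of `σ` on the upper half plane. -/
noncomputable def jacobian (σ : V ≃ₗ[ℝ] V) (Z : Fin n → ℂ) : Matrix (Fin n) (Fin n) ℂ :=
  LinearMap.toMatrix' (fderiv ℂ (M.act σ) Z).toLinearMap

theorem jacobian_mulVec (σ : V ≃ₗ[ℝ] V) (Z v : Fin n → ℂ) :
    (M.jacobian σ Z).mulVec v = fderiv ℂ (M.act σ) Z v := by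
  rw [jacobian, ← Matrix.toLin'_apply, Matrix.toLin'_toMatrix']
  rfl

theorem fderiv_real_act (hσ : ∀ x, M.q (σ x) = M.q x) (hZ : 0 < M.qY Z) (v : Fin n → ℂ) :
    fderiv ℝ (M.act σ) Z v = (M.jacobian σ Z).mulVec v := by
  rw [jacobian_mulVec, (M.differentiableAt_act hσ hZ).fderiv_restrictScalars ℝ]
  rfl

/-- The product rule applied to j(σ, Z)ψ(σZ) = σψ(Z). The second summand is the derivative of the
factor of automorphy. -/
theorem dpsi_act (hσ : ∀ x, M.q (σ x) = M.q x) (hZ : 0 < M.qY Z) (v : Fin n → ℂ) :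
    M.autFactor σ Z • M.dpsi (M.act σ Z) ((M.jacobian σ Z).mulVec v)
      + M.dpsi Z v (σ⁻¹ M.e) • M.psi (M.act σ Z)
      = (M.dpsi Z v).comp (σ⁻¹ : V ≃ₗ[ℝ] V).toLinearMap := by
  refine LinearMap.ext fun x => ?_
  have h1 : (fun Z => M.pairPsi (σ⁻¹ M.e) Z * M.pairPsi x (M.act σ Z))
      =ᶠ[𝓝 Z] M.pairPsi (σ⁻¹ x) := by
    filter_upwards [M.continuous_qY.continuousAt.eventually (lt_mem_nhds hZ)] with W hW
    rw [← M.autFactor_eq hσ, M.pairPsi_act hσ hW]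
  have h2 : HasFDerivAt (fun Z => M.pairPsi x (M.act σ Z))
      ((fderiv ℂ (M.pairPsi x) (M.act σ Z)).comp (fderiv ℂ (M.act σ) Z)) Z :=
    ((M.differentiable_pairPsi x) _).hasFDerivAt.comp Z (M.differentiableAt_act hσ hZ).hasFDerivAt
  have h3 := ((M.differentiable_pairPsi (σ⁻¹ M.e) Z).hasFDerivAt.mul h2).fderiv
  have h4 := h1.fderiv_eq (𝕜 := ℂ)
  have h5 := DFunLike.congr_fun (h3.symm.trans h4) v
  simp only [add_apply, smul_apply, ContinuousLinearMap.comp_apply, smul_eq_mul,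
    fderiv_pairPsi_apply, ← jacobian_mulVec, ← M.autFactor_eq hσ] at h5
  rw [LinearMap.add_apply, LinearMap.smul_apply, LinearMap.smul_apply, smul_eq_mul, smul_eq_mul,
    psi_apply, mul_comm (M.dpsi Z v _)]
  exact (by rw [← h5] : _ = M.dpsi Z v (σ⁻¹ x))

/-- The complex bilinear form `∑ ε_k v_k w_k` on `ℂⁿ`. -/
noncomputable def epsForm (v w : Fin n → ℂ) : ℂ := ∑ k, (M.q (M.b k) : ℂ) * v k * w k

/-- Invariance of the bilinear form applied to two derivatives of ψ. The terms with the derivative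
of j drop out, since ψ is isotropic and orthogonal to its derivatives. So σ is conformal with factor
j⁻². -/
theorem epsForm_jacobian (hσ : ∀ x, M.q (σ x) = M.q x) (hZ : 0 < M.qY Z) (v w : Fin n → ℂ) :
    M.autFactor σ Z ^ 2 * M.epsForm ((M.jacobian σ Z).mulVec v) ((M.jacobian σ Z).mulVec w)
      = M.epsForm v w := by
  have h := M.dualForm_comp hσ (M.dpsi Z v) (M.dpsi Z w)
  rw [← M.dpsi_act hσ hZ, ← M.dpsi_act hσ hZ, dualForm_dpsi_dpsi] at h
  simp only [dualForm_add_left, dualForm_add_right, dualForm_smul_left, dualForm_smul_right,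
    dualForm_dpsi_dpsi, dualForm_psi_dpsi, dualForm_psi_psi, M.dualForm_comm (M.dpsi _ _) (M.psi _)]
    at h
  rw [epsForm, epsForm]
  linear_combination h / 2

theorem det_jacobian (hσ : ∀ x, M.q (σ x) = M.q x) (hZ : 0 < M.qY Z) :
    (M.autFactor σ Z ^ n * (M.jacobian σ Z).det) ^ 2 = 1 := by
  set J := M.jacobian σ Z
  set D : Matrix (Fin n) (Fin n) ℂ := Matrix.diagonal fun k => (M.q (M.b k) : ℂ) with hD
  have h1 : ∀ v w : Fin n → ℂ, dotProduct v (D.mulVec w) = M.epsForm v w := by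
    intro v w
    simp only [dotProduct, hD, Matrix.mulVec_diagonal, epsForm]
    exact Finset.sum_congr rfl fun _ _ => by ring
  have h2 : (M.autFactor σ Z ^ 2) • (J.transpose * D * J) = D := by
    ext i j
    have h3 := M.epsForm_jacobian hσ hZ (Pi.single i 1) (Pi.single j 1)
    rw [← h1, ← h1] at h3
    have h4 : ∀ A : Matrix (Fin n) (Fin n) ℂ,
        dotProduct (Pi.single i 1) (A.mulVec (Pi.single j 1)) = A i j := by
      intro A
      simp
    rw [← h4 D, ← h3, Matrix.smul_apply, ← h4 (J.transpose * D * J), smul_eq_mul,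
      ← Matrix.mulVec_mulVec, ← Matrix.mulVec_mulVec, Matrix.dotProduct_mulVec _ J.transpose,
      Matrix.vecMul_transpose]
  have h5 := congrArg Matrix.det h2
  rw [Matrix.det_smul, Matrix.det_mul, Matrix.det_mul, Matrix.det_transpose, Fintype.card_fin] at h5
  have h6 : D.det ≠ 0 := by
    rw [hD, Matrix.det_diagonal, Finset.prod_ne_zero_iff]
    intro k _ h
    have := M.eps_sq_complex k
    rw [h] at this
    simp at this
  apply mul_right_cancel₀ h6
  linear_combination h5

/-- Invariance of dμ: conformality gives |det J| = |j|⁻ⁿ, which matches the transformation of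
q(Y)⁻ⁿ. -/
theorem volDensity_act (hσ : ∀ x, M.q (σ x) = M.q x) (hZ : 0 < M.qY Z) :
    M.volDensity (M.act σ Z) * ((M.jacobian σ Z).det * conj (M.jacobian σ Z).det)
      = M.volDensity Z := by
  have hj := M.autFactor_ne_zero hσ hZ
  have hj' : conj (M.autFactor σ Z) ≠ 0 := by simpa using hj
  have h1 : ‖M.autFactor σ Z ^ n * (M.jacobian σ Z).det‖ = 1 := by
    have := congrArg norm (M.det_jacobian hσ hZ)
    rw [norm_pow, norm_one] at this
    exact (pow_eq_one_iff_of_nonneg (norm_nonneg _) two_ne_zero).1 this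
  have h2 : (M.autFactor σ Z ^ n * (M.jacobian σ Z).det)
      * conj (M.autFactor σ Z ^ n * (M.jacobian σ Z).det) = 1 := by
    rw [Complex.mul_conj, Complex.normSq_eq_norm_sq, h1]
    simp
  have h3 : (M.qY (M.act σ Z) : ℂ) ≠ 0 := by exact_mod_cast (M.qY_act_pos hσ hZ).ne'
  rw [map_mul, map_pow] at h2
  rw [volDensity, volDensity, ← M.qY_act hσ hZ]
  have hI := Complex.I_ne_zero
  rw [div_mul_eq_mul_div, div_eq_div_iff (pow_ne_zero n (by simp [h3]))
    (pow_ne_zero n (by simp [h3, hj]))]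
  simp only [mul_pow]
  linear_combination (4 ^ n * Complex.I ^ n * (M.qY (M.act σ Z) : ℂ) ^ n) * h2

/-- A description of the coefficients of p_Z(x) through invariant pairings only, from which their
transformation law can be read off. -/
theorem epsForm_pCoeff (x : V) (Z v : Fin n → ℂ) :
    M.epsForm (fun k => conj (M.pCoeff x Z k)) v
      = M.pairPsi x Z / 4 * M.dualForm (M.psiBar Z) (M.dpsi Z v) - M.qY Z * M.dpsi Z v x := by
  rw [dualForm_psiBar_dpsi]
  change _ = _ - _ * ∑ k, conj (M.dPair x Z k) * v k
  rw [epsForm, Finset.mul_sum, Finset.mul_sum, Finset.mul_sum, ← Finset.sum_sub_distrib]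
  refine Finset.sum_congr rfl fun k _ => ?_
  simp only [pCoeff, map_sub, map_mul, Complex.conj_I, Complex.conj_ofReal, Complex.conj_conj]
  linear_combination (-M.qY Z * conj (M.dPair x Z k) * v k) * M.eps_sq_complex k

theorem pCoeff_act (hσ : ∀ x, M.q (σ x) = M.q x) (hZ : 0 < M.qY Z) (x : V) :
    conj (M.autFactor σ Z) • (fun k => conj (M.pCoeff x (M.act σ Z) k))
      = (M.jacobian σ Z).mulVec (fun k => conj (M.pCoeff (σ⁻¹ x) Z k)) := by
  have hj := M.autFactor_ne_zero hσ hZ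
  have hj' : conj (M.autFactor σ Z) ≠ 0 := by simpa using hj
  set J := M.jacobian σ Z
  have hdet : IsUnit J.det := by
    rw [isUnit_iff_ne_zero]
    intro h
    have := M.det_jacobian hσ hZ
    rw [h] at this
    simp at this
  have key : ∀ v, M.epsForm (conj (M.autFactor σ Z) • (fun k => conj (M.pCoeff x (M.act σ Z) k)))
      (J.mulVec v) = M.epsForm (J.mulVec (fun k => conj (M.pCoeff (σ⁻¹ x) Z k))) (J.mulVec v) := by
    intro v
    have hs : ∀ (c : ℂ) (u w : Fin n → ℂ), M.epsForm (c • u) w = c * M.epsForm u w := by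
      intro c u w
      rw [epsForm, epsForm, Finset.mul_sum]
      exact Finset.sum_congr rfl fun _ _ => by simp; ring
    apply mul_left_cancel₀ (pow_ne_zero 2 hj)
    rw [M.epsForm_jacobian hσ hZ, hs, epsForm_pCoeff, epsForm_pCoeff]
    have h1 := LinearMap.congr_fun (M.dpsi_act hσ hZ v) x
    have h2 := M.dualForm_comp hσ (M.psiBar Z) (M.dpsi Z v)
    rw [← M.conj_smul_psiBar_act hσ hZ, ← M.dpsi_act hσ hZ] at h2
    simp only [dualForm_add_right, dualForm_smul_left, dualForm_smul_right,
      dualForm_psiBar_psi] at h2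
    have h3 : M.autFactor σ Z * M.dpsi (M.act σ Z) (J.mulVec v) x
      + M.dpsi Z v (σ⁻¹ M.e) * M.pairPsi x (M.act σ Z) = M.dpsi Z v (σ⁻¹ x) := h1
    -- The derivative of j enters once through (ψ̄, dψ) = 4q(Y)-terms and once through dψ(x), with
    -- opposite signs, and cancels.
    rw [← h2, ← h3, ← M.pairPsi_act hσ hZ, ← M.qY_act hσ hZ]
    ring
  funext k
  have h4 := key (J⁻¹.mulVec (Pi.single k 1))
  rw [Matrix.mulVec_mulVec, Matrix.mul_nonsing_inv _ hdet, Matrix.one_mulVec] at h4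
  have h5 : ∀ u : Fin n → ℂ, M.epsForm u (Pi.single k 1) = M.q (M.b k) * u k := by
    intro u
    rw [epsForm, Finset.sum_eq_single k]
    · simp
    · intro i _ hi; simp [Pi.single_eq_of_ne hi]
    · simp
  rw [h5, h5] at h4
  have h6 : (M.q (M.b k) : ℂ) ≠ 0 := by
    intro h
    have := M.eps_sq_complex k
    rw [h] at this
    simp at this
  exact mul_left_cancel₀ h6 h4

theorem pForm_eq_antiContract (x : V) (hZ : 0 < M.qY Z) :
    M.pForm x Z = M.volDensity Z • antiContract (fun k => conj (M.pCoeff x Z k)) := by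
  rw [M.pForm_eq x hZ, antiContract_eq, Finset.smul_sum]
  refine Finset.sum_congr rfl fun j _ => ?_
  rw [smul_smul, Complex.conj_conj, mul_comm (M.pCoeff x Z j)]

theorem pForm_act (hσ : ∀ x, M.q (σ x) = M.q x) (hZ : 0 < M.qY Z) (x : V) :
    M.autFactor σ Z • (M.pForm x (M.act σ Z)).compContinuousLinearMap (fderiv ℝ (M.act σ) Z)
      = M.pForm (σ⁻¹ x) Z := by
  have h1 := congrArg antiContract (M.pCoeff_act hσ hZ x)
  rw [antiContract_smul, Complex.conj_conj] at h1
  ext w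
  rw [M.pForm_eq_antiContract x (M.qY_act_pos hσ hZ), M.pForm_eq_antiContract _ hZ,
    ContinuousAlternatingMap.smul_apply, ContinuousAlternatingMap.smul_apply,
    ContinuousAlternatingMap.compContinuousLinearMap_apply, ContinuousAlternatingMap.smul_apply]
  have h2 : (fderiv ℝ (M.act σ) Z : (Fin n → ℂ) → Fin n → ℂ) ∘ w
      = fun i => (M.jacobian σ Z).mulVec (w i) := funext fun i => M.fderiv_real_act hσ hZ _
  have h3 := DFunLike.congr_fun h1 fun i => (M.jacobian σ Z).mulVec (w i)
  rw [antiContract_mulVec, ContinuousAlternatingMap.smul_apply, smul_eq_mul] at h3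
  rw [h2, smul_eq_mul, smul_eq_mul, smul_eq_mul, mul_left_comm, h3, ← M.volDensity_act hσ hZ]
  ring

/-- The terms of the series are equivariant. -/
theorem slash_pTilde (κ : ℤ) (hσ : ∀ x, M.q (σ x) = M.q x) (hZ : 0 < M.qY Z) (x : V) :
    M.slash (-κ) σ (M.pTilde κ x) Z = M.pTilde κ (σ⁻¹ x) Z := by
  have hj := M.autFactor_ne_zero hσ hZ
  have h1 := M.pForm_act hσ hZ x
  have h2 : ∀ (c : ℂ) (η : (Fin n → ℂ) [⋀^Fin (2 * n - 2 + 1)]→L[ℝ] ℂ)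
      (T : (Fin n → ℂ) →L[ℝ] (Fin n → ℂ)),
      (c • η).compContinuousLinearMap T = c • η.compContinuousLinearMap T := fun _ _ _ => rfl
  rw [slash, pTilde, pTilde, h2, ← h1, smul_smul, smul_smul, M.qNeg_act hσ hZ, M.qPos_act hσ hZ,
    M.q_inv hσ, ← M.pairPsi_act hσ hZ, mul_zpow, neg_neg]
  congr 1
  -- The weight κ is the sum of κ − 1 from the power of (x, ψ(Z)) and 1 from p_Z(x).
  rw [← sub_add_cancel κ 1, zpow_add_one₀ hj, sub_add_cancel]
  ring

theorem slashFun_pairPsi (κ : ℤ) (hσ : ∀ x, M.q (σ x) = M.q x) (hZ : 0 < M.qY Z) (x : V) :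
    M.slashFun κ σ (fun Z => 1 / M.pairPsi x Z ^ κ) Z = 1 / M.pairPsi (σ⁻¹ x) Z ^ κ := by
  rw [slashFun, ← M.pairPsi_act hσ hZ, mul_zpow, zpow_neg, one_div, one_div, mul_inv]

end LatticeSetup

/-! ### Series as bounded functionals of analytic maps into bounded families. -/

section NormalSeries

open Topology
open scoped ENNReal

/-- Bounded families of complex numbers. -/
noncomputable abbrev BddFamily (I : Type*) := lp (fun _ : I => ℂ) ∞

variable {I : Type*} {n : ℕ}

/-- The bounded family with given members. -/
noncomputable def BddFamily.mk (f : I → ℂ) (C : ℝ) (h : ∀ i, ‖f i‖ ≤ C) : BddFamily I :=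
  ⟨f, memℓp_infty ⟨C, by rintro _ ⟨i, rfl⟩; exact h i⟩⟩

theorem BddFamily.mk_apply (f : I → ℂ) (C : ℝ) (h : ∀ i, ‖f i‖ ≤ C) (i : I) :
    BddFamily.mk f C h i = f i := rfl

/-- The sum of a bounded family with summable weights. -/
noncomputable def weightedSum {w : I → ℝ} (hw : Summable w) (hw0 : ∀ i, 0 ≤ w i) :
    BddFamily I →L[ℂ] ℂ :=
  have h : ∀ t : BddFamily I, Summable fun i => (w i : ℂ) * t i := fun t =>
    Summable.of_norm_bounded (hw.mul_right ‖t‖) fun i => by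
      rw [norm_mul, Complex.norm_real, Real.norm_of_nonneg (hw0 i)]
      exact mul_le_mul_of_nonneg_left (lp.norm_apply_le_norm ENNReal.top_ne_zero t i) (hw0 i)
  LinearMap.mkContinuous
    { toFun := fun t => ∑' i, (w i : ℂ) * t i
      map_add' := fun s t => by
        rw [← (h s).tsum_add (h t)]
        exact tsum_congr fun i => by rw [lp.coeFn_add, Pi.add_apply, mul_add]
      map_smul' := fun c t => by
        rw [RingHom.id_apply, smul_eq_mul, ← tsum_mul_left]
        exact tsum_congr fun i => by rw [lp.coeFn_smul, Pi.smul_apply, smul_eq_mul]; ring }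
    (∑' i, w i) fun t => by
      rw [← tsum_mul_right]
      refine tsum_of_norm_bounded (hw.mul_right ‖t‖).hasSum fun i => ?_
      rw [norm_mul, Complex.norm_real, Real.norm_of_nonneg (hw0 i)]
      exact mul_le_mul_of_nonneg_left (lp.norm_apply_le_norm ENNReal.top_ne_zero t i) (hw0 i)

theorem weightedSum_apply {w : I → ℝ} (hw : Summable w) (hw0 : ∀ i, 0 ≤ w i) (t : BddFamily I) :
    weightedSum hw hw0 t = ∑' i, (w i : ℂ) * t i := rfl

theorem summable_weight_mul {w : I → ℝ} (hw : Summable w) (hw0 : ∀ i, 0 ≤ w i) (t : BddFamily I) :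
    Summable fun i => (w i : ℂ) * t i :=
  Summable.of_norm_bounded (hw.mul_right ‖t‖) fun i => by
    rw [norm_mul, Complex.norm_real, Real.norm_of_nonneg (hw0 i)]
    exact mul_le_mul_of_nonneg_left (lp.norm_apply_le_norm ENNReal.top_ne_zero t i) (hw0 i)

/-- The terms `f i` are the coordinates of a real analytic function with values in the bounded
families, up to summable weights. -/
structure NormalSeries (f : I → (Fin n → ℂ) → ℂ) (U : Set (Fin n → ℂ)) : Prop where
  exists_family : ∃ (w : I → ℝ) (T : (Fin n → ℂ) → BddFamily I), Summable w ∧ (∀ i, 0 ≤ w i) ∧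
    AnalyticOnNhd ℝ T U ∧ ∀ Z ∈ U, ∀ i, f i Z = w i * T Z i

namespace NormalSeries

variable {f : I → (Fin n → ℂ) → ℂ} {U : Set (Fin n → ℂ)} {Z : Fin n → ℂ}

theorem exists_bound (hf : NormalSeries f U) (hZ : Z ∈ U) :
    ∃ V ∈ 𝓝 Z, ∃ g : I → ℝ, Summable g ∧ ∀ i, ∀ W ∈ V ∩ U, ‖f i W‖ ≤ g i := by
  obtain ⟨w, T, hw, hw0, hT, hfT⟩ := hf.exists_family
  have h1 : ∀ᶠ W in 𝓝 Z, ‖T W‖ < ‖T Z‖ + 1 :=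
    ((hT Z hZ).continuousAt.norm).eventually (gt_mem_nhds (lt_add_one _))
  refine ⟨_, h1, fun i => w i * (‖T Z‖ + 1), hw.mul_right _, fun i W hW => ?_⟩
  rw [hfT W hW.2, norm_mul, Complex.norm_real, Real.norm_of_nonneg (hw0 i)]
  exact mul_le_mul_of_nonneg_left ((lp.norm_apply_le_norm ENNReal.top_ne_zero _ i).trans hW.1.le)
    (hw0 i)

theorem summable (hf : NormalSeries f U) (hZ : Z ∈ U) : Summable fun i => f i Z := by
  obtain ⟨V, hV, g, hg, hb⟩ := hf.exists_bound hZ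
  exact Summable.of_norm_bounded hg fun i => hb i Z ⟨mem_of_mem_nhds hV, hZ⟩

theorem analyticOnNhd (hf : NormalSeries f U) (hU : IsOpen U) :
    AnalyticOnNhd ℝ (fun Z => ∑' i, f i Z) U := by
  obtain ⟨w, T, hw, hw0, hT, hfT⟩ := hf.exists_family
  intro Z hZ
  have h1 : AnalyticAt ℝ (fun Z => (weightedSum hw hw0).restrictScalars ℝ (T Z)) Z :=
    (ContinuousLinearMap.analyticAt _ _).comp (hT Z hZ)
  refine h1.congr ?_
  filter_upwards [hU.mem_nhds hZ] with W hW
  exact (tsum_congr fun i => (hfT W hW i)).symm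

/-- Differentiating T once in the space of bounded families differentiates all terms simultaneously,
and summation commutes with the derivative because it is a bounded complex linear functional. -/
theorem hasDbar (hf : NormalSeries f U) (hU : IsOpen U) (hZ : Z ∈ U) {d : I → Fin n → ℂ}
    (hd : ∀ i, HasDbar (f i) (d i) Z) :
    (∀ k, Summable fun i => d i k) ∧
      HasDbar (fun Z => ∑' i, f i Z) (fun k => ∑' i, d i k) Z := by
  obtain ⟨w, T, hw, hw0, hT, hfT⟩ := hf.exists_family
  have hTd : DifferentiableAt ℝ T Z := (hT Z hZ).differentiableAt
  set T' := fderiv ℝ T Z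
  set S : (Fin n → ℂ) → BddFamily I := fun v => (1 / 2 : ℂ) • (T' v + Complex.I • T' (Complex.I • v))
  have h1 : ∀ i v, ∑ k, d i k * conj (v k) = w i * S v i := by
    intro i v
    have h2 : f i =ᶠ[𝓝 Z] fun Z => (w i : ℂ) * T Z i := by
      filter_upwards [hU.mem_nhds hZ] with W hW using hfT W hW i
    have h3 : HasFDerivAt (fun Z => (w i : ℂ) * T Z i)
        ((w i : ℂ) • ((lp.evalCLM ℝ (fun _ : I => ℂ) ∞ i).comp T')) Z :=
      HasFDerivAt.const_mul ((lp.evalCLM ℝ (fun _ : I => ℂ) ∞ i).hasFDerivAt.comp Z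
        hTd.hasFDerivAt) _
    rw [← (hd i).eq, h2.fderiv_eq, h3.fderiv, conjLinearPart_apply]
    have h4 : ∀ t : BddFamily I, lp.evalCLM ℝ (fun _ : I => ℂ) ∞ i t = t i := fun _ => rfl
    simp only [smul_apply, ContinuousLinearMap.comp_apply, h4, S, lp.coeFn_smul, lp.coeFn_add,
      Pi.smul_apply, Pi.add_apply, smul_eq_mul]
    ring
  have h5 : ∀ i k, d i k = w i * S (Pi.single k 1) i := by
    intro i k
    rw [← h1, Finset.sum_eq_single k]
    · simp
    · intro l _ hl; simp [Pi.single_eq_of_ne hl]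
    · simp
  have h6 : ∀ k, Summable fun i => d i k := by
    intro k
    simp only [h5]
    exact summable_weight_mul hw hw0 _
  refine ⟨h6, ?_⟩
  have h7 : (fun Z => ∑' i, f i Z) =ᶠ[𝓝 Z] fun Z => weightedSum hw hw0 (T Z) := by
    filter_upwards [hU.mem_nhds hZ] with W hW
    exact tsum_congr fun i => hfT W hW i
  have h8 : HasFDerivAt (fun Z => weightedSum hw hw0 (T Z))
      (((weightedSum hw hw0).restrictScalars ℝ).comp T') Z :=
    ((weightedSum hw hw0).restrictScalars ℝ).hasFDerivAt.comp Z hTd.hasFDerivAt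
  refine ⟨h7.differentiableAt_iff.2 h8.differentiableAt, fun v => ?_⟩
  rw [h7.fderiv_eq, h8.fderiv, conjLinearPart_apply]
  simp only [ContinuousLinearMap.comp_apply, ContinuousLinearMap.coe_restrictScalars']
  rw [← map_smul, ← map_add, ← map_smul, weightedSum_apply]
  change ∑' i, (w i : ℂ) * S v i = _
  simp only [← h1, ← tsum_mul_right]
  exact Summable.tsum_finsetSum fun k _ => (h6 k).mul_right _

end NormalSeries

theorem hasSumLocallyUniformlyOn_of_exists_bound {X F : Type*} [TopologicalSpace X]
    [NormedAddCommGroup F] [CompleteSpace F] {f : I → X → F} {s : Set X}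
    (h : ∀ x ∈ s, ∃ V ∈ 𝓝 x, ∃ g : I → ℝ, Summable g ∧ ∀ i, ∀ y ∈ V ∩ s, ‖f i y‖ ≤ g i) :
    HasSumLocallyUniformlyOn f (fun x => ∑' i, f i x) s := by
  refine hasSumLocallyUniformlyOn_of_of_forall_exists_nhds fun x hx => ?_
  obtain ⟨V, hV, g, hg, hb⟩ := h x hx
  exact ⟨V ∩ s, Set.inter_comm s V ▸ inter_mem_nhdsWithin s hV, HasSumUniformlyOn.of_norm_le_summable hg hb⟩

end NormalSeries

/-! ### Inversion and power series in the algebra of bounded families. -/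

namespace BddFamily

open Topology
open scoped ENNReal

variable {I : Type*}

/-- A uniform lower bound keeps the family of reciprocals bounded. -/
theorem isUnit_of_le {t : BddFamily I} {δ : ℝ} (hδ : 0 < δ) (h : ∀ i, δ ≤ ‖t i‖) : IsUnit t := by
  have h0 : ∀ i, t i ≠ 0 := fun i => norm_pos_iff.1 (hδ.trans_le (h i))
  refine IsUnit.of_mul_eq_one (mk (fun i => (t i)⁻¹) δ⁻¹ fun i => ?_) ?_
  · rw [norm_inv]
    exact inv_anti₀ hδ (h i)
  · ext i
    rw [lp.infty_coeFn_mul, Pi.mul_apply, mk_apply, mul_inv_cancel₀ (h0 i)]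
    rfl

theorem inverse_apply {t : BddFamily I} (ht : IsUnit t) (i : I) :
    Ring.inverse t i = (t i)⁻¹ := by
  have h := congrArg (fun s : BddFamily I => s i) (Ring.mul_inverse_cancel t ht)
  simp only [lp.infty_coeFn_mul, Pi.mul_apply, lp.infty_coeFn_one, Pi.one_apply] at h
  exact eq_inv_of_mul_eq_one_right h

theorem analyticAt_inverse' {E : Type*} [NormedAddCommGroup E] [NormedSpace ℝ E]
    {T : E → BddFamily I} {z : E} (hT : AnalyticAt ℝ T z) (h : IsUnit (T z)) :
    AnalyticAt ℝ (fun z => Ring.inverse (T z)) z := by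
  have h1 := analyticAt_inverse (𝕜 := ℝ) (A := BddFamily I) h.unit
  exact h1.comp_of_eq hT h.unit_spec.symm

/-- Members of a scalar power series in a bounded family. -/
theorem ofScalarsSum_apply [Nonempty I] {c : ℕ → ℝ}
    (hc : 1 ≤ (FormalMultilinearSeries.ofScalars (BddFamily I) c).radius)
    (hc' : 1 ≤ (FormalMultilinearSeries.ofScalars ℝ c).radius) {u : BddFamily I} (hu : ‖u‖ < 1)
    (i : I) {r : ℝ} (hr : u i = r) :
    FormalMultilinearSeries.ofScalarsSum c u i
      = ((FormalMultilinearSeries.ofScalarsSum c r : ℝ) : ℂ) := by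
  have hr1 : |r| < 1 := by
    have := lp.norm_apply_le_norm ENNReal.top_ne_zero u i
    rw [hr, Complex.norm_real, Real.norm_eq_abs] at this
    exact this.trans_lt hu
  have h1 := ((FormalMultilinearSeries.ofScalars (BddFamily I) c).hasFPowerSeriesOnBall
    (zero_lt_one.trans_le hc)).hasSum (y := u) (by
      rw [Metric.mem_eball, edist_zero_right, enorm_eq_nnnorm]
      exact lt_of_lt_of_le (by exact_mod_cast hu) hc)
  have h2 := ((FormalMultilinearSeries.ofScalars ℝ c).hasFPowerSeriesOnBall
    (zero_lt_one.trans_le hc')).hasSum (y := r) (by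
      rw [Metric.mem_eball, edist_zero_right, enorm_eq_nnnorm]
      exact lt_of_lt_of_le (by exact_mod_cast hr1) hc')
  rw [zero_add] at h1 h2
  have h3 := h1.mapL (lp.evalCLM ℝ (fun _ : I => ℂ) ∞ i)
  have h4 := h2.mapL Complex.ofRealCLM
  refine h3.unique (h4.congr_fun fun k => ?_)
  rw [FormalMultilinearSeries.ofScalars_apply_eq, FormalMultilinearSeries.ofScalars_apply_eq]
  have h5 : ∀ t : BddFamily I, lp.evalCLM ℝ (fun _ : I => ℂ) ∞ i t = t i := fun _ => rfl
  rw [h5, lp.coeFn_smul, Pi.smul_apply, lp.infty_coeFn_pow, Pi.pow_apply, hr]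
  simp

theorem analyticAt_ofScalarsSum {E : Type*} [NormedAddCommGroup E] [NormedSpace ℝ E] {c : ℕ → ℝ}
    (hc : 1 ≤ (FormalMultilinearSeries.ofScalars (BddFamily I) c).radius)
    {T : E → BddFamily I} {z : E} (hT : AnalyticAt ℝ T z) (h : ‖T z‖ < 1) :
    AnalyticAt ℝ (fun z => FormalMultilinearSeries.ofScalarsSum c (T z)) z := by
  have h1 := ((FormalMultilinearSeries.ofScalars (BddFamily I) c).hasFPowerSeriesOnBall
    (zero_lt_one.trans_le hc)).analyticAt_of_mem (y := T z) (by
      rw [Metric.mem_eball, edist_zero_right, enorm_eq_nnnorm]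
      exact lt_of_lt_of_le (by exact_mod_cast h) hc)
  exact h1.comp hT

end BddFamily

/-- Only finitely many values reach 1/2, so a maximum of finitely many numbers below 1 bounds them
all. -/
theorem exists_lt_one_of_tendsto_cofinite {I : Type*} {f : I → ℝ} (h : ∀ i, f i < 1)
    (h0 : Filter.Tendsto f Filter.cofinite (nhds 0)) : ∃ r, 0 ≤ r ∧ r < 1 ∧ ∀ i, f i ≤ r := by
  classical
  have hS : {i | ¬ f i < 1 / 2}.Finite := h0.eventually (gt_mem_nhds (by norm_num))
  set F : Finset ℝ := insert (1 / 2) (hS.toFinset.image f)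
  have hF : F.Nonempty := ⟨1 / 2, Finset.mem_insert_self _ _⟩
  have hhalf : 1 / 2 ≤ F.max' hF := F.le_max' _ (Finset.mem_insert_self _ _)
  refine ⟨F.max' hF, by linarith, ?_, fun i => ?_⟩
  · rw [Finset.max'_lt_iff]
    intro y hy
    rcases Finset.mem_insert.1 hy with rfl | hy
    · norm_num
    · obtain ⟨i, -, rfl⟩ := Finset.mem_image.1 hy
      exact h i
  · by_cases hi : f i < 1 / 2
    · exact hi.le.trans hhalf
    · exact F.le_max' _ (Finset.mem_insert_of_mem (Finset.mem_image_of_mem _ (by simpa using hi)))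

/-! ### Families over a set of vectors, normalised by their length. -/

namespace LatticeSetup

open Topology
open scoped ENNReal

variable {n : ℕ} [NeZero n] {V : Type*} [AddCommGroup V] [Module ℝ V] (M : LatticeSetup n V)
  {I : Type*} (x : I → V)

/-- The vector x_{Z⁻} is orthogonal to the positive plane of Z, whose complement is negative
definite. -/
theorem qNeg_nonpos (v : V) {Z : Fin n → ℂ} (hZ : 0 < M.qY Z) : M.qNeg v Z ≤ 0 := by
  by_contra h
  push Not at h
  have h0 : M.pairPsi (v - M.projPos v Z) Z = 0 := by
    apply Complex.ext
    · rw [pairPsi_re, Complex.zero_re, projPos, bil_sub_left, bil_add_left, bil_smul_left,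
        bil_smul_left, bil_self, q_psiRe, M.bil_comm (M.psiIm Z), bil_psiRe_psiIm]
      field_simp
      ring
    · rw [pairPsi_im, Complex.zero_im, projPos, bil_sub_left, bil_add_left, bil_smul_left,
        bil_smul_left, bil_self, q_psiIm, bil_psiRe_psiIm]
      field_simp
      ring
  have h1 := M.q_neg_of_pairPsi_eq_zero hZ h0 h.le
  rw [qNeg, h1, map_zero] at h
  exact lt_irrefl _ h

theorem lt_qPos_iff (v : V) {Z : Fin n → ℂ} (hZ : 0 < M.qY Z) :
    M.q v < M.qPos v Z ↔ M.qNeg v Z ≠ 0 := by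
  have h := M.qNeg_nonpos v hZ
  rw [qNeg_eq] at h ⊢
  exact ⟨fun h1 h2 => by linarith, fun h1 => by
    rcases h.lt_or_eq with h2 | h2
    · linarith
    · exact absurd h2 h1⟩

/-- The members `φ(x i) / ‖x i‖` for a linear functional `φ`. -/
noncomputable def normalized (φ : V →ₗ[ℝ] ℝ) : BddFamily I :=
  BddFamily.mk (fun i => ((φ (x i) / ‖M.coord (x i)‖ : ℝ) : ℂ))
    ‖LinearMap.toContinuousLinearMap (φ.comp M.coordEquiv.symm.toLinearMap)‖ fun i => by
      rw [Complex.norm_real, norm_div, norm_norm]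
      refine div_le_of_le_mul₀ (norm_nonneg _) (norm_nonneg _) ?_
      have := (LinearMap.toContinuousLinearMap
        (φ.comp M.coordEquiv.symm.toLinearMap)).le_opNorm (M.coord (x i))
      have h2 : M.coordEquiv.symm (M.coord (x i)) = x i := M.coordEquiv.symm_apply_apply (x i)
      simpa [h2] using this

theorem normalized_apply (φ : V →ₗ[ℝ] ℝ) (i : I) :
    M.normalized x φ i = (φ (x i) : ℂ) / ‖M.coord (x i)‖ := by
  rw [normalized, BddFamily.mk_apply, Complex.ofReal_div]

/-- The linear functional `(·, u)`. -/
def bilRight (u : V) : V →ₗ[ℝ] ℝ where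
  toFun v := M.bil v u
  map_add' _ _ := M.bil_add_left _ _ _
  map_smul' _ _ := M.bil_smul_left _ _ _

theorem bilRight_apply (u v : V) : M.bilRight u v = M.bil v u := rfl

/-- The normalized family of the `(x i, ψ(Z))`. -/
noncomputable def pairFamily (Z : Fin n → ℂ) : BddFamily I :=
  M.normalized x (M.bilRight M.et) - M.qC Z • M.normalized x (M.bilRight M.e)
    + ∑ k, Z k • M.normalized x (M.bilRight (M.b k))

theorem pairFamily_apply (Z : Fin n → ℂ) (i : I) :
    M.pairFamily x Z i = M.pairPsi (x i) Z / ‖M.coord (x i)‖ := by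
  simp only [pairFamily, lp.coeFn_add, lp.coeFn_sub, lp.coeFn_smul, lp.coeFn_sum, Pi.add_apply,
    Pi.sub_apply, Pi.smul_apply, Finset.sum_apply, smul_eq_mul, normalized_apply, bilRight_apply,
    pairPsi_eq, add_div, sub_div, Finset.sum_div]
  congr 1
  · ring
  · exact Finset.sum_congr rfl fun _ _ => by ring

/-- The normalized family of the `conj (x i, ψ(Z))`. -/
noncomputable def pairConjFamily (Z : Fin n → ℂ) : BddFamily I :=
  M.normalized x (M.bilRight M.et) - conj (M.qC Z) • M.normalized x (M.bilRight M.e)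
    + ∑ k, conj (Z k) • M.normalized x (M.bilRight (M.b k))

theorem pairConjFamily_apply (Z : Fin n → ℂ) (i : I) :
    M.pairConjFamily x Z i = conj (M.pairPsi (x i) Z) / ‖M.coord (x i)‖ := by
  simp only [pairConjFamily, lp.coeFn_add, lp.coeFn_sub, lp.coeFn_smul, lp.coeFn_sum, Pi.add_apply,
    Pi.sub_apply, Pi.smul_apply, Finset.sum_apply, smul_eq_mul, normalized_apply, bilRight_apply,
    pairPsi_eq, map_add, map_sub, map_sum, map_mul, Complex.conj_ofReal, add_div, sub_div,
    Finset.sum_div]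
  congr 1
  · ring
  · exact Finset.sum_congr rfl fun _ _ => by ring

/-- The normalized family of the `dPair (x i) Z k`. -/
noncomputable def dPairFamily (Z : Fin n → ℂ) (k : Fin n) : BddFamily I :=
  M.normalized x (M.bilRight (M.b k))
    - (2 * M.q (M.b k) * conj (Z k)) • M.normalized x (M.bilRight M.e)

theorem dPairFamily_apply (Z : Fin n → ℂ) (k : Fin n) (i : I) :
    M.dPairFamily x Z k i = M.dPair (x i) Z k / ‖M.coord (x i)‖ := by
  simp only [dPairFamily, lp.coeFn_sub, lp.coeFn_smul, Pi.sub_apply, Pi.smul_apply, smul_eq_mul,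
    normalized_apply, bilRight_apply, dPair]
  ring

/-- The normalized family of the `q(x i)`. -/
noncomputable def qFamily : BddFamily I :=
  M.normalized x (M.bilRight M.et) * M.normalized x (M.bilRight M.e)
    + ∑ k, ((M.q (M.b k) : ℂ) / 4) • (M.normalized x (M.bilRight (M.b k)) ^ 2)

theorem qFamily_apply (i : I) :
    M.qFamily x i = M.q (x i) / (‖M.coord (x i)‖ : ℂ) ^ 2 := by
  simp only [qFamily, lp.coeFn_add, lp.coeFn_smul, lp.coeFn_sum, lp.infty_coeFn_mul,
    lp.infty_coeFn_pow, Pi.add_apply, Pi.mul_apply, Pi.pow_apply, Pi.smul_apply, Finset.sum_apply,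
    smul_eq_mul, normalized_apply, bilRight_apply]
  rw [M.q_eq (x i)]
  push_cast
  rw [add_div, Finset.sum_div]
  congr 1
  · ring
  · exact Finset.sum_congr rfl fun _ _ => by ring

/-- The normalized family of the `q((x i)_{Z⁺})`. -/
noncomputable def qPosFamily (Z : Fin n → ℂ) : BddFamily I :=
  (4 * (M.qY Z : ℂ))⁻¹ • (M.pairFamily x Z * M.pairConjFamily x Z)

theorem qPosFamily_apply (Z : Fin n → ℂ) (i : I) :
    M.qPosFamily x Z i = M.qPos (x i) Z / (‖M.coord (x i)‖ : ℂ) ^ 2 := by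
  rw [qPosFamily, lp.coeFn_smul, Pi.smul_apply, lp.infty_coeFn_mul, Pi.mul_apply, pairFamily_apply,
    pairConjFamily_apply, qPos_eq_complex, smul_eq_mul, mul_inv]
  ring

/-- The family `q(x i) / q((x i)_{Z⁺})`. -/
noncomputable def ratioFamily (Z : Fin n → ℂ) : BddFamily I :=
  M.qFamily x * Ring.inverse (M.qPosFamily x Z)

variable {x}

theorem q_eq_coord (v : V) : M.q v = (M.coord v).1 * (M.coord v).2.1
    + ∑ k, M.q (M.b k) * (M.coord v).2.2 k ^ 2 := by
  rw [q_eq]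
  congr 1
  refine Finset.sum_congr rfl fun k _ => ?_
  simp only [coord, LinearMap.coe_mk, AddHom.coe_mk]
  linear_combination (-(M.q (M.b k)) / 4 * M.bil v (M.b k) ^ 2) * M.eps_sq k

theorem pairPsi_eq_coord (v : V) (Z : Fin n → ℂ) : M.pairPsi v Z =
    (M.coord v).1 - (M.coord v).2.1 * M.qC Z
      + ∑ k, 2 * (M.q (M.b k) : ℂ) * (M.coord v).2.2 k * Z k := by
  rw [pairPsi_eq]
  congr 1
  refine Finset.sum_congr rfl fun k _ => ?_
  simp only [coord, LinearMap.coe_mk, AddHom.coe_mk]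
  push_cast
  linear_combination (-(M.bil v (M.b k) : ℂ) * Z k) * M.eps_sq_complex k

theorem coord_ne_zero {v : V} (hv : v ≠ 0) : M.coord v ≠ 0 :=
  fun h => hv (M.coord_injective (h.trans (map_zero _).symm))

/-- By homogeneity it is enough to treat the unit sphere intersected with q ≥ 0. This set is
compact, and the pairing has no zero on it by `q_neg_of_pairPsi_eq_zero`. -/
theorem exists_le_norm_pairPsi {Z : Fin n → ℂ} (hZ : 0 < M.qY Z) :
    ∃ δ > 0, ∀ v : V, 0 ≤ M.q v → δ * ‖M.coord v‖ ≤ ‖M.pairPsi v Z‖ := by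
  set S : Set (ℝ × ℝ × (Fin n → ℝ)) := Metric.sphere 0 1 ∩
    {p | 0 ≤ p.1 * p.2.1 + ∑ k, M.q (M.b k) * p.2.2 k ^ 2} with hS
  have hSc : IsCompact S := (isCompact_sphere _ _).inter_right
    (isClosed_le continuous_const (by fun_prop))
  set g : ℝ × ℝ × (Fin n → ℝ) → ℝ := fun p => ‖(p.1 : ℂ) - p.2.1 * M.qC Z
      + ∑ k, 2 * (M.q (M.b k) : ℂ) * p.2.2 k * Z k‖ with hg
  have hgc : Continuous g := by rw [hg]; fun_prop
  have hgv : ∀ v, g (M.coord v) = ‖M.pairPsi v Z‖ := fun v => by rw [pairPsi_eq_coord]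
  obtain ⟨δ, hδ, hδS⟩ : ∃ δ > 0, ∀ p ∈ S, δ ≤ g p := by
    rcases S.eq_empty_or_nonempty with h | h
    · exact ⟨1, one_pos, fun p hp => by rw [h] at hp; exact hp.elim⟩
    · obtain ⟨p, hp, hmin⟩ := hSc.exists_isMinOn h hgc.continuousOn
      refine ⟨g p, ?_, fun p' hp' => hmin hp'⟩
      rw [← M.coord_ofCoord p, hgv, gt_iff_lt, norm_pos_iff]
      intro h0
      have h1 := M.q_neg_of_pairPsi_eq_zero hZ h0 (by
        rw [q_eq_coord, coord_ofCoord]; exact hp.2)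
      have h2 := hp.1
      rw [← M.coord_ofCoord p, h1, map_zero] at h2
      simp at h2
  refine ⟨δ, hδ, fun v hv => ?_⟩
  rcases eq_or_ne v 0 with rfl | hv0
  · simp
  have hρ : 0 < ‖M.coord v‖ := norm_pos_iff.2 (M.coord_ne_zero hv0)
  have h1 := hδS (M.coord (‖M.coord v‖⁻¹ • v)) ⟨by
    rw [map_smul, mem_sphere_zero_iff_norm, norm_smul, norm_inv, norm_norm, inv_mul_cancel₀ hρ.ne'],
    by
      rw [Set.mem_ofPred_eq, ← q_eq_coord, QuadraticMap.map_smul]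
      exact smul_nonneg (mul_self_nonneg _) hv⟩
  rw [hgv, ← psi_apply, map_smul, norm_smul, norm_inv, norm_norm, psi_apply] at h1
  rwa [inv_mul_eq_div, le_div_iff₀ hρ] at h1

variable {m : ℝ} {Z : Fin n → ℂ}

theorem isUnit_pairFamily (hm : 0 < m) (hq : ∀ i, M.q (x i) = m) (hZ : 0 < M.qY Z) :
    IsUnit (M.pairFamily x Z) := by
  obtain ⟨δ, hδ, h⟩ := M.exists_le_norm_pairPsi hZ
  refine BddFamily.isUnit_of_le hδ fun i => ?_
  have hx : x i ≠ 0 := fun h0 => by have := hq i; rw [h0, map_zero] at this; linarith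
  have hρ : 0 < ‖M.coord (x i)‖ := norm_pos_iff.2 (M.coord_ne_zero hx)
  rw [pairFamily_apply, norm_div, Complex.norm_real, norm_norm, le_div_iff₀ hρ]
  exact h _ (by rw [hq]; exact hm.le)

theorem isUnit_qPosFamily (hm : 0 < m) (hq : ∀ i, M.q (x i) = m) (hZ : 0 < M.qY Z) :
    IsUnit (M.qPosFamily x Z) := by
  obtain ⟨δ, hδ, h⟩ := M.exists_le_norm_pairPsi hZ
  refine BddFamily.isUnit_of_le (δ := δ ^ 2 / (4 * M.qY Z)) (by positivity) fun i => ?_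
  have hx : x i ≠ 0 := fun h0 => by have := hq i; rw [h0, map_zero] at this; linarith
  have hρ : 0 < ‖M.coord (x i)‖ := norm_pos_iff.2 (M.coord_ne_zero hx)
  have h1 := h _ (by rw [hq]; exact hm.le : 0 ≤ M.q (x i))
  rw [qPosFamily_apply, qPos_eq, norm_div, Complex.norm_real, norm_pow, Complex.norm_real, norm_norm,
    Real.norm_of_nonneg (by have := Complex.normSq_nonneg (M.pairPsi (x i) Z); positivity),
    Complex.normSq_eq_norm_sq, le_div_iff₀ (by positivity), div_mul_eq_mul_div, ← mul_pow]
  gcongr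

theorem ratioFamily_apply (hm : 0 < m) (hq : ∀ i, M.q (x i) = m) (hZ : 0 < M.qY Z) (i : I) :
    M.ratioFamily x Z i = ((m / M.qPos (x i) Z : ℝ) : ℂ) := by
  have hx : x i ≠ 0 := fun h0 => by have := hq i; rw [h0, map_zero] at this; linarith
  have hρ : (‖M.coord (x i)‖ : ℂ) ≠ 0 := by
    exact_mod_cast (norm_pos_iff.2 (M.coord_ne_zero hx)).ne'
  rw [ratioFamily, lp.infty_coeFn_mul, Pi.mul_apply, qFamily_apply,
    BddFamily.inverse_apply (M.isUnit_qPosFamily hm hq hZ), qPosFamily_apply, hq, inv_div]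
  push_cast
  field_simp

theorem qPos_pos (hm : 0 < m) {v : V} (hq : M.q v = m) (hZ : 0 < M.qY Z) : 0 < M.qPos v Z := by
  have := M.qNeg_nonpos v hZ
  rw [qNeg_eq] at this
  linarith

theorem tendsto_normInv_of_summable {k : ℕ}
    (hs : Summable fun i => (‖M.coord (x i)‖ ^ k)⁻¹) :
    Filter.Tendsto (fun i => ‖M.coord (x i)‖⁻¹) Filter.cofinite (𝓝 0) := by
  have h := hs.tendsto_cofinite_zero
  rw [Metric.tendsto_nhds] at h ⊢
  intro ε hε
  filter_upwards [h (ε ^ k) (by positivity)] with i hi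
  rw [Real.dist_0_eq_abs, abs_of_nonneg (by positivity)] at hi ⊢
  rw [← inv_pow] at hi
  exact lt_of_pow_lt_pow_left₀ k hε.le hi

/-- Summability of the weights forces ‖x‖ → ∞, and q(x_{Z⁺}) grows like ‖x‖². The ratios tend to 0,
so being below 1 for each member already bounds their supremum away from 1. -/
theorem norm_ratioFamily_lt_one_iff (hm : 0 < m) (hq : ∀ i, M.q (x i) = m) {k : ℕ}
    (hs : Summable fun i => (‖M.coord (x i)‖ ^ k)⁻¹) (hZ : 0 < M.qY Z) :
    ‖M.ratioFamily x Z‖ < 1 ↔ ∀ i, m < M.qPos (x i) Z := by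
  have hpos : ∀ i, 0 < M.qPos (x i) Z := fun i => M.qPos_pos hm (hq i) hZ
  constructor
  · intro h i
    have h1 := (lp.norm_apply_le_norm ENNReal.top_ne_zero (M.ratioFamily x Z) i).trans_lt h
    rw [M.ratioFamily_apply hm hq hZ, Complex.norm_real, Real.norm_of_nonneg
      (div_nonneg hm.le (hpos i).le), div_lt_one (hpos i)] at h1
    exact h1
  · intro h
    obtain ⟨δ, hδ, hδ'⟩ := M.exists_le_norm_pairPsi hZ
    obtain ⟨r, hr0, hr1, hr⟩ := exists_lt_one_of_tendsto_cofinite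
      (f := fun i => m / M.qPos (x i) Z) (fun i => (div_lt_one (hpos i)).2 (h i)) (by
        have h1 := ((M.tendsto_normInv_of_summable hs).pow 2).const_mul
          (m * (4 * M.qY Z) / δ ^ 2)
        rw [zero_pow two_ne_zero, mul_zero] at h1
        refine squeeze_zero (fun i => div_nonneg hm.le (hpos i).le) (fun i => ?_) h1
        have hx : x i ≠ 0 := fun h0 => by have := hq i; rw [h0, map_zero] at this; linarith
        have hρ : 0 < ‖M.coord (x i)‖ := norm_pos_iff.2 (M.coord_ne_zero hx)
        have h2 := hδ' _ (by rw [hq]; exact hm.le : 0 ≤ M.q (x i))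
        have h3 : (δ * ‖M.coord (x i)‖) ^ 2 / (4 * M.qY Z) ≤ M.qPos (x i) Z := by
          rw [qPos_eq, Complex.normSq_eq_norm_sq]
          gcongr
        calc m / M.qPos (x i) Z ≤ m / ((δ * ‖M.coord (x i)‖) ^ 2 / (4 * M.qY Z)) := by gcongr
          _ = _ := by field_simp)
    refine (lp.norm_le_of_forall_le hr0 fun i => ?_).trans_lt hr1
    rw [M.ratioFamily_apply hm hq hZ, Complex.norm_real, Real.norm_of_nonneg
      (div_nonneg hm.le (hpos i).le)]
    exact hr i

end LatticeSetup

theorem BddFamily.analyticAt_smul_pow_mul_mul {I E : Type*} [NormedAddCommGroup E]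
    [NormedSpace ℝ E] {z : E} (c : ℂ) (k : ℕ) {A B C : E → BddFamily I} (hA : AnalyticAt ℝ A z)
    (hB : AnalyticAt ℝ B z) (hC : AnalyticAt ℝ C z) :
    AnalyticAt ℝ (fun z => c • (A z ^ k * B z * C z)) z :=
  analyticAt_const.fun_smul (((hA.fun_pow k).fun_mul hB).fun_mul hC)

section Coordinates

variable {n : ℕ}

theorem analyticAt_coord (k : Fin n) (Z : Fin n → ℂ) :
    AnalyticAt ℝ (fun Z : Fin n → ℂ => Z k) Z :=
  ContinuousLinearMap.analyticAt (ContinuousLinearMap.proj (R := ℝ) (φ := fun _ : Fin n => ℂ) k) Z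

theorem analyticAt_conj_coord (k : Fin n) (Z : Fin n → ℂ) :
    AnalyticAt ℝ (fun Z : Fin n → ℂ => conj (Z k)) Z :=
  ((Complex.conjCLE : ℂ →L[ℝ] ℂ).analyticAt _).comp (analyticAt_coord k Z)

theorem analyticAt_im_coord (k : Fin n) (Z : Fin n → ℂ) :
    AnalyticAt ℝ (fun Z : Fin n → ℂ => (((Z k).im : ℝ) : ℂ)) Z := by
  simp only [HasDbar.im_eq]
  exact analyticAt_const.mul ((analyticAt_coord k Z).sub (analyticAt_conj_coord k Z))

end Coordinates

/-! ### Analyticity of the families and normal convergence. -/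

namespace LatticeSetup

open Topology
open scoped ENNReal

variable {n : ℕ} [NeZero n] {V : Type*} [AddCommGroup V] [Module ℝ V] (M : LatticeSetup n V)
  {I : Type*} (x : I → V) {m : ℝ} {Z : Fin n → ℂ}

theorem analyticAt_qC (Z : Fin n → ℂ) : AnalyticAt ℝ M.qC Z := by
  unfold qC
  exact Finset.analyticAt_fun_sum _ fun k _ => analyticAt_const.mul ((analyticAt_coord k Z).pow 2)

theorem analyticAt_conj_qC (Z : Fin n → ℂ) : AnalyticAt ℝ (fun Z => conj (M.qC Z)) Z :=
  ((Complex.conjCLE : ℂ →L[ℝ] ℂ).analyticAt _).comp (M.analyticAt_qC Z)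

theorem analyticAt_qY (Z : Fin n → ℂ) : AnalyticAt ℝ (fun Z => (M.qY Z : ℂ)) Z := by
  simp only [qY_eq_complex]
  exact Finset.analyticAt_fun_sum _ fun k _ =>
    analyticAt_const.mul ((analyticAt_im_coord k Z).pow 2)

theorem analyticAt_qY_inv (hZ : 0 < M.qY Z) : AnalyticAt ℝ (fun Z => (M.qY Z : ℂ)⁻¹) Z :=
  (M.analyticAt_qY Z).inv (by exact_mod_cast hZ.ne')

theorem analyticAt_volDensity (hZ : 0 < M.qY Z) : AnalyticAt ℝ M.volDensity Z := by
  have h : M.volDensity = fun Z => ((4 * Complex.I)⁻¹ * (M.qY Z : ℂ)⁻¹) ^ n := by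
    funext Z
    rw [volDensity, one_div, ← mul_inv, inv_pow]
  rw [h]
  exact (analyticAt_const.mul (M.analyticAt_qY_inv hZ)).pow n

theorem analyticAt_pairFamily (Z : Fin n → ℂ) : AnalyticAt ℝ (M.pairFamily x) Z := by
  unfold pairFamily
  exact (analyticAt_const.sub ((M.analyticAt_qC Z).smul analyticAt_const)).add
    (Finset.analyticAt_fun_sum _ fun k _ => (analyticAt_coord k Z).smul analyticAt_const)

theorem analyticAt_pairConjFamily (Z : Fin n → ℂ) : AnalyticAt ℝ (M.pairConjFamily x) Z := by
  unfold pairConjFamily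
  exact (analyticAt_const.sub ((M.analyticAt_conj_qC Z).smul analyticAt_const)).add
    (Finset.analyticAt_fun_sum _ fun k _ => (analyticAt_conj_coord k Z).smul analyticAt_const)

theorem analyticAt_dPairFamily (k : Fin n) (Z : Fin n → ℂ) :
    AnalyticAt ℝ (fun Z => M.dPairFamily x Z k) Z := by
  unfold dPairFamily
  exact analyticAt_const.sub ((analyticAt_const.mul (analyticAt_conj_coord k Z)).smul
    analyticAt_const)

theorem analyticAt_qPosFamily (hZ : 0 < M.qY Z) : AnalyticAt ℝ (M.qPosFamily x) Z := by
  unfold qPosFamily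
  simp only [mul_inv]
  exact (analyticAt_const.mul (M.analyticAt_qY_inv hZ)).smul
    ((M.analyticAt_pairFamily x Z).mul (M.analyticAt_pairConjFamily x Z))

variable {x}

theorem analyticAt_ratioFamily (hm : 0 < m) (hq : ∀ i, M.q (x i) = m) (hZ : 0 < M.qY Z) :
    AnalyticAt ℝ (M.ratioFamily x) Z :=
  analyticAt_const.mul (BddFamily.analyticAt_inverse' (M.analyticAt_qPosFamily x hZ)
    (M.isUnit_qPosFamily hm hq hZ))

variable (x)

/-- The family `(1 - u)^(-n/2)` for the ratios `u`. -/
noncomputable def binomialFamily (Z : Fin n → ℂ) : BddFamily I :=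
  FormalMultilinearSeries.ofScalarsSum (fun l : ℕ => Ring.choose ((n : ℝ) / 2 + l - 1) l)
    (M.ratioFamily x Z)

/-- The family of the hypergeometric functions of the ratios. -/
noncomputable def hypergeometricFamily (k : ℕ) (Z : Fin n → ℂ) : BddFamily I :=
  FormalMultilinearSeries.ofScalarsSum (ordinaryHypergeometricCoefficient (1 - (n : ℝ) / 2)
    (k - (n : ℝ) / 2) (k - (n : ℝ) / 2 + 1)) (M.ratioFamily x Z)

/-- The normalized family of the radial factors. -/
noncomputable def radialFamily (k : ℕ) (Z : Fin n → ℂ) : BddFamily I :=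
  ((-((4 : ℂ) ^ k * (k - (n : ℂ) / 2)))⁻¹) • (Ring.inverse (M.qPosFamily x Z) ^ k *
    M.binomialFamily x Z * M.hypergeometricFamily x k Z)

variable {x}

theorem binomialFamily_apply [Nonempty I] (hm : 0 < m) (hq : ∀ i, M.q (x i) = m) (hZ : 0 < M.qY Z)
    (h1 : ‖M.ratioFamily x Z‖ < 1) (i : I) (h2 : m < M.qPos (x i) Z) :
    M.binomialFamily x Z i = ((1 / (1 - m / M.qPos (x i) Z) ^ ((n : ℝ) / 2) : ℝ) : ℂ) := by
  have hx : |m / M.qPos (x i) Z| < 1 := by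
    rw [abs_of_pos (div_pos hm (hm.trans h2)), div_lt_one (hm.trans h2)]; exact h2
  have e1 := BddFamily.ofScalarsSum_apply (one_le_radius_binomial ((n : ℝ) / 2))
    (one_le_radius_binomial ((n : ℝ) / 2)) h1 i (M.ratioFamily_apply hm hq hZ i)
  have e3 := (Real.one_div_one_sub_rpow_hasFPowerSeriesOnBall_zero ((n : ℝ) / 2)).sum
    (y := m / M.qPos (x i) Z) (by
      rw [Metric.mem_eball, edist_zero_right, enorm_eq_nnnorm]
      exact_mod_cast hx)
  rw [zero_add] at e3
  rw [binomialFamily, e1, e3]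
  rfl

theorem hypergeometricFamily_apply [Nonempty I] {k : ℕ} (hk : (n : ℝ) / 2 < k) (hm : 0 < m)
    (hq : ∀ i, M.q (x i) = m) (hZ : 0 < M.qY Z) (h1 : ‖M.ratioFamily x Z‖ < 1) (i : I) :
    M.hypergeometricFamily x k Z i = ((ordinaryHypergeometric (1 - (n : ℝ) / 2)
      (k - (n : ℝ) / 2) (k - (n : ℝ) / 2 + 1) (m / M.qPos (x i) Z) : ℝ) : ℂ) := by
  have hb : 0 < (k : ℝ) - (n : ℝ) / 2 := by linarith
  exact BddFamily.ofScalarsSum_apply (one_le_radius_hypergeometric (1 - (n : ℝ) / 2) hb)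
    (one_le_radius_hypergeometric (1 - (n : ℝ) / 2) hb) h1 i (M.ratioFamily_apply hm hq hZ i)

theorem radialFamily_apply [Nonempty I] {k : ℕ} (hk : (n : ℝ) / 2 < k) (hm : 0 < m)
    (hq : ∀ i, M.q (x i) = m) (hZ : 0 < M.qY Z) (h1 : ‖M.ratioFamily x Z‖ < 1) (i : I)
    (h2 : m < M.qPos (x i) Z) :
    M.radialFamily x k Z i
      = (‖M.coord (x i)‖ : ℂ) ^ (2 * k) * radial n (k : ℤ) m (M.qPos (x i) Z) := by
  have e : M.radialFamily x k Z i = (-((4 : ℂ) ^ k * (k - (n : ℂ) / 2)))⁻¹ *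
      (Ring.inverse (M.qPosFamily x Z) i ^ k * M.binomialFamily x Z i
        * M.hypergeometricFamily x k Z i) := by
    rw [radialFamily, lp.coeFn_smul, Pi.smul_apply, lp.infty_coeFn_mul, Pi.mul_apply,
      lp.infty_coeFn_mul, Pi.mul_apply, lp.infty_coeFn_pow, Pi.pow_apply, smul_eq_mul]
  rw [e, BddFamily.inverse_apply (M.isUnit_qPosFamily hm hq hZ), qPosFamily_apply,
    M.binomialFamily_apply hm hq hZ h1 i h2, M.hypergeometricFamily_apply hk hm hq hZ h1 i,
    radial_eq n _ hm h2, inv_div, div_pow, ← pow_mul]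
  push_cast
  rw [zpow_natCast, zpow_natCast, div_eq_mul_inv]
  ring

theorem analyticAt_binomialFamily [Nonempty I] (hr : AnalyticAt ℝ (M.ratioFamily x) Z)
    (h1 : ‖M.ratioFamily x Z‖ < 1) : AnalyticAt ℝ (fun Z => M.binomialFamily x Z) Z :=
  BddFamily.analyticAt_ofScalarsSum (one_le_radius_binomial _) hr h1

theorem analyticAt_hypergeometricFamily [Nonempty I] {k : ℕ} (hk : (n : ℝ) / 2 < k)
    (hr : AnalyticAt ℝ (M.ratioFamily x) Z) (h1 : ‖M.ratioFamily x Z‖ < 1) :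
    AnalyticAt ℝ (fun Z => M.hypergeometricFamily x k Z) Z :=
  BddFamily.analyticAt_ofScalarsSum (one_le_radius_hypergeometric _ (by linarith)) hr h1

theorem analyticAt_inverse_qPosFamily (hm : 0 < m) (hq : ∀ i, M.q (x i) = m) (hZ : 0 < M.qY Z) :
    AnalyticAt ℝ (fun Z => Ring.inverse (M.qPosFamily x Z)) Z :=
  BddFamily.analyticAt_inverse' (M.analyticAt_qPosFamily x hZ) (M.isUnit_qPosFamily hm hq hZ)

theorem analyticAt_radialFamily [Nonempty I] {k : ℕ} (hk : (n : ℝ) / 2 < k) (hm : 0 < m)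
    (hq : ∀ i, M.q (x i) = m) (hZ : 0 < M.qY Z) (h1 : ‖M.ratioFamily x Z‖ < 1) :
    AnalyticAt ℝ (fun Z => M.radialFamily x k Z) Z :=
  have hr := M.analyticAt_ratioFamily hm hq hZ
  BddFamily.analyticAt_smul_pow_mul_mul _ k (M.analyticAt_inverse_qPosFamily hm hq hZ)
    (M.analyticAt_binomialFamily hr h1) (M.analyticAt_hypergeometricFamily hk hr h1)

variable (x)

/-- The points outside the cycles of the members of a family of vectors of norm `m`. -/
def offCycles (m : ℝ) : Set (Fin n → ℂ) := {Z | 0 < M.qY Z ∧ ∀ i, m < M.qPos (x i) Z}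

variable {x}

/-- The set is described by the norm of one continuous map into the bounded families. This replaces
an argument on local finiteness of the cycles. -/
theorem isOpen_offCycles [Nonempty I] (hm : 0 < m) (hq : ∀ i, M.q (x i) = m) {k : ℕ}
    (hs : Summable fun i => (‖M.coord (x i)‖ ^ k)⁻¹) : IsOpen (M.offCycles x m) := by
  have h1 : M.offCycles x m
      = {Z | 0 < M.qY Z} ∩ (fun Z => ‖M.ratioFamily x Z‖) ⁻¹' Set.Iio 1 := by
    ext Z
    constructor
    · rintro ⟨h2, h3⟩
      exact ⟨h2, (M.norm_ratioFamily_lt_one_iff hm hq hs h2).2 h3⟩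
    · rintro ⟨h2, h3⟩
      exact ⟨h2, (M.norm_ratioFamily_lt_one_iff hm hq hs h2).1 h3⟩
  rw [h1]
  refine ContinuousOn.isOpen_inter_preimage (fun Z hZ => ?_)
    (isOpen_lt continuous_const M.continuous_qY) isOpen_Iio
  exact (M.analyticAt_ratioFamily hm hq hZ).continuousAt.norm.continuousWithinAt

/-- The weights of the series over a family of vectors. -/
theorem weight_nonneg (k : ℕ) (i : I) : 0 ≤ (‖M.coord (x i)‖ ^ k)⁻¹ := by positivity

/-- Counting powers of ‖x‖: κ − 1 from the pairing, −2κ from the radial factor and 1 from `pCoeff`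
leave the weight ‖x‖^(-κ). -/
theorem normalSeries_termCoeff [Nonempty I] {k : ℕ} (hk0 : k ≠ 0) (hk : (n : ℝ) / 2 < k)
    (hm : 0 < m) (hq : ∀ i, M.q (x i) = m) (hs : Summable fun i => (‖M.coord (x i)‖ ^ k)⁻¹)
    (j : Fin n) : NormalSeries (fun i Z => M.termCoeff k (x i) Z j) (M.offCycles x m) := by
  refine ⟨_, fun Z => (M.volDensity Z) • (M.pairFamily x Z ^ (k - 1) * M.radialFamily x k Z *
    ((Complex.I * ((Z j).im : ℂ)) • M.pairConjFamily x Z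
      - ((M.qY Z : ℂ) * M.q (M.b j)) • M.dPairFamily x Z j)), hs, M.weight_nonneg k,
    fun Z hZ => ?_, fun Z hZ i => ?_⟩
  · have h1 := (M.norm_ratioFamily_lt_one_iff hm hq hs hZ.1).2 hZ.2
    exact (M.analyticAt_volDensity hZ.1).smul ((((M.analyticAt_pairFamily x Z).pow _).mul
      (M.analyticAt_radialFamily hk hm hq hZ.1 h1)).mul
      (((analyticAt_const.mul (analyticAt_im_coord j Z)).smul
        (M.analyticAt_pairConjFamily x Z)).sub
        (((M.analyticAt_qY Z).mul analyticAt_const).smul (M.analyticAt_dPairFamily x j Z))))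
  · have h1 := (M.norm_ratioFamily_lt_one_iff hm hq hs hZ.1).2 hZ.2
    have hx : x i ≠ 0 := fun h0 => by have := hq i; rw [h0, map_zero] at this; linarith
    have hρ : (‖M.coord (x i)‖ : ℂ) ≠ 0 := by
      exact_mod_cast (norm_pos_iff.2 (M.coord_ne_zero hx)).ne'
    simp only [lp.coeFn_smul, lp.coeFn_sub, lp.infty_coeFn_mul, lp.infty_coeFn_pow, Pi.smul_apply,
      Pi.mul_apply, Pi.pow_apply, Pi.sub_apply, smul_eq_mul, pairFamily_apply,
      pairConjFamily_apply, dPairFamily_apply, M.radialFamily_apply hk hm hq hZ.1 h1 i (hZ.2 i)]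
    have h2 : ((k : ℤ) - 1) = ((k - 1 : ℕ) : ℤ) := by omega
    obtain ⟨l, rfl⟩ : ∃ l, k = l + 1 := ⟨k - 1, by omega⟩
    rw [termCoeff, pCoeff, h2, zpow_natCast, hq]
    push_cast
    simp only [div_pow]
    field_simp
    ring

theorem normalSeries_starCoeff [Nonempty I] {k : ℕ} (hk0 : k ≠ 0) (hk : (n : ℝ) / 2 < k)
    (hm : 0 < m) (hq : ∀ i, M.q (x i) = m) (hs : Summable fun i => (‖M.coord (x i)‖ ^ k)⁻¹)
    (j : Fin n) : NormalSeries (fun i Z => M.starCoeff k (x i) Z j) (M.offCycles x m) := by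
  refine ⟨_, fun Z => (((M.qY Z : ℂ)⁻¹ • M.pairConjFamily x Z) ^ (k - 1) * M.radialFamily x k Z *
    ((M.qY Z : ℂ)⁻¹ • M.dPairFamily x Z j - (Complex.I * M.q (M.b j) * ((Z j).im : ℂ)
      * (M.qY Z : ℂ)⁻¹ ^ 2) • M.pairConjFamily x Z)), hs, M.weight_nonneg k,
    fun Z hZ => ?_, fun Z hZ i => ?_⟩
  · have h1 := (M.norm_ratioFamily_lt_one_iff hm hq hs hZ.1).2 hZ.2
    have hY := M.analyticAt_qY_inv hZ.1
    exact ((((hY.smul (M.analyticAt_pairConjFamily x Z)).pow _).mul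
      (M.analyticAt_radialFamily hk hm hq hZ.1 h1)).mul
      ((hY.smul (M.analyticAt_dPairFamily x j Z)).sub
      (((analyticAt_const.mul (analyticAt_im_coord j Z)).mul (hY.pow 2)).smul
        (M.analyticAt_pairConjFamily x Z))))
  · have h1 := (M.norm_ratioFamily_lt_one_iff hm hq hs hZ.1).2 hZ.2
    have hx : x i ≠ 0 := fun h0 => by have := hq i; rw [h0, map_zero] at this; linarith
    have hρ : (‖M.coord (x i)‖ : ℂ) ≠ 0 := by
      exact_mod_cast (norm_pos_iff.2 (M.coord_ne_zero hx)).ne'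
    have hY : (M.qY Z : ℂ) ≠ 0 := by exact_mod_cast hZ.1.ne'
    simp only [lp.coeFn_smul, lp.coeFn_sub, lp.infty_coeFn_mul, lp.infty_coeFn_pow, Pi.smul_apply,
      Pi.mul_apply, Pi.pow_apply, Pi.sub_apply, smul_eq_mul,
      pairConjFamily_apply, dPairFamily_apply, M.radialFamily_apply hk hm hq hZ.1 h1 i (hZ.2 i)]
    have h2 : ((k : ℤ) - 1) = ((k - 1 : ℕ) : ℤ) := by omega
    obtain ⟨l, rfl⟩ : ∃ l, k = l + 1 := ⟨k - 1, by omega⟩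
    rw [starCoeff, betaCoeff, h2, zpow_natCast, hq]
    push_cast
    simp only [div_pow, mul_pow, inv_pow]
    field_simp
    ring

theorem normalSeries_pairPsi {k : ℕ} (hm : 0 < m) (hq : ∀ i, M.q (x i) = m)
    (hs : Summable fun i => (‖M.coord (x i)‖ ^ k)⁻¹) :
    NormalSeries (fun i Z => 1 / M.pairPsi (x i) Z ^ (k : ℤ)) {Z | 0 < M.qY Z} := by
  refine ⟨_, fun Z => Ring.inverse (M.pairFamily x Z) ^ k, hs, M.weight_nonneg k,
    fun Z hZ => ?_, fun Z hZ i => ?_⟩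
  · exact (BddFamily.analyticAt_inverse' (M.analyticAt_pairFamily x Z)
      (M.isUnit_pairFamily hm hq hZ)).pow k
  · have hx : x i ≠ 0 := fun h0 => by have := hq i; rw [h0, map_zero] at this; linarith
    have hρ : (‖M.coord (x i)‖ : ℂ) ≠ 0 := by
      exact_mod_cast (norm_pos_iff.2 (M.coord_ne_zero hx)).ne'
    rw [lp.infty_coeFn_pow, Pi.pow_apply,
      BddFamily.inverse_apply (M.isUnit_pairFamily hm hq hZ), pairFamily_apply, zpow_natCast]
    push_cast
    rw [inv_div, div_pow]
    field_simp

end LatticeSetup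

/-! ### Orbits, cosets and the regular set. -/

namespace LatticeSetup

open Topology

variable {n : ℕ} [NeZero n] {V : Type*} [AddCommGroup V] [Module ℝ V] (M : LatticeSetup n V)
  (Γ : Subgroup (V ≃ₗ[ℝ] V)) (μ : V) {Z : Fin n → ℂ}

section Orbit

/-- The vector `γ⁻¹ μ` attached to the class of `γ` in `Γ_μ \ Γ`. -/
noncomputable def orbitVec (c : Cosets Γ μ) : V := ((c.out : Γ) : V ≃ₗ[ℝ] V)⁻¹ μ

/-- The class of γ in Γ_μ \ Γ records exactly the vector γ⁻¹μ, so sums over cosets are sums over the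
orbit without repetition. -/
theorem rightRel_stabilizer_iff (a b : Γ) :
    QuotientGroup.rightRel (MulAction.stabilizer Γ μ) a b ↔
      (a : V ≃ₗ[ℝ] V)⁻¹ μ = (b : V ≃ₗ[ℝ] V)⁻¹ μ := by
  rw [QuotientGroup.rightRel_apply, MulAction.mem_stabilizer_iff, mul_smul, ← eq_inv_smul_iff]
  exact Iff.rfl

theorem orbitVec_mk (γ : Γ) :
    orbitVec Γ μ (Quotient.mk _ γ) = (γ : V ≃ₗ[ℝ] V)⁻¹ μ :=
  (rightRel_stabilizer_iff Γ μ _ _).1 (Quotient.mk_out (s := QuotientGroup.rightRel _) γ)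

theorem orbitVec_injective : Function.Injective (orbitVec Γ μ) := by
  intro c d h
  rw [← Quotient.out_eq c, ← Quotient.out_eq d]
  exact Quotient.sound ((rightRel_stabilizer_iff Γ μ _ _).2 h)

theorem exists_orbitVec_eq_inv (γ : Γ) (c : Cosets Γ μ) :
    ∃ d, orbitVec Γ μ d = (γ : V ≃ₗ[ℝ] V)⁻¹ (orbitVec Γ μ c) :=
  ⟨Quotient.mk _ ((c.out : Γ) * γ), by rw [orbitVec_mk, Subgroup.coe_mul, mul_inv_rev]; rfl⟩

/-- The action of `γ` on `Γ_μ \ Γ` by translation from the right. -/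
noncomputable def cosetsEquiv (γ : Γ) : Cosets Γ μ ≃ Cosets Γ μ :=
  Equiv.ofBijective (fun c => (exists_orbitVec_eq_inv Γ μ γ c).choose) <| by
    have key : ∀ c, orbitVec Γ μ (exists_orbitVec_eq_inv Γ μ γ c).choose
        = (γ : V ≃ₗ[ℝ] V)⁻¹ (orbitVec Γ μ c) :=
      fun c => (exists_orbitVec_eq_inv Γ μ γ c).choose_spec
    refine ⟨fun c d h => ?_, fun c => ?_⟩
    · refine orbitVec_injective Γ μ ((γ : V ≃ₗ[ℝ] V)⁻¹.injective ?_)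
      rw [← key c, ← key d]
      exact congrArg _ h
    · obtain ⟨d, hd⟩ := exists_orbitVec_eq_inv Γ μ γ⁻¹ c
      refine ⟨d, orbitVec_injective Γ μ ?_⟩
      rw [key d, hd, Subgroup.coe_inv, inv_inv, ← LinearEquiv.mul_apply, inv_mul_cancel]
      rfl

theorem orbitVec_cosetsEquiv (γ : Γ) (c : Cosets Γ μ) :
    orbitVec Γ μ (cosetsEquiv Γ μ γ c) = (γ : V ≃ₗ[ℝ] V)⁻¹ (orbitVec Γ μ c) :=
  (exists_orbitVec_eq_inv Γ μ γ c).choose_spec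

instance : Nonempty (Cosets Γ μ) := ⟨Quotient.mk _ 1⟩

variable {Γ μ}

theorem q_orbitVec (hΓ : ∀ γ ∈ Γ, M.InOPlus γ) (c : Cosets Γ μ) :
    M.q (orbitVec Γ μ c) = M.q μ :=
  M.q_inv (hΓ _ (c.out : Γ).2).1 μ

theorem smul_orbitVec_mem (hΓ : ∀ γ ∈ Γ, M.InOPlus γ) {N : ℕ} (hN : N • μ ∈ M.L)
    (c : Cosets Γ μ) : N • orbitVec Γ μ c ∈ M.L := by
  rw [← (hΓ _ (c.out : Γ).2).2.1, map_nsmul, orbitVec, ← LinearEquiv.mul_apply, mul_inv_cancel]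
  exact hN

theorem summable_norm_coord_orbitVec (hΓ : ∀ γ ∈ Γ, M.InOPlus γ) (hμ : M.IsRational μ)
    (hq : 0 < M.q μ) {k : ℕ} (hk : n + 1 ≤ k) :
    Summable fun c : Cosets Γ μ => (‖M.coord (orbitVec Γ μ c)‖ ^ k)⁻¹ := by
  obtain ⟨N, hN, hNμ⟩ := hμ
  have h := M.summable_norm_coord N hN (M.q μ) hq (k : ℝ) (by exact_mod_cast hk)
  have hinj : Function.Injective (fun c : Cosets Γ μ =>
      (⟨orbitVec Γ μ c, M.smul_orbitVec_mem hΓ hNμ c, M.q_orbitVec hΓ c⟩ :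
        {x : V // N • x ∈ M.L ∧ M.q x = M.q μ})) := fun c d hcd =>
    orbitVec_injective Γ μ (congrArg Subtype.val hcd)
  refine (h.comp_injective hinj).congr fun c => ?_
  simp only [Function.comp_apply]
  rw [Real.rpow_neg (norm_nonneg _), Real.rpow_natCast]

end Orbit

section RegularSet

theorem act_act_inv {σ : V ≃ₗ[ℝ] V} (hσ : ∀ x, M.q (σ x) = M.q x) (hZ : 0 < M.qY Z) :
    M.act σ (M.act σ⁻¹ Z) = Z := by
  have hσ' : ∀ x, M.q (σ⁻¹ x) = M.q x := M.q_inv hσ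
  have hW := M.qY_act_pos hσ' hZ
  have h1 := M.pairPsi_act hσ hW
  have h2 := M.pairPsi_act hσ' hZ
  have key : ∀ x, M.autFactor σ⁻¹ Z * (M.autFactor σ (M.act σ⁻¹ Z) *
      M.pairPsi x (M.act σ (M.act σ⁻¹ Z))) = M.pairPsi x Z := fun x => by
    rw [h1, h2, inv_inv, ← LinearEquiv.mul_apply, mul_inv_cancel]
    rfl
  have h3 := key M.e
  rw [← psi_apply, ← psi_apply, psi_e, psi_e, mul_one] at h3
  funext k
  have h4 := key (M.b k)
  rw [← mul_assoc, h3, one_mul, ← psi_apply, ← psi_apply, psi_b, psi_b] at h4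
  refine mul_left_cancel₀ (mul_ne_zero two_ne_zero ?_) h4
  exact left_ne_zero_of_mul_eq_one (M.eps_sq_complex k)

theorem isOpen_upperHalfPlane : IsOpen M.upperHalfPlane :=
  (isOpen_lt continuous_const M.continuous_qY).inter
    (isOpen_lt continuous_const (Complex.continuous_im.comp (continuous_apply 0)))

variable {Γ μ}

theorem mem_regularSet_iff (hΓ : ∀ γ ∈ Γ, M.InOPlus γ) :
    Z ∈ M.regularSet Γ μ ↔
      Z ∈ M.upperHalfPlane ∧ ∀ γ ∈ Γ, M.qNeg ((γ : V ≃ₗ[ℝ] V)⁻¹ μ) Z ≠ 0 := by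
  refine and_congr_right fun hZ => ?_
  rw [Set.mem_iUnion₂, not_exists]
  constructor
  · intro h γ hγ h0
    have hγ' := hΓ _ (inv_mem hγ)
    refine h γ⁻¹ ⟨inv_mem hγ, M.act γ Z, ⟨(hΓ γ hγ).2.2 Z hZ, ?_⟩, ?_⟩
    · rw [M.qNeg_act (hΓ γ hγ).1 hZ.1, h0]
    · simpa using M.act_act_inv hγ'.1 hZ.1
  · rintro h γ ⟨hγ, W, ⟨hW, hW0⟩, rfl⟩
    refine h γ⁻¹ (inv_mem hγ) ?_
    rw [M.qNeg_act (hΓ γ hγ).1 hW.1, inv_inv, ← LinearEquiv.mul_apply, inv_mul_cancel]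
    exact hW0

/-- Moving a cycle by γ replaces μ by γμ, and by negative semidefiniteness on the complement,
q(x_{Z⁻}) ≠ 0 means m < q(x_{Z⁺}). -/
theorem regularSet_eq (hΓ : ∀ γ ∈ Γ, M.InOPlus γ) :
    M.regularSet Γ μ = M.upperHalfPlane ∩ M.offCycles (orbitVec Γ μ) (M.q μ) := by
  ext Z
  rw [M.mem_regularSet_iff hΓ]
  refine and_congr_right fun hZ => ?_
  have key : ∀ γ ∈ Γ, M.q μ < M.qPos (γ⁻¹ μ) Z ↔ M.qNeg (γ⁻¹ μ) Z ≠ 0 := fun γ hγ => by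
    rw [← M.lt_qPos_iff _ hZ.1, M.q_inv (hΓ γ hγ).1]
  constructor
  · exact fun h => ⟨hZ.1, fun c => (key _ (c.out : Γ).2).2 (h _ (c.out : Γ).2)⟩
  · rintro ⟨-, h⟩ γ hγ
    have := h (Quotient.mk _ ⟨γ, hγ⟩)
    rw [orbitVec_mk] at this
    exact (key γ hγ).1 this

theorem act_mem_regularSet (hΓ : ∀ γ ∈ Γ, M.InOPlus γ) (hZ : Z ∈ M.regularSet Γ μ)
    {γ : V ≃ₗ[ℝ] V} (hγ : γ ∈ Γ) : M.act γ Z ∈ M.regularSet Γ μ := by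
  rw [M.mem_regularSet_iff hΓ] at hZ ⊢
  refine ⟨(hΓ γ hγ).2.2 Z hZ.1, fun δ hδ => ?_⟩
  rw [M.qNeg_act (hΓ γ hγ).1 hZ.1.1, ← LinearEquiv.mul_apply, ← mul_inv_rev]
  exact hZ.2 _ (mul_mem hδ hγ)

theorem isOpen_regularSet (hΓ : ∀ γ ∈ Γ, M.InOPlus γ) (hμ : M.IsRational μ) (hq : 0 < M.q μ) :
    IsOpen (M.regularSet Γ μ) := by
  rw [M.regularSet_eq hΓ]
  exact M.isOpen_upperHalfPlane.inter (M.isOpen_offCycles hq (M.q_orbitVec hΓ)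
    (M.summable_norm_coord_orbitVec hΓ hμ hq le_rfl))

end RegularSet

end LatticeSetup

namespace NormalSeries

theorem mono {I : Type*} {n : ℕ} {f : I → (Fin n → ℂ) → ℂ} {U U' : Set (Fin n → ℂ)}
    (hf : NormalSeries f U) (h : U' ⊆ U) : NormalSeries f U' := by
  obtain ⟨w, T, hw, hw0, hT, hfT⟩ := hf.exists_family
  exact ⟨w, T, hw, hw0, hT.mono h, fun Z hZ => hfT Z (h hZ)⟩

end NormalSeries

/-! ### The series Ω: convergence, type and invariance. -/

namespace LatticeSetup

open Topology

theorem half_lt_of_lt {n k : ℕ} (hk : n + 1 ≤ k) : (n : ℝ) / 2 < k := by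
  have : (n : ℝ) + 1 ≤ k := by exact_mod_cast hk
  have : (0 : ℝ) ≤ n := Nat.cast_nonneg n
  linarith

variable {n : ℕ} [NeZero n] {V : Type*} [AddCommGroup V] [Module ℝ V] (M : LatticeSetup n V)
  {Γ : Subgroup (V ≃ₗ[ℝ] V)} {μ : V} {Z : Fin n → ℂ} {k : ℕ}

section Terms

theorem slash_pTilde_of_mem (hΓ : ∀ γ ∈ Γ, M.InOPlus γ) (κ : ℤ) {γ : V ≃ₗ[ℝ] V} (hγ : γ ∈ Γ)
    (hZ : Z ∈ M.upperHalfPlane) (x : V) :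
    M.slash (-κ) γ (M.pTilde κ x) Z = M.pTilde κ (γ⁻¹ x) Z :=
  M.slash_pTilde κ (hΓ γ hγ).1 hZ.1 x

theorem OmegaTerm_eq_pTilde (hΓ : ∀ γ ∈ Γ, M.InOPlus γ) (κ : ℤ) (hZ : 0 < M.qY Z)
    (c : Cosets Γ μ) : M.OmegaTerm Γ κ μ c Z = M.pTilde κ (orbitVec Γ μ c) Z :=
  M.slash_pTilde κ (hΓ _ (c.out : Γ).2).1 hZ μ

theorem OmegaTerm_eq (hΓ : ∀ γ ∈ Γ, M.InOPlus γ) (κ : ℤ) (hZ : 0 < M.qY Z)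
    (c : Cosets Γ μ) :
    M.OmegaTerm Γ κ μ c Z = ∑ j, M.termCoeff κ (orbitVec Γ μ c) Z j • theta j := by
  rw [M.OmegaTerm_eq_pTilde hΓ κ hZ, M.pTilde_eq κ _ hZ]

theorem omegaTerm_eq (hΓ : ∀ γ ∈ Γ, M.InOPlus γ) (κ : ℤ) (hZ : 0 < M.qY Z)
    (c : Cosets Γ μ) : M.omegaTerm Γ κ μ c Z = 1 / M.pairPsi (orbitVec Γ μ c) Z ^ κ :=
  M.slashFun_pairPsi κ (hΓ _ (c.out : Γ).2).1 hZ μ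

end Terms

section Normal

theorem normalSeries_OmegaTerm (hΓ : ∀ γ ∈ Γ, M.InOPlus γ) (hμ : M.IsRational μ)
    (hq : 0 < M.q μ) (hk : n + 1 ≤ k) (j : Fin n) :
    NormalSeries (fun (c : Cosets Γ μ) Z => M.termCoeff k (orbitVec Γ μ c) Z j)
      (M.regularSet Γ μ) := by
  rw [M.regularSet_eq hΓ]
  exact (M.normalSeries_termCoeff (by omega) (half_lt_of_lt hk) hq (M.q_orbitVec hΓ)
    (M.summable_norm_coord_orbitVec hΓ hμ hq hk) j).mono Set.inter_subset_right

theorem normalSeries_starCoeff_orbitVec (hΓ : ∀ γ ∈ Γ, M.InOPlus γ) (hμ : M.IsRational μ)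
    (hq : 0 < M.q μ) (hk : n + 1 ≤ k) (j : Fin n) :
    NormalSeries (fun (c : Cosets Γ μ) Z => M.starCoeff k (orbitVec Γ μ c) Z j)
      (M.regularSet Γ μ) := by
  rw [M.regularSet_eq hΓ]
  exact (M.normalSeries_starCoeff (by omega) (half_lt_of_lt hk) hq (M.q_orbitVec hΓ)
    (M.summable_norm_coord_orbitVec hΓ hμ hq hk) j).mono Set.inter_subset_right

theorem normalSeries_omegaTerm (hΓ : ∀ γ ∈ Γ, M.InOPlus γ) (hμ : M.IsRational μ)
    (hq : 0 < M.q μ) (hk : n + 1 ≤ k) :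
    NormalSeries (fun (c : Cosets Γ μ) Z => 1 / M.pairPsi (orbitVec Γ μ c) Z ^ (k : ℤ))
      M.upperHalfPlane :=
  (M.normalSeries_pairPsi hq (M.q_orbitVec hΓ)
    (M.summable_norm_coord_orbitVec hΓ hμ hq hk)).mono fun _ hZ => hZ.1

theorem summable_omegaTerm (hΓ : ∀ γ ∈ Γ, M.InOPlus γ) (hμ : M.IsRational μ)
    (hq : 0 < M.q μ) (hk : n + 1 ≤ k) (hZ : Z ∈ M.upperHalfPlane) :
    Summable fun c => M.omegaTerm Γ k μ c Z := by
  simp only [M.omegaTerm_eq hΓ k hZ.1]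
  exact (M.normalSeries_omegaTerm hΓ hμ hq hk).summable hZ

theorem lt_qPos_orbitVec (hΓ : ∀ γ ∈ Γ, M.InOPlus γ) (hZ : Z ∈ M.regularSet Γ μ)
    (c : Cosets Γ μ) : M.q (orbitVec Γ μ c) < M.qPos (orbitVec Γ μ c) Z := by
  rw [M.regularSet_eq hΓ] at hZ
  rw [M.q_orbitVec hΓ]
  exact hZ.2.2 c

theorem exists_bound_OmegaTerm (hΓ : ∀ γ ∈ Γ, M.InOPlus γ) (hμ : M.IsRational μ)
    (hq : 0 < M.q μ) (hk : n + 1 ≤ k) (hZ : Z ∈ M.regularSet Γ μ) :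
    ∃ U ∈ 𝓝 Z, ∃ g : Cosets Γ μ → ℝ, Summable g ∧
      ∀ c, ∀ W ∈ U ∩ M.regularSet Γ μ, ‖M.OmegaTerm Γ k μ c W‖ ≤ g c := by
  have h := fun j => (M.normalSeries_OmegaTerm hΓ hμ hq hk j).exists_bound hZ
  choose U hU g hg hb using h
  refine ⟨⋂ j, U j, Filter.iInter_mem.2 hU, fun c => ∑ j, g j c * ‖theta (n := n) j‖,
    summable_sum fun j _ => (hg j).mul_right _, fun c W hW => ?_⟩
  rw [M.OmegaTerm_eq hΓ k hW.2.1.1]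
  refine (norm_sum_le _ _).trans (Finset.sum_le_sum fun j _ => ?_)
  rw [norm_smul]
  exact mul_le_mul_of_nonneg_right (hb j c W ⟨Set.mem_iInter.1 hW.1 j, hW.2⟩) (norm_nonneg _)

theorem hasSumLocallyUniformlyOn_OmegaTerm (hΓ : ∀ γ ∈ Γ, M.InOPlus γ) (hμ : M.IsRational μ)
    (hq : 0 < M.q μ) (hk : n + 1 ≤ k) :
    HasSumLocallyUniformlyOn (M.OmegaTerm Γ k μ) (M.OmegaCusp Γ k μ) (M.regularSet Γ μ) :=
  hasSumLocallyUniformlyOn_of_exists_bound fun _ hZ => M.exists_bound_OmegaTerm hΓ hμ hq hk hZ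

theorem summableLocallyUniformlyOn_norm_OmegaTerm (hΓ : ∀ γ ∈ Γ, M.InOPlus γ)
    (hμ : M.IsRational μ) (hq : 0 < M.q μ) (hk : n + 1 ≤ k) :
    SummableLocallyUniformlyOn (fun c Z => ‖M.OmegaTerm Γ k μ c Z‖) (M.regularSet Γ μ) := by
  refine (hasSumLocallyUniformlyOn_of_exists_bound fun Z hZ => ?_).summableLocallyUniformlyOn
  obtain ⟨U, hU, g, hg, hb⟩ := M.exists_bound_OmegaTerm hΓ hμ hq hk hZ
  exact ⟨U, hU, g, hg, fun c W hW => (norm_norm _).trans_le (hb c W hW)⟩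

theorem OmegaCusp_eq (hΓ : ∀ γ ∈ Γ, M.InOPlus γ) (hμ : M.IsRational μ)
    (hq : 0 < M.q μ) (hk : n + 1 ≤ k) (hZ : Z ∈ M.regularSet Γ μ) :
    M.OmegaCusp Γ k μ Z
      = ∑ j, (∑' c : Cosets Γ μ, M.termCoeff k (orbitVec Γ μ c) Z j) • theta j := by
  have h := fun j => (M.normalSeries_OmegaTerm hΓ hμ hq hk j).summable hZ
  rw [OmegaCusp, tsum_congr fun c => M.OmegaTerm_eq hΓ k hZ.1.1 c,
    Summable.tsum_finsetSum fun j _ => (h j).smul_const _]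
  exact Finset.sum_congr rfl fun j _ => (h j).tsum_smul_const _

theorem analyticOnNhd_OmegaCusp (hΓ : ∀ γ ∈ Γ, M.InOPlus γ) (hμ : M.IsRational μ)
    (hq : 0 < M.q μ) (hk : n + 1 ≤ k) :
    AnalyticOnNhd ℝ (M.OmegaCusp Γ k μ) (M.regularSet Γ μ) := by
  have hU := M.isOpen_regularSet hΓ hμ hq
  intro Z hZ
  have h1 : AnalyticAt ℝ (fun Z =>
      ∑ j, (∑' c : Cosets Γ μ, M.termCoeff k (orbitVec Γ μ c) Z j) • theta j) Z :=
    Finset.analyticAt_fun_sum _ fun j _ =>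
      ((M.normalSeries_OmegaTerm hΓ hμ hq hk j).analyticOnNhd hU Z hZ).smul analyticAt_const
  refine h1.congr ?_
  filter_upwards [hU.mem_nhds hZ] with W hW
  exact (M.OmegaCusp_eq hΓ hμ hq hk hW).symm

theorem isOfType_OmegaCusp (hΓ : ∀ γ ∈ Γ, M.InOPlus γ) (hμ : M.IsRational μ)
    (hq : 0 < M.q μ) (hk : n + 1 ≤ k) :
    Form.IsOfType n (n - 1) (M.OmegaCusp Γ k μ) (M.regularSet Γ μ) := by
  refine ⟨by have := NeZero.pos n; omega, fun Z hZ c v => ?_⟩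
  simp only [M.OmegaCusp_eq hΓ hμ hq hk hZ, ContinuousAlternatingMap.sum_apply,
    ContinuousAlternatingMap.smul_apply, theta_smul, Finset.mul_sum, smul_eq_mul]
  exact Finset.sum_congr rfl fun j _ => by ring

/-- The slash operator is linear and continuous at each point, so it passes through the sum, and γ
only permutes the orbit. -/
theorem slash_OmegaCusp (hΓ : ∀ γ ∈ Γ, M.InOPlus γ) (hμ : M.IsRational μ)
    (hq : 0 < M.q μ) (hk : n + 1 ≤ k) {γ : V ≃ₗ[ℝ] V} (hγ : γ ∈ Γ) (hZ : Z ∈ M.regularSet Γ μ) :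
    M.slash (-k) γ (M.OmegaCusp Γ k μ) Z = M.OmegaCusp Γ k μ Z := by
  have hW := M.act_mem_regularSet hΓ hZ hγ
  have hs : Summable fun c => M.OmegaTerm Γ k μ c (M.act γ Z) :=
    (M.hasSumLocallyUniformlyOn_OmegaTerm hΓ hμ hq hk).summableLocallyUniformlyOn.summable hW
  have h1 : ∀ c, M.slash (-k) γ (M.OmegaTerm Γ k μ c) Z
      = M.OmegaTerm Γ k μ (cosetsEquiv Γ μ ⟨γ, hγ⟩ c) Z := fun c => by
    rw [M.OmegaTerm_eq_pTilde hΓ k hZ.1.1, orbitVec_cosetsEquiv,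
      ← M.slash_pTilde_of_mem hΓ k hγ hZ.1, slash, slash, M.OmegaTerm_eq_pTilde hΓ k hW.1.1]
  have h2 : M.slash (-k) γ (M.OmegaCusp Γ k μ) Z
      = ∑' c, M.slash (-k) γ (M.OmegaTerm Γ k μ c) Z := by
    have h3 := (ContinuousAlternatingMap.compContinuousLinearMapCLM (ι := Fin (2 * n - 2 + 1))
      (F := ℂ) (fderiv ℝ (M.act γ) Z)).map_tsum hs
    simp only [ContinuousAlternatingMap.compContinuousLinearMapCLM_apply] at h3
    rw [slash, OmegaCusp, h3]
    exact (tsum_const_smul'' _).symm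
  rw [h2, tsum_congr h1, OmegaCusp]
  exact (cosetsEquiv Γ μ ⟨γ, hγ⟩).tsum_eq fun c => M.OmegaTerm Γ k μ c Z

end Normal

end LatticeSetup

/-! ### The images of Ω under ξ and the Laplace operator. -/

namespace LatticeSetup

open Topology

variable {n : ℕ} [NeZero n] {V : Type*} [AddCommGroup V] [Module ℝ V] (M : LatticeSetup n V)
  {Γ : Subgroup (V ≃ₗ[ℝ] V)} {μ : V} {Z : Fin n → ℂ} {k : ℕ}

theorem hasDbar_one_div_pairPsi_zpow (κ : ℤ) {x : V} (hx : 0 < M.q x) (hZ : 0 < M.qY Z) :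
    HasDbar (fun Z => 1 / M.pairPsi x Z ^ κ) (fun _ => 0) Z := by
  have h0 : M.pairPsi x Z ≠ 0 := fun h => by
    have h1 := M.qPos_pos hx rfl hZ
    have h2 := M.qPos_eq_complex x Z
    rw [h] at h2
    simp only [zero_mul, zero_div] at h2
    rw [Complex.ofReal_eq_zero] at h2
    exact h1.ne' h2
  simp only [one_div, ← zpow_neg]
  exact ((M.hasDbar_pairPsi x Z).zpow h0 (-κ)).congr_deriv (by funext k; ring)

theorem hodgeStar_eq_zero (p q : ℕ) {k l : ℕ} (h : k + l = 2 * n) {Φ : Form n k}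
    (hΦ : Φ Z = 0) : M.hodgeStar p q h Φ Z = 0 := by
  ext w
  rw [hodgeStar_apply, hΦ]
  simp

theorem hodgeStarWeight_eq_zero (κ : ℤ) (p q : ℕ) {k l : ℕ} (h : k + l = 2 * n) {Φ : Form n k}
    (hΦ : Φ Z = 0) : M.hodgeStarWeight κ p q h Φ Z = 0 := by
  ext w
  rw [hodgeStarWeight, M.hodgeStar_eq_zero p q h hΦ]
  exact mul_zero _

theorem hodgeStarWeight_top_eq_ofFun_xiTop (κ : ℤ) (Φ : Form n (2 * n - 2 + 1)) :
    M.hodgeStarWeight κ n n (l := 0) degree_eq Φ.dbar = Form.ofFun (M.xiTop κ Φ) := by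
  have hn : n - 1 + 1 = n := by have := NeZero.pos n; omega
  funext Z
  ext w
  have h1 : Form.ofFun (M.xiTop κ Φ) Z w
      = M.hodgeStarWeight κ n (n - 1 + 1) degree_eq (Form.dbar Φ) Z Fin.elim0 := rfl
  rw [h1, hn, Subsingleton.elim w Fin.elim0]

theorem hasDbar_omegaCusp (hΓ : ∀ γ ∈ Γ, M.InOPlus γ) (hμ : M.IsRational μ)
    (hq : 0 < M.q μ) (hk : n + 1 ≤ k) (hZ : Z ∈ M.upperHalfPlane) :
    HasDbar (M.omegaCusp Γ k μ) (fun _ => 0) Z := by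
  have h := ((M.normalSeries_omegaTerm hΓ hμ hq hk).hasDbar M.isOpen_upperHalfPlane hZ
    fun c => M.hasDbar_one_div_pairPsi_zpow k ((M.q_orbitVec hΓ c).symm ▸ hq) hZ.1).2
  simp only [tsum_zero] at h
  refine h.congr_of_eventuallyEq ?_
  filter_upwards [M.isOpen_upperHalfPlane.mem_nhds hZ] with W hW
  exact tsum_congr fun c => M.omegaTerm_eq hΓ k hW.1 c

theorem exists_hasDbar_OmegaCusp_coeff (hΓ : ∀ γ ∈ Γ, M.InOPlus γ) (hμ : M.IsRational μ)
    (hq : 0 < M.q μ) (hk : n + 1 ≤ k) (hZ : Z ∈ M.regularSet Γ μ) :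
    ∃ d : Fin n → Fin n → ℂ,
      (∀ j, HasDbar (fun Z => ∑' c : Cosets Γ μ, M.termCoeff k (orbitVec Γ μ c) Z j) (d j) Z) ∧
      ∑ j, d j j = ∑' c : Cosets Γ μ, M.termDiv k (orbitVec Γ μ c) Z := by
  have h := fun c : Cosets Γ μ => M.exists_hasDbar_termCoeff (κ := k)
    (by exact_mod_cast half_lt_of_lt hk) hZ.1.1 ((M.q_orbitVec hΓ c).symm ▸ hq)
    (M.lt_qPos_orbitVec hΓ hZ c)
  choose d hd hsum using h
  have h1 := fun j => (M.normalSeries_OmegaTerm hΓ hμ hq hk j).hasDbar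
    (M.isOpen_regularSet hΓ hμ hq) hZ fun c => hd c j
  refine ⟨_, fun j => (h1 j).2, ?_⟩
  simp only [← hsum]
  exact (Summable.tsum_finsetSum fun j _ => (h1 j).1 j).symm

theorem OmegaCusp_eventuallyEq (hΓ : ∀ γ ∈ Γ, M.InOPlus γ) (hμ : M.IsRational μ)
    (hq : 0 < M.q μ) (hk : n + 1 ≤ k) (hZ : Z ∈ M.regularSet Γ μ) :
    M.OmegaCusp Γ k μ =ᶠ[𝓝 Z]
      fun Z => ∑ j, (∑' c : Cosets Γ μ, M.termCoeff k (orbitVec Γ μ c) Z j) • theta j := by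
  filter_upwards [(M.isOpen_regularSet hΓ hμ hq).mem_nhds hZ] with W hW
  exact M.OmegaCusp_eq hΓ hμ hq hk hW

theorem xiTop_OmegaCusp (hΓ : ∀ γ ∈ Γ, M.InOPlus γ) (hμ : M.IsRational μ)
    (hq : 0 < M.q μ) (hk : n + 1 ≤ k) (hZ : Z ∈ M.regularSet Γ μ) :
    M.xiTop (-k) (M.OmegaCusp Γ k μ) Z = M.omegaCusp Γ k μ Z := by
  obtain ⟨d, hd, hsum⟩ := M.exists_hasDbar_OmegaCusp_coeff hΓ hμ hq hk hZ
  rw [M.xiTop_eq k hZ.1.1 hd _ (M.OmegaCusp_eventuallyEq hΓ hμ hq hk hZ), hsum, Complex.conj_tsum,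
    ← tsum_mul_right, ← tsum_mul_right, ← tsum_mul_right, ← tsum_mul_left, omegaCusp]
  exact tsum_congr fun c => by rw [M.omegaTerm_eq hΓ k hZ.1.1 c, M.conj_termDiv_mul k _ hZ.1.1]

theorem lowered_eq (κ : ℤ) (x : V) (hZ : 0 < M.qY Z) (j : Fin n) :
    M.lowered κ x Z j = M.starCoeff κ x Z j * ((M.qY Z : ℂ) ^ (κ - 1) *
      (conj (M.volDensity Z) * (1 / 2 * M.qY Z))) := by
  have h0 : (M.qY Z : ℂ) ^ (κ - 1) ≠ 0 := zpow_ne_zero _ (by exact_mod_cast hZ.ne')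
  rw [lowered, starCoeff, div_zpow]
  field_simp

theorem hodgeStarWeight_OmegaCusp (hΓ : ∀ γ ∈ Γ, M.InOPlus γ) (hμ : M.IsRational μ)
    (hq : 0 < M.q μ) (hk : n + 1 ≤ k) (hZ : Z ∈ M.regularSet Γ μ) :
    M.hodgeStarWeight (-k) n (n - 1) (degree_add_one n) (M.OmegaCusp Γ k μ) Z
      = ∑ j, (-∑' c : Cosets Γ μ, M.starCoeff k (orbitVec Γ μ c) Z j) • dzbar j := by
  have hs := fun j => (M.normalSeries_starCoeff_orbitVec hΓ hμ hq hk j).summable hZ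
  have hl : ∀ j, Summable fun c : Cosets Γ μ => M.lowered k (orbitVec Γ μ c) Z j := fun j => by
    simp only [M.lowered_eq k _ hZ.1.1]
    exact (hs j).mul_right _
  rw [M.hodgeStarWeight_eq k _ (x := fun j => ∑' c : Cosets Γ μ, M.lowered k (orbitVec Γ μ c) Z j)
    hZ.1.1 (M.OmegaCusp_eq hΓ hμ hq hk hZ)]
  · refine Finset.sum_congr rfl fun j _ => ?_
    rw [← tsum_mul_left, ← tsum_neg]
    congr 1
    exact tsum_congr fun c => M.lowered_mul k _ hZ.1.1 j
  · intro j
    simp only [raise_apply, ← tsum_mul_left]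
    rw [← Summable.tsum_finsetSum fun i _ => (hl i).mul_left _, Complex.conj_tsum]
    refine tsum_congr fun c => ?_
    rw [M.conj_raise_lowered k _ hZ.1.1 j, raise_apply]

/-- One half is ∂̄ of ξΩ = ω, which is holomorphic. The other half contains ∂̄ of the series of the
`starCoeff`, whose derivative matrix is symmetric term by term. -/
theorem laplace_OmegaCusp (hΓ : ∀ γ ∈ Γ, M.InOPlus γ) (hμ : M.IsRational μ)
    (hq : 0 < M.q μ) (hk : n + 1 ≤ k) (hZ : Z ∈ M.regularSet Γ μ) :
    M.laplace (-k) (M.OmegaCusp Γ k μ) Z = 0 := by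
  have hU := M.isOpen_regularSet hΓ hμ hq
  have h1 : (M.hodgeStarWeight (-k) n n (l := 0) degree_eq (M.OmegaCusp Γ k μ).dbar).dbar Z = 0 := by
    rw [hodgeStarWeight_top_eq_ofFun_xiTop]
    ext v
    have h2 : Form.ofFun (M.xiTop (-k) (M.OmegaCusp Γ k μ))
        =ᶠ[𝓝 Z] Form.ofFun (M.omegaCusp Γ k μ) := by
      filter_upwards [hU.mem_nhds hZ] with W hW
      simp only [Form.ofFun, M.xiTop_OmegaCusp hΓ hμ hq hk hW]
    rw [dbar_ofFun (M.hasDbar_omegaCusp hΓ hμ hq hk hZ.1) _ h2]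
    simp
  -- Needed on the whole open set rather than at Z alone, since another ∂̄ is applied afterwards.
  have h3 : ∀ W ∈ M.regularSet Γ μ, (M.hodgeStarWeight (-k) n (n - 1) (degree_add_one n)
      (M.OmegaCusp Γ k μ)).dbar W = 0 := by
    intro W hW
    have h := fun c : Cosets Γ μ => M.exists_hasDbar_starCoeff (κ := k)
      (by exact_mod_cast half_lt_of_lt hk) hW.1.1 ((M.q_orbitVec hΓ c).symm ▸ hq)
      (M.lt_qPos_orbitVec hΓ hW c)
    choose d hd hsymm using h
    refine dbar_sum_dzbar_eq_zero (fun j => ((M.normalSeries_starCoeff_orbitVec hΓ hμ hq hk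
      j).hasDbar hU hW fun c => hd c j).2.neg) (fun i j => ?_) _ ?_
    · rw [tsum_congr fun c => hsymm c i j]
    · filter_upwards [hU.mem_nhds hW] with W' hW'
      exact M.hodgeStarWeight_OmegaCusp hΓ hμ hq hk hW'
  rw [laplace, Pi.add_apply, M.hodgeStarWeight_eq_zero _ _ _ _ h1, zero_add]
  refine dbar_eq_zero_of_eventuallyEq ?_
  filter_upwards [hU.mem_nhds hZ] with W hW
  exact M.hodgeStarWeight_eq_zero _ _ _ _ (h3 W hW)

end LatticeSetup

/-! ### Conjugate linearity of ξ and the spans of the two families. -/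

theorem dbar_add {n k : ℕ} {Φ Ψ : Form n k} {Z : Fin n → ℂ} (hΦ : DifferentiableAt ℝ Φ Z)
    (hΨ : DifferentiableAt ℝ Ψ Z) : Form.dbar (Φ + Ψ) Z = Form.dbar Φ Z + Form.dbar Ψ Z := by
  ext v
  rw [ContinuousAlternatingMap.add_apply, dbar_apply, dbar_apply, dbar_apply, fderiv_add hΦ hΨ,
    ← Finset.sum_add_distrib]
  refine Finset.sum_congr rfl fun i _ => ?_
  simp only [conjLinearPart_apply, add_apply, ContinuousAlternatingMap.smul_apply,
    ContinuousAlternatingMap.add_apply, zsmul_eq_mul, smul_eq_mul]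
  ring

theorem dbar_smul {n k : ℕ} {Φ : Form n k} {Z : Fin n → ℂ} (c : ℂ)
    (hΦ : DifferentiableAt ℝ Φ Z) : Form.dbar (c • Φ) Z = c • Form.dbar Φ Z := by
  ext v
  rw [ContinuousAlternatingMap.smul_apply, dbar_apply, dbar_apply, fderiv_const_smul hΦ,
    Finset.smul_sum]
  refine Finset.sum_congr rfl fun i _ => ?_
  simp only [conjLinearPart_apply, smul_apply, ContinuousAlternatingMap.smul_apply,
    ContinuousAlternatingMap.add_apply, zsmul_eq_mul, smul_eq_mul]
  ring

namespace LatticeSetup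

variable {n : ℕ} [NeZero n] {V : Type*} [AddCommGroup V] [Module ℝ V] (M : LatticeSetup n V)
  (Γ : Subgroup (V ≃ₗ[ℝ] V)) {Z : Fin n → ℂ}

theorem xiTop_apply (κ : ℤ) (Φ : Form n (2 * n - 2 + 1)) (Z : Fin n → ℂ) :
    M.xiTop κ Φ Z
      = (M.qY Z : ℂ) ^ κ * M.hodgeStar n (n - 1 + 1) degree_eq Φ.dbar Z Fin.elim0 := rfl

theorem xiTop_add (κ : ℤ) {Φ Ψ : Form n (2 * n - 2 + 1)} (hΦ : DifferentiableAt ℝ Φ Z)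
    (hΨ : DifferentiableAt ℝ Ψ Z) :
    M.xiTop κ (Φ + Ψ) Z = M.xiTop κ Φ Z + M.xiTop κ Ψ Z := by
  simp only [xiTop_apply, hodgeStar_apply, dbar_add hΦ hΨ, ContinuousAlternatingMap.add_apply,
    map_add, add_mul, Finset.sum_add_distrib, mul_add]

theorem xiTop_smul (κ : ℤ) {Φ : Form n (2 * n - 2 + 1)} (c : ℂ) (hΦ : DifferentiableAt ℝ Φ Z) :
    M.xiTop κ (c • Φ) Z = conj c * M.xiTop κ Φ Z := by
  simp only [xiTop_apply, hodgeStar_apply, dbar_smul c hΦ, ContinuousAlternatingMap.smul_apply,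
    smul_eq_mul, map_mul, mul_assoc, ← Finset.mul_sum]
  ring

theorem xiTop_zero (κ : ℤ) (Z : Fin n → ℂ) : M.xiTop κ 0 Z = 0 := by
  have h : Form.dbar (0 : Form n (2 * n - 2 + 1)) Z = 0 := dbar_eq_zero_of_eventuallyEq .rfl
  rw [xiTop_apply, M.hodgeStar_eq_zero _ _ _ h]
  exact mul_zero _

/-- `Φ` is differentiable and `ξ_{-κ} Φ = f` on `ℍₙ` outside the `Γ`-translates of finitely many
cycles `C_μ`. -/
def DifferentiableXiEqOffCycles (κ : ℤ) (Φ : Form n (2 * n - 2 + 1)) (f : (Fin n → ℂ) → ℂ) :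
    Prop :=
  ∃ S : Finset V, (∀ μ ∈ S, M.IsRational μ ∧ 0 < M.q μ) ∧
    ∀ Z ∈ M.upperHalfPlane, (∀ μ ∈ S, Z ∈ M.regularSet Γ μ) →
      DifferentiableAt ℝ Φ Z ∧ M.xiTop (-κ) Φ Z = f Z

namespace DifferentiableXiEqOffCycles

variable {M Γ} {κ : ℤ} {Φ Ψ : Form n (2 * n - 2 + 1)} {f g : (Fin n → ℂ) → ℂ}

theorem xiEqOffCycles (h : M.DifferentiableXiEqOffCycles Γ κ Φ f) : M.XiEqOffCycles Γ κ Φ f := by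
  obtain ⟨S, hS, h⟩ := h
  exact ⟨S, hS, fun Z hZ hZS => (h Z hZ hZS).2⟩

theorem zero : M.DifferentiableXiEqOffCycles Γ κ 0 0 :=
  ⟨∅, by simp, fun Z _ _ => ⟨differentiableAt_const _, M.xiTop_zero _ Z⟩⟩

theorem add (hΦ : M.DifferentiableXiEqOffCycles Γ κ Φ f)
    (hΨ : M.DifferentiableXiEqOffCycles Γ κ Ψ g) :
    M.DifferentiableXiEqOffCycles Γ κ (Φ + Ψ) (f + g) := by
  classical
  obtain ⟨S, hS, h⟩ := hΦ
  obtain ⟨T, hT, h'⟩ := hΨ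
  refine ⟨S ∪ T, fun μ hμ => (Finset.mem_union.1 hμ).elim (hS μ) (hT μ), fun Z hZ hZST => ?_⟩
  obtain ⟨h1, h2⟩ := h Z hZ fun μ hμ => hZST μ (Finset.mem_union_left _ hμ)
  obtain ⟨h3, h4⟩ := h' Z hZ fun μ hμ => hZST μ (Finset.mem_union_right _ hμ)
  exact ⟨h1.add h3, by rw [M.xiTop_add _ h1 h3, h2, h4, Pi.add_apply]⟩

theorem smul (c : ℂ) (hΦ : M.DifferentiableXiEqOffCycles Γ κ Φ f) :
    M.DifferentiableXiEqOffCycles Γ κ (c • Φ) (conj c • f) := by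
  obtain ⟨S, hS, h⟩ := hΦ
  refine ⟨S, hS, fun Z hZ hZS => ?_⟩
  obtain ⟨h1, h2⟩ := h Z hZ hZS
  exact ⟨h1.const_smul c, by rw [M.xiTop_smul _ c h1, h2, Pi.smul_apply, smul_eq_mul]⟩

theorem of_OmegaCusp {k : ℕ} {μ : V} (hΓ : ∀ γ ∈ Γ, M.InOPlus γ) (hμ : M.IsRational μ)
    (hq : 0 < M.q μ) (hk : n + 1 ≤ k) :
    M.DifferentiableXiEqOffCycles Γ k (M.OmegaCusp Γ k μ) (M.omegaCusp Γ k μ) := by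
  refine ⟨{μ}, fun ν hν => ?_, fun Z _ hZ => ?_⟩
  · rw [Finset.mem_singleton.1 hν]
    exact ⟨hμ, hq⟩
  · have hZ' := hZ μ (Finset.mem_singleton_self μ)
    exact ⟨(M.analyticOnNhd_OmegaCusp hΓ hμ hq hk Z hZ').differentiableAt,
      M.xiTop_OmegaCusp hΓ hμ hq hk hZ'⟩

theorem exists_of_mem_HLoc {k : ℕ} (hΓ : ∀ γ ∈ Γ, M.InOPlus γ) (hk : n + 1 ≤ k)
    (hΦ : Φ ∈ M.HLoc Γ k) : ∃ f ∈ M.omegaSpace Γ k, M.DifferentiableXiEqOffCycles Γ k Φ f := by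
  induction hΦ using Submodule.span_induction with
  | mem Φ h =>
    obtain ⟨μ, hμ, hq, rfl⟩ := h
    exact ⟨_, Submodule.subset_span ⟨μ, hμ, hq, rfl⟩, of_OmegaCusp hΓ hμ hq hk⟩
  | zero => exact ⟨0, zero_mem _, zero⟩
  | add Φ Ψ _ _ h h' =>
    obtain ⟨f, hf, h⟩ := h
    obtain ⟨g, hg, h'⟩ := h'
    exact ⟨f + g, add_mem hf hg, h.add h'⟩
  | smul c Φ _ h =>
    obtain ⟨f, hf, h⟩ := h
    exact ⟨conj c • f, Submodule.smul_mem _ _ hf, h.smul c⟩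

theorem exists_of_mem_omegaSpace {k : ℕ} (hΓ : ∀ γ ∈ Γ, M.InOPlus γ) (hk : n + 1 ≤ k)
    (hf : f ∈ M.omegaSpace Γ k) : ∃ Φ ∈ M.HLoc Γ k, M.DifferentiableXiEqOffCycles Γ k Φ f := by
  induction hf using Submodule.span_induction with
  | mem f h =>
    obtain ⟨μ, hμ, hq, rfl⟩ := h
    exact ⟨_, Submodule.subset_span ⟨μ, hμ, hq, rfl⟩, of_OmegaCusp hΓ hμ hq hk⟩
  | zero => exact ⟨0, zero_mem _, zero⟩
  | add f g _ _ h h' =>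
    obtain ⟨Φ, hΦ, h⟩ := h
    obtain ⟨Ψ, hΨ, h'⟩ := h'
    exact ⟨Φ + Ψ, add_mem hΦ hΨ, h.add h'⟩
  | smul c f _ h =>
    obtain ⟨Φ, hΦ, h⟩ := h
    -- Since ξ is conjugate linear, the scalar has to be conjugated in the preimage.
    refine ⟨conj c • Φ, Submodule.smul_mem _ _ hΦ, ?_⟩
    have := h.smul (conj c)
    rwa [Complex.conj_conj] at this

end DifferentiableXiEqOffCycles

end LatticeSetup

theorem mainTheorem1 {n : ℕ} [NeZero n] {V : Type*} [AddCommGroup V] [Module ℝ V]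
    [Module.Finite ℝ V] (M : LatticeSetup n V) (Γ : Subgroup (V ≃ₗ[ℝ] V))
    (hΓ : M.IsNeatCongruenceSubgroup Γ) (κ : ℤ) (hκ : (n : ℤ) < κ) :
    (∀ μ : V, M.IsRational μ → 0 < M.q μ →
      (∀ γ ∈ Γ, ∀ Z ∈ M.upperHalfPlane,
        M.slash (-κ) γ (M.pTilde κ μ) Z = M.pTilde κ (γ⁻¹ μ) Z) ∧
      SummableLocallyUniformlyOn (fun c Z => ‖M.OmegaTerm Γ κ μ c Z‖) (M.regularSet Γ μ) ∧
      HasSumLocallyUniformlyOn (M.OmegaTerm Γ κ μ) (M.OmegaCusp Γ κ μ) (M.regularSet Γ μ) ∧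
      IsOpen (M.regularSet Γ μ) ∧
      AnalyticOnNhd ℝ (M.OmegaCusp Γ κ μ) (M.regularSet Γ μ) ∧
      Form.IsOfType n (n - 1) (M.OmegaCusp Γ κ μ) (M.regularSet Γ μ) ∧
      (∀ γ ∈ Γ, ∀ Z ∈ M.regularSet Γ μ,
        M.slash (-κ) γ (M.OmegaCusp Γ κ μ) Z = M.OmegaCusp Γ κ μ Z) ∧
      (∀ Z ∈ M.upperHalfPlane, Summable fun c => M.omegaTerm Γ κ μ c Z) ∧
      (∀ Z ∈ M.regularSet Γ μ,
        M.xiTop (-κ) (M.OmegaCusp Γ κ μ) Z = M.omegaCusp Γ κ μ Z) ∧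
      (∀ Z ∈ M.regularSet Γ μ, M.laplace (-κ) (M.OmegaCusp Γ κ μ) Z = 0)) ∧
    (∀ Φ ∈ M.HLoc Γ κ, ∃ f ∈ M.omegaSpace Γ κ, M.XiEqOffCycles Γ κ Φ f) ∧
    (∀ f ∈ M.omegaSpace Γ κ, ∃ Φ ∈ M.HLoc Γ κ, M.XiEqOffCycles Γ κ Φ f) := by
  have hO := hΓ.inOPlus
  -- From here on κ is a natural number, so that powers can be taken in the algebra of bounded
  -- families.
  lift κ to ℕ using (Nat.cast_nonneg n).trans hκ.le with k
  have hk : n + 1 ≤ k := by exact_mod_cast hκ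
  refine ⟨fun μ hμ hq => ⟨fun γ hγ Z hZ => M.slash_pTilde_of_mem hO k hγ hZ μ,
    M.summableLocallyUniformlyOn_norm_OmegaTerm hO hμ hq hk,
    M.hasSumLocallyUniformlyOn_OmegaTerm hO hμ hq hk,
    M.isOpen_regularSet hO hμ hq,
    M.analyticOnNhd_OmegaCusp hO hμ hq hk,
    M.isOfType_OmegaCusp hO hμ hq hk,
    fun γ hγ Z hZ => M.slash_OmegaCusp hO hμ hq hk hγ hZ,
    fun Z hZ => M.summable_omegaTerm hO hμ hq hk hZ,
    fun Z hZ => M.xiTop_OmegaCusp hO hμ hq hk hZ,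
    fun Z hZ => M.laplace_OmegaCusp hO hμ hq hk hZ⟩, fun Φ hΦ => ?_, fun f hf => ?_⟩
  · obtain ⟨f, hf, h⟩ :=
      LatticeSetup.DifferentiableXiEqOffCycles.exists_of_mem_HLoc hO hk hΦ
    exact ⟨f, hf, h.xiEqOffCycles⟩
  · obtain ⟨Φ, hΦ, h⟩ :=
      LatticeSetup.DifferentiableXiEqOffCycles.exists_of_mem_omegaSpace hO hk hf
    exact ⟨Φ, hΦ, h.xiEqOffCycles⟩
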